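/- **Setting.** Write $x\cdot y=x_0y_0-\sum_{k=1}^3x_ky_k=(x,\eta y)$ on $\mathbb R^4$, $p\,\theta\,q:=(p,\eta\theta\eta q)$, and $\tilde f(p)=(2\pi)^{-2}\int d^4x\,f(x)e^{-ip\cdot x}$ (and likewise, with $(2\pi)^{-2n}$, in $n$ variables). Let $\mathscr S_K=\mathscr S(\mathbb R^4)^{\oplus K}$, and let $\mathscr S_K^{(n)}$ be the Schwartz functions on $\mathbb R^{4n}$ with components indexed by $\{1,\dots,K\}^n$. *The undeformed theory.* Let $\mathcal H$ be a separable Hilbert space with a strongly continuous unitary representation $U$ of the translations $\mathbb R^4$ and a $U$-invariant unit vector $\Omega$. Let $\phi(f)$, $f\in\mathscr S_K$, be fields, linear in $f$, defined on a dense, $U$-invariant subspace $\mathcal D\ni\Omega$ that is stable under all $\phi(f)$, such that $f\mapsto\langle\Psi,\phi(f)\Psi'\rangle$ is a tempered distribution for $\Psi,\Psi'\in\mathcal D$, $U(y)\phi(f)U(y)^{-1}=\phi(f(\cdot-y))$ on $\mathcal D$, and $\phi(f)^*\supset\phi(f^*)$ with $f^*(x)_k=\overline{f(x)_{\bar k}}$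 for an involution $k\mapsto\bar k$ of $\{1,\dots,K\}$. Let $\Psi^n:\mathscr S_K^{(n)}\to\mathcal H$ be the continuous linear maps with $\Psi^n(f_1\otimes\cdots\otimes f_n)=\phi(f_1)\cdots\phi(f_n)\Omega$; the domain is $\mathcal D=\mathrm{span}\{\Psi^n(F):n\ge0,\,F\in\mathscr S_K^{(n)}\}$. Put $\omega_n(F)=\langle\Omega,\Psi^n(F)\rangle$, with distributional Fourier transform $\tilde\omega_n$, so that $\omega_n(F)=\sum_{\boldsymbol k}\int d^{4n}p\;\tilde\omega_n(-p)_{\boldsymbol k}\tilde F(p)_{\boldsymbol k}$. (Every Wightman theory is of this kind; Lorentz covariance, the spectrum condition and locality are not needed.) *Noncommutative Minkowski space.* Let $\kappa_e,\kappa_m\in\mathbb R$ be not both zero, and let $\Sigma\subset\mathbb R^{16}$ be the submanifold of real antisymmetric $4\times4$ matrices $\theta$ with $\theta_{\mu\nu}\theta^{\mu\nu}=2(\kappa_m^2-\kappa_e^2)$ and $\varepsilon_{\mu\nu\alpha\beta}\theta^{\mu\nu}\theta^{\alpha\beta}=-8\kappa_e\kappa_m$ ($\varepsilon_{0123}=1$),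 with its induced (four-dimensional Euclidean surface) measure $d\sigma$. It contains the matrix $\theta_1$ whose only non-zero entries are $(\theta_1)_{01}=-(\theta_1)_{10}=\kappa_e$ and $(\theta_1)_{23}=-(\theta_1)_{32}=\kappa_m$. Let $\theta\mapsto\Lambda_\theta$ be a Borel map, bounded on compact sets, from $\Sigma$ to the proper orthochronous Lorentz group with $\Lambda_\theta\theta_1\Lambda_\theta^T=\theta$. With $\hat x=(s_1,-i\kappa_e\partial_{s_1},s_2,-i\kappa_m\partial_{s_2})$, put $(X_\mu v)(s,\theta)=((\Lambda_\theta\hat x)_\mu v)(s,\theta)$ for functions $v$ on $\mathbb R^2\times\Sigma$, and let $e^{ip\cdot X}$ be the unitary generated by $p\cdot X$. *The deformed fields.* Let $\underline{\mathscr S}^\otimes$ be the space of terminating sequences $\boldsymbol g=(\boldsymbol g^0,\boldsymbol g^1,\dots)$, where $\boldsymbol g^n$ assigns to each $\theta\in\Sigma$ a Schwartz function $(s,x)\mapsto\boldsymbol g^n_{s,\theta}(x)$ of $(s,x)\in\mathbb R^2\times\mathbb R^{4n}$ with components indexed by $\{1,\dots,K\}^n$, depending on $\theta$ in a Borel measurable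 way, bounded in each Schwartz seminorm uniformly in $\theta$, and vanishing for $\theta$ outside a compact subset of $\Sigma$. Put $\Psi^\otimes(\boldsymbol g)(s,\theta)=\sum_n\Psi^n(\boldsymbol g^n_{s,\theta})$ and $\mathcal D^\otimes=\mathrm{span}\{\Psi^\otimes(\boldsymbol g):\boldsymbol g\in\underline{\mathscr S}^\otimes\}$. For $f\in\mathscr S_K$ define $f\times\boldsymbol g$ by $(f\times\boldsymbol g)^0=0$ and $$\widetilde{(f\times\boldsymbol g)^{n}_{s,\theta}}(p_1,\dots,p_n)_{k\boldsymbol l}=\tilde f(p_1)_k\,\widetilde{(e^{ip_1\cdot X}\boldsymbol g)^{n-1}_{s,\theta}}(p_2,\dots,p_n)_{\boldsymbol l}\qquad(n\ge1),$$ and define the Weyl–Wigner deformed field by $\phi^\otimes(f)\Psi^\otimes(\boldsymbol g)=\Psi^\otimes(f\times\boldsymbol g)$. **Proposition.** (a) For $f\in\mathscr S_K$ and $\boldsymbol g\in\underline{\mathscr S}^\otimes$ one has $\Psi^\otimes(\boldsymbol g)\in L^2(\mathbb R^2\times\Sigma\to\mathcal H)\cong L^2(\mathbb R^2\times\Sigma)\otimes\mathcal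 H$, and $f\times\boldsymbol g$ exists, uniquely, in $\underline{\mathscr S}^\otimes$. The span of the vectors $v\otimes\Psi^n(F)$ with $v\in C_0^\infty(\mathbb R^2\times\Sigma)$, $n\ge0$, $F\in\mathscr S_K^{(n)}$ is contained in $\mathcal D^\otimes$ and dense; in particular $\mathcal D^\otimes$ is dense. Each $\phi^\otimes(f)$ is a well-defined linear operator with domain $\mathcal D^\otimes$, and leaves $\mathcal D^\otimes$ invariant. (b) $\phi^\otimes(f)^*\supset\phi^\otimes(f^*)$ for all $f\in\mathscr S_K$. (c) For $v\in C_0^\infty(\mathbb R^2\times\Sigma)$, $n\ge0$ and $f_1,\dots,f_n\in\mathscr S_K$, $$\langle v\otimes\Omega,\ \phi^\otimes(f_1)\cdots\phi^\otimes(f_n)\,v\otimes\Omega\rangle=\sum_{\boldsymbol k}\int ds\,d\sigma(\theta)\int d^{4n}p\;\tilde\omega_n(-p)_{\boldsymbol k}\prod_{j=1}^n\tilde f_j(p_j)_{k_j}\prod_{l<r}e^{-\frac i2p_l\theta p_r}\,|v(s,\theta)|^2,$$ where the $p$-integral, summed over $\boldsymbol k$, denotes $\omega_n(F_\theta)$ for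 the $F_\theta\in\mathscr S_K^{(n)}$ with $\tilde F_\theta(p)_{\boldsymbol k}=\prod_j\tilde f_j(p_j)_{k_j}\prod_{l<r}e^{-\frac i2p_l\theta p_r}$, and the integral over $(s,\theta)$ converges absolutely. -/

import Mathlib

open MeasureTheory
open scoped SchwartzMap ContDiff InnerProductSpace

noncomputable section

namespace WeylWigner

/-! ### Minkowski space and multi-component test functions -/

/-- Four-dimensional Minkowski space, as a vector space (points and momenta). -/
abbrev Mink : Type := EuclideanSpace ℝ (Fin 4)

/-- The diagonal entries of the Minkowski metric `η = diag(1,-1,-1,-1)`. -/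
def eta (μ : Fin 4) : ℝ := if μ = 0 then 1 else -1

/-- The Minkowski inner product `x · y = x₀y₀ - x₁y₁ - x₂y₂ - x₃y₃`. -/
def mdot (x y : Mink) : ℝ := ∑ μ, eta μ * x μ * y μ

/-- `p θ q = (p, η θ η q)`. -/
def twist (θ : Matrix (Fin 4) (Fin 4) ℝ) (p q : Mink) : ℝ :=
  ∑ μ, ∑ ν, (eta μ * p μ) * θ μ ν * (eta ν * q ν)

/-- The space of `K`-component Schwartz functions of one spacetime variable. -/
abbrev Test (K : ℕ) : Type := 𝓢(Mink, Fin K → ℂ)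

/-- Schwartz functions of `n` spacetime variables, with components labelled by
multi-indices in `{1,…,K}ⁿ`. -/
abbrev TestN (K n : ℕ) : Type := 𝓢(Fin n → Mink, (Fin n → Fin K) → ℂ)

/-- The Fourier transform `f̃(p) = (2π)⁻² ∫ d⁴x f(x) e^{-ip·x}`, componentwise. -/
def fourier {K : ℕ} (f : Test K) (p : Mink) (k : Fin K) : ℂ :=
  (((2 * Real.pi) ^ 2)⁻¹ : ℝ) *
    ∫ x : Mink, f x k * Complex.exp (-Complex.I * (mdot p x : ℝ))

/-- The Fourier transform in all `n` variables, componentwise. -/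
def fourierN {K n : ℕ} (F : TestN K n) (p : Fin n → Mink) (k : Fin n → Fin K) : ℂ :=
  (((2 * Real.pi) ^ (2 * n))⁻¹ : ℝ) *
    ∫ x : Fin n → Mink, F x k * Complex.exp (-Complex.I * (∑ j, mdot (p j) (x j) : ℝ))

/-- `F = f₁ ⊗ ⋯ ⊗ fₙ`. -/
def IsTensor {K n : ℕ} (f : Fin n → Test K) (F : TestN K n) : Prop :=
  ∀ x k, F x k = ∏ j, f j (x j) (k j)

/-- The antilinear map `(c_k) ↦ (conj c_{bar k})` on components. -/
def conjComponents {K : ℕ} (bar : Fin K → Fin K) : (Fin K → ℂ) →L[ℝ] (Fin K → ℂ) :=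
  ContinuousLinearMap.pi fun k =>
    (Complex.conjCLE : ℂ →L[ℝ] ℂ).comp (ContinuousLinearMap.proj (bar k))

/-- `f*(x)_k = conj (f(x)_{bar k})`. -/
def starTest {K : ℕ} (bar : Fin K → Fin K) (f : Test K) : Test K :=
  SchwartzMap.postcompCLM (conjComponents bar) f

/-! ### The undeformed quantum field theory -/

/-- A theory of `K` quantum fields in the Wightman framework, with the properties that refer to
translations only: a strongly continuous unitary representation `U` of the translations with an
invariant unit vector `Ω`, and operator-valued tempered distributions `φ` on a dense, stable,
`U`-invariant domain `D ∋ Ω`, closed under taking adjoints and translation covariant. The domain is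
the one generated from the vacuum by the vector-valued tempered distributions `Ψⁿ`, where `Ψⁿ` is
the continuous linear map on the `n`-variable test functions with
`Ψⁿ(f₁ ⊗ ⋯ ⊗ fₙ) = φ(f₁) ⋯ φ(fₙ) Ω`. -/
structure Theory (K : ℕ) (H : Type*) [NormedAddCommGroup H] [InnerProductSpace ℂ H] where
  U : Mink → H ≃ₗᵢ[ℂ] H
  U_add : ∀ x y v, U (x + y) v = U x (U y v)
  U_continuous : ∀ v, Continuous fun x => U x v
  Ω : H
  norm_Ω : ‖Ω‖ = 1
  U_Ω : ∀ x, U x Ω = Ω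
  /-- The common domain of the fields. -/
  D : Submodule ℂ H
  D_dense : Dense (D : Set H)
  Ω_mem : Ω ∈ D
  U_mem : ∀ x, ∀ v ∈ D, U x v ∈ D
  /-- The fields, `φ(f) = ∑ₖ φₖ(fₖ)`. -/
  φ : Test K →ₗ[ℂ] (D →ₗ[ℂ] D)
  φ_tempered : ∀ v w : D, Continuous fun f => ⟪(v : H), (φ f w : H)⟫_ℂ
  φ_covariant : ∀ x f (v : D),
    U x (φ f v : H) = (φ (SchwartzMap.compSubConstCLM ℂ x f) ⟨U x v, U_mem x v v.2⟩ : H)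
  /-- The index of the adjoint field, `φₖ(f)* = φ_{bar k}(conj f)` on `D`. -/
  bar : Fin K → Fin K
  bar_bar : ∀ k, bar (bar k) = k
  φ_adjoint : ∀ f (v w : D), ⟪(v : H), (φ f w : H)⟫_ℂ = ⟪(φ (starTest bar f) v : H), (w : H)⟫_ℂ
  Ψ : ∀ n, TestN K n →L[ℂ] H
  Ψ_tensor : ∀ n (f : Fin n → Test K) (F : TestN K n), IsTensor f F →
    Ψ n F = ((List.ofFn f).foldr (fun g v => φ g v) ⟨Ω, Ω_mem⟩ : D)
  D_eq : D = Submodule.span ℂ {v | ∃ n F, v = Ψ n F}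

/-- The `n`-point functions `ωₙ(F) = ⟨Ω, Ψⁿ(F)⟩`. -/
def Theory.npoint {K : ℕ} {H : Type*} [NormedAddCommGroup H] [InnerProductSpace ℂ H]
    (T : Theory K H) (n : ℕ) (F : TestN K n) : ℂ := ⟪T.Ω, T.Ψ n F⟫_ℂ

/-! ### Noncommutative Minkowski space -/

/-- The space `ℝ¹⁶` of real `4 × 4` matrices with its Euclidean metric. -/
abbrev MatSpace : Type := EuclideanSpace ℝ (Fin 4 × Fin 4)

/-- A point of `ℝ¹⁶` as a matrix; its entries are the components `θ_{μν}` with lower indices. -/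
def toMat (θ : MatSpace) : Matrix (Fin 4) (Fin 4) ℝ := Matrix.of fun μ ν => θ (μ, ν)

/-- `θ^{μν}`: both indices raised with the Minkowski metric. -/
def raise (θ : Matrix (Fin 4) (Fin 4) ℝ) (μ ν : Fin 4) : ℝ := eta μ * θ μ ν * eta ν

/-- The reference matrix `θ₁`. -/
def thetaRef (κe κm : ℝ) : Matrix (Fin 4) (Fin 4) ℝ :=
  !![0, κe, 0, 0; -κe, 0, 0, 0; 0, 0, 0, κm; 0, 0, -κm, 0]

/-- The joint spectrum `Σ` of the commutators: antisymmetric matrices `θ` with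
`θ_{μν}θ^{μν} = 2(κm² - κe²)` and `ε_{μναβ}θ^{μν}θ^{αβ} = -8 κe κm`, where `ε_{0123} = 1`. -/
def Spec (κe κm : ℝ) : Set MatSpace :=
  {θ | (toMat θ).transpose = -toMat θ ∧
    ∑ μ, ∑ ν, toMat θ μ ν * raise (toMat θ) μ ν = 2 * (κm ^ 2 - κe ^ 2) ∧
    ∑ τ : Equiv.Perm (Fin 4), (Equiv.Perm.sign τ : ℝ) *
      (raise (toMat θ) (τ 0) (τ 1) * raise (toMat θ) (τ 2) (τ 3)) = -8 * κe * κm}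

/-- The proper orthochronous Lorentz transformations. -/
def IsLorentz (L : Matrix (Fin 4) (Fin 4) ℝ) : Prop :=
  L.transpose * Matrix.diagonal eta * L = Matrix.diagonal eta ∧ L.det = 1 ∧ 0 < L 0 0

/-- A choice `θ ↦ Λ_θ` of proper orthochronous Lorentz transformations with
`Λ_θ θ₁ Λ_θᵀ = θ`, Borel measurable and bounded on compact sets. -/
structure IsFrame (κe κm : ℝ) (Λ : Spec κe κm → Matrix (Fin 4) (Fin 4) ℝ) : Prop where
  lorentz : ∀ θ, IsLorentz (Λ θ)
  conj : ∀ θ, Λ θ * thetaRef κe κm * (Λ θ).transpose = toMat θ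
  measurable : ∀ μ ν, Measurable fun θ => Λ θ μ ν
  bounded : ∀ C : Set (Spec κe κm), IsCompact C → ∃ B, ∀ θ ∈ C, ∀ μ ν, |Λ θ μ ν| ≤ B

/-- The plane `ℝ²` of the variable `s = (s₁, s₂)`. -/
abbrev Plane : Type := EuclideanSpace ℝ (Fin 2)

/-- The measure `d²s × dσ(θ)` on `ℝ² × Σ`; here `dσ` is the measure of `Σ` as a four-dimensional
submanifold of `ℝ¹⁶`, i.e. its four-dimensional Euclidean Hausdorff measure. -/
def specMeasure (κe κm : ℝ) : Measure (Plane × Spec κe κm) :=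
  (volume : Measure Plane).prod (μHE[4] : Measure (Spec κe κm))

/-- The Schrödinger operators `x̂₀ = s₁`, `x̂₁ = -iκe ∂_{s₁}`, `x̂₂ = s₂`, `x̂₃ = -iκm ∂_{s₂}`. -/
def xhat (κe κm : ℝ) (μ : Fin 4) (w : Plane → ℂ) (s : Plane) : ℂ :=
  match μ with
  | 0 => s 0 * w s
  | 1 => -Complex.I * κe * fderiv ℝ w s (EuclideanSpace.single 0 1)
  | 2 => s 1 * w s
  | 3 => -Complex.I * κm * fderiv ℝ w s (EuclideanSpace.single 1 1)

/-- The coordinate operators `X_μ = (Λ_θ x̂)_μ` in the fibre over `θ`, with `L = Λ_θ`. -/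
def coord (κe κm : ℝ) (L : Matrix (Fin 4) (Fin 4) ℝ) (μ : Fin 4) (w : Plane → ℂ) (s : Plane) : ℂ :=
  ∑ ν, L μ ν * xhat κe κm ν w s

/-- `p · X` in the fibre over `θ`. -/
def dotCoord (κe κm : ℝ) (L : Matrix (Fin 4) (Fin 4) ℝ) (p : Mink) (w : Plane → ℂ) (s : Plane) :
    ℂ :=
  ∑ μ, (eta μ * p μ : ℝ) * coord κe κm L μ w s

/-- The coefficients `a = Λᵀ η p`, so that `p · X = ∑ᵥ aᵥ x̂ᵥ`. -/
def coeff (L : Matrix (Fin 4) (Fin 4) ℝ) (p : Mink) (ν : Fin 4) : ℝ := ∑ μ, eta μ * p μ * L μ ν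

/-- The translation of `s` that is implemented by `e^{ip·X}`. -/
def shift (κe κm : ℝ) (L : Matrix (Fin 4) (Fin 4) ℝ) (p : Mink) : Plane :=
  WithLp.toLp 2 ![κe * coeff L p 1, κm * coeff L p 3]

/-- The unitary `e^{ip·X}` in the fibre over `θ`: the one-parameter group generated by `i p·X`
(see `weyl_zero`, `weyl_add_smul` and `weyl_hasDerivAt`). -/
def weyl (κe κm : ℝ) (L : Matrix (Fin 4) (Fin 4) ℝ) (p : Mink) (w : Plane → ℂ) (s : Plane) : ℂ :=
  Complex.exp (Complex.I * ((coeff L p 0 * s 0 + coeff L p 2 * s 1 +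
      (κe * coeff L p 0 * coeff L p 1 + κm * coeff L p 2 * coeff L p 3) / 2 : ℝ) : ℂ)) *
    w (s + shift κe κm L p)

lemma coeff_smul (L : Matrix (Fin 4) (Fin 4) ℝ) (t : ℝ) (p : Mink) (ν : Fin 4) :
    coeff L (t • p) ν = t * coeff L p ν := by
  simp only [coeff, PiLp.smul_apply, smul_eq_mul, Finset.mul_sum]
  exact Finset.sum_congr rfl fun μ _ => by ring

lemma shift_smul (κe κm : ℝ) (L : Matrix (Fin 4) (Fin 4) ℝ) (t : ℝ) (p : Mink) :
    shift κe κm L (t • p) = t • shift κe κm L p := by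
  ext i
  fin_cases i <;> simp [shift, coeff_smul] <;> ring

lemma weyl_zero (κe κm : ℝ) (L : Matrix (Fin 4) (Fin 4) ℝ) (p : Mink) (w : Plane → ℂ) :
    weyl κe κm L ((0 : ℝ) • p) w = w := by
  funext s
  simp only [weyl, shift_smul, coeff_smul]
  simp

lemma weyl_add_smul (κe κm : ℝ) (L : Matrix (Fin 4) (Fin 4) ℝ) (p : Mink) (t r : ℝ)
    (w : Plane → ℂ) :
    weyl κe κm L ((t + r) • p) w = weyl κe κm L (t • p) (weyl κe κm L (r • p) w) := by
  funext s
  simp only [weyl, shift_smul, coeff_smul, ← mul_assoc, ← Complex.exp_add]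
  congr 2
  · simp [shift]
    ring
  · rw [add_smul, add_assoc]

lemma dotCoord_eq (κe κm : ℝ) (L : Matrix (Fin 4) (Fin 4) ℝ) (p : Mink) (w : Plane → ℂ)
    (s : Plane) :
    dotCoord κe κm L p w s = ∑ ν, (coeff L p ν : ℂ) * xhat κe κm ν w s := by
  simp only [dotCoord, coord, coeff, Fin.sum_univ_four]
  push_cast
  ring

/-- The derivative at `t = 0` of `e^{itp·X}` is `i p·X`. -/
lemma weyl_hasDerivAt (κe κm : ℝ) (L : Matrix (Fin 4) (Fin 4) ℝ) (p : Mink) (w : Plane → ℂ)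
    (s : Plane) (hw : DifferentiableAt ℝ w s) :
    HasDerivAt (fun t : ℝ => weyl κe κm L (t • p) w s)
      (Complex.I * dotCoord κe κm L p w s) 0 := by
  have h1 : HasDerivAt (fun t : ℝ => s + t • shift κe κm L p) (shift κe κm L p) 0 := by
    simpa using ((hasDerivAt_id (0 : ℝ)).smul_const (shift κe κm L p)).const_add s
  have h2 : HasDerivAt (fun t : ℝ => w (s + t • shift κe κm L p))
      (fderiv ℝ w s (shift κe κm L p)) 0 := by
    have : HasFDerivAt w (fderiv ℝ w s) (s + (0 : ℝ) • shift κe κm L p) := by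
      simpa using hw.hasFDerivAt
    exact this.comp_hasDerivAt (0 : ℝ) h1
  have h3 : HasDerivAt (fun t : ℝ => t * (coeff L p 0 * s 0 + coeff L p 2 * s 1) + t ^ 2 *
      ((κe * coeff L p 0 * coeff L p 1 + κm * coeff L p 2 * coeff L p 3) / 2))
      (coeff L p 0 * s 0 + coeff L p 2 * s 1) 0 := by
    have := ((hasDerivAt_id (0 : ℝ)).mul_const (coeff L p 0 * s 0 + coeff L p 2 * s 1)).add
      (((hasDerivAt_id (0 : ℝ)).pow 2).mul_const
        ((κe * coeff L p 0 * coeff L p 1 + κm * coeff L p 2 * coeff L p 3) / 2))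
    convert! this using 1
    simp
  have h4 := ((h3.ofReal_comp.const_mul Complex.I).cexp).mul h2
  have h5 : shift κe κm L p = (κe * coeff L p 1) • EuclideanSpace.single (0 : Fin 2) (1 : ℝ) +
      (κm * coeff L p 3) • EuclideanSpace.single (1 : Fin 2) (1 : ℝ) := by
    ext i
    fin_cases i <;> simp [shift]
  convert! h4 using 1
  · funext t
    simp only [weyl, shift_smul, coeff_smul, Pi.mul_apply]
    congr 4
    ring
  · rw [dotCoord_eq, h5, map_add, map_smul, map_smul]
    simp only [Fin.sum_univ_four, xhat]
    simp
    linear_combination (-(κe * coeff L p 1 * fderiv ℝ w s (EuclideanSpace.single 0 1) : ℂ) -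
      κm * coeff L p 3 * fderiv ℝ w s (EuclideanSpace.single 1 1)) * Complex.I_sq

/-! ### The enlarged test function space -/

/-- Sequences `𝐠 = (𝐠⁰, 𝐠¹, …)` of functions of `(s, θ)` and of the spacetime variables: the
`n`-th member is, for each `θ ∈ Σ`, a Schwartz function of `(s, x₁, …, xₙ)`. -/
abbrev BigTest (κe κm : ℝ) (K : ℕ) : Type :=
  ∀ n : ℕ, Spec κe κm → 𝓢(Plane × (Fin n → Mink), (Fin n → Fin K) → ℂ)

/-- The enlarged Borchers-Uhlmann space: terminating sequences whose members depend on `θ` in a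
Borel measurable way, boundedly with respect to each Schwartz seminorm, and with compact support
in `Σ`. -/
structure IsBigTest {κe κm : ℝ} {K : ℕ} (g : BigTest κe κm K) : Prop where
  terminating : ∃ N, ∀ n, N ≤ n → g n = 0
  measurable : ∀ n z, Measurable fun θ => g n θ z
  bounded : ∀ n a b : ℕ, ∃ B, ∀ θ, SchwartzMap.seminorm ℝ a b (g n θ) ≤ B
  support : ∀ n, ∃ C : Set (Spec κe κm), IsCompact C ∧ ∀ θ, θ ∉ C → g n θ = 0

lemma slice_temperate {n : ℕ} (s : Plane) :
    Function.HasTemperateGrowth fun x : Fin n → Mink => (s, x) := by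
  have h := (Function.HasTemperateGrowth.const ((s, 0) : Plane × (Fin n → Mink))).add
    (ContinuousLinearMap.inr ℝ Plane (Fin n → Mink)).hasTemperateGrowth
  convert! h using 1
  funext x
  simp

/-- The restriction `x ↦ G(s, x)` of a Schwartz function of `(s, x)`, at fixed `s`. -/
def slice {K n : ℕ} (s : Plane) :
    𝓢(Plane × (Fin n → Mink), (Fin n → Fin K) → ℂ) →L[ℂ] TestN K n :=
  SchwartzMap.compCLMOfAntilipschitz (g := fun x => (s, x)) (K := 1) ℂ (slice_temperate s)
    (fun x y => by simp [Prod.edist_eq])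

lemma slice_apply {K n : ℕ} (s : Plane) (G : 𝓢(Plane × (Fin n → Mink), (Fin n → Fin K) → ℂ))
    (x : Fin n → Mink) : slice s G x = G (s, x) := rfl

/-- `h = f × g`: in momentum space,
`(f × g)ⁿ⁺¹_{s,θ}(p₀, …, pₙ) = f̃(p₀) (e^{ip₀·X} g)ⁿ_{s,θ}(p₁, …, pₙ)`, and `(f × g)⁰ = 0`. -/
def IsAction {κe κm : ℝ} {K : ℕ} (Λ : Spec κe κm → Matrix (Fin 4) (Fin 4) ℝ)
    (f : Test K) (g h : BigTest κe κm K) : Prop :=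
  h 0 = 0 ∧ ∀ n θ s (p : Fin (n + 1) → Mink) (k : Fin (n + 1) → Fin K),
    fourierN (slice s (h (n + 1) θ)) p k = fourier f (p 0) (k 0) *
      weyl κe κm (Λ θ) (p 0) (fun s' => fourierN (slice s' (g n θ)) (Fin.tail p) (Fin.tail k)) s

/-- Smooth compactly supported functions on the closed submanifold `ℝ² × Σ` of `ℝ² × ℝ¹⁶`. -/
def IsSmoothCompact {κe κm : ℝ} (v : Plane × Spec κe κm → ℂ) : Prop :=
  ∃ V : Plane × MatSpace → ℂ, ContDiff ℝ ∞ V ∧ HasCompactSupport V ∧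
    ∀ s (θ : Spec κe κm), v (s, θ) = V (s, θ)

/-! ### The deformed fields -/

section Fields

variable {K : ℕ} {H : Type*} [NormedAddCommGroup H] [InnerProductSpace ℂ H]

/-- The Hilbert space `L²(ℝ² × Σ) ⊗ H ≅ L²(ℝ² × Σ → H)`. -/
abbrev BigHilbert (κe κm : ℝ) (H : Type*) [NormedAddCommGroup H] : Type _ :=
  Lp H 2 (specMeasure κe κm)

/-- `Ψ^⊗(𝐠)(s, θ) = ∑ₙ Ψⁿ(𝐠ⁿ_{s,θ})`. -/
def bigPsi {κe κm : ℝ} (T : Theory K H) (g : BigTest κe κm K) (z : Plane × Spec κe κm) : H :=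
  ∑ᶠ n, T.Ψ n (slice z.1 (g n z.2))

/-- The domain `D^⊗`, spanned by the vectors `Ψ^⊗(𝐠)`. -/
def bigDomain (κe κm : ℝ) (T : Theory K H) : Submodule ℂ (BigHilbert κe κm H) :=
  Submodule.span ℂ {ξ | ∃ g : BigTest κe κm K, IsBigTest g ∧
    ξ =ᵐ[specMeasure κe κm] bigPsi T g}

/-- The subspace spanned by the vectors `v ⊗ Ψⁿ(F)` with `v ∈ C₀^∞(ℝ² × Σ)`. -/
def smoothDomain (κe κm : ℝ) (T : Theory K H) : Submodule ℂ (BigHilbert κe κm H) :=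
  Submodule.span ℂ {ξ | ∃ v : Plane × Spec κe κm → ℂ, IsSmoothCompact v ∧
    ∃ (n : ℕ) (F : TestN K n), ξ =ᵐ[specMeasure κe κm] fun z => v z • T.Ψ n F}

/-- The linear relation spanned by the pairs `(Ψ^⊗(𝐠), Ψ^⊗(f × 𝐠))`. -/
def fieldGraph {κe κm : ℝ} (Λ : Spec κe κm → Matrix (Fin 4) (Fin 4) ℝ) (T : Theory K H)
    (f : Test K) : Submodule ℂ (BigHilbert κe κm H × BigHilbert κe κm H) :=
  Submodule.span ℂ {ξ | ∃ g h : BigTest κe κm K, IsBigTest g ∧ IsBigTest h ∧ IsAction Λ f g h ∧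
    ξ.1 =ᵐ[specMeasure κe κm] bigPsi T g ∧ ξ.2 =ᵐ[specMeasure κe κm] bigPsi T h}

/-- The Weyl-Wigner deformed field `φ^⊗(f) : Ψ^⊗(𝐠) ↦ Ψ^⊗(f × 𝐠)`, the operator whose graph is
the relation `fieldGraph` (it has this graph once the relation is single-valued). -/
def field {κe κm : ℝ} (Λ : Spec κe κm → Matrix (Fin 4) (Fin 4) ℝ) (T : Theory K H)
    (f : Test K) : BigHilbert κe κm H →ₗ.[ℂ] BigHilbert κe κm H :=
  (fieldGraph Λ T f).toLinearPMap

/-- `ζ = φ^⊗(f₁) ⋯ φ^⊗(fₙ) ξ`, including that each factor acts on a vector of its domain. -/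
def IsFieldProduct {κe κm : ℝ} (Λ : Spec κe κm → Matrix (Fin 4) (Fin 4) ℝ) (T : Theory K H) :
    List (Test K) → BigHilbert κe κm H → BigHilbert κe κm H → Prop
  | [], ξ, ζ => ζ = ξ
  | f :: fs, ξ, ζ => ∃ χ, IsFieldProduct Λ T fs ξ χ ∧
      ∃ hχ : χ ∈ (field Λ T f).domain, ζ = field Λ T f ⟨χ, hχ⟩

end Fields

/-- The test function `F` with
`F̃(p)_k = ∏ⱼ f̃ⱼ(pⱼ)_{kⱼ} ∏_{l<r} exp(-(i/2) p_l θ p_r)`. -/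
def IsTwistedProduct {K n : ℕ} (θ : Matrix (Fin 4) (Fin 4) ℝ) (f : Fin n → Test K)
    (F : TestN K n) : Prop :=
  ∀ p k, fourierN F p k = (∏ j, fourier (f j) (p j) (k j)) *
    ∏ l, ∏ r ∈ Finset.Ioi l, Complex.exp (-(Complex.I / 2) * (twist θ (p l) (p r) : ℝ))

end WeylWigner

end

/-! Fix `θ`. Since `e^{ip·X}` is unitary on functions of `s`, it can be moved to the other factor of
`∫ ds ⟨Ψ(g'_s), Ψ(·_s)⟩`; combined with `φ(f)^* ⊃ φ(f^*)` this makes `φ^⊗(f)` and `φ^⊗(f^*)` formal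
adjoints of each other, first on tensor products and then, these being dense, by continuity. As the
domain is dense, the adjoint relation also forces `φ^⊗(f)` to be single-valued. The products `f × g`
are Schwartz because in momentum space they arise by composition with maps of temperate growth.

Density is `L²`-duality: test functions separate the locally integrable functions on `ℝ² × Σ`, as
`Σ` is closed in `ℝ¹⁶` and its surface measure is locally finite. For the latter, write `θ` in terms
of its electric and magnetic parts as `E + iB ∈ ℂ³`: `Σ` is the level set of the complex square
`(E + iB)²` at a non-zero value, hence locally a Lipschitz graph.

For the `n`-point functions, the Weyl relations turn `f₁ × (⋯ (fₙ × v))` into the twist factors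
times a single Weyl operator at the total momentum, and translation invariance concentrates `ω̃ₙ` at
total momentum zero, where this operator is the identity. -/

noncomputable section

namespace WeylWigner

open scoped FourierTransform Topology BoundedContinuousFunction

universe u

/-! ### Functions of temperate growth -/

section Temperate

variable {D E F : Type*} [NormedAddCommGroup D] [NormedSpace ℝ D] [NormedAddCommGroup E]
  [NormedSpace ℝ E] [NormedAddCommGroup F] [NormedSpace ℝ F]

@[fun_prop]
lemma hasTemperateGrowth_prodMk {f : D → E} {g : D → F} (hf : f.HasTemperateGrowth)
    (hg : g.HasTemperateGrowth) : (fun x => (f x, g x)).HasTemperateGrowth := by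
  have hsum := ((ContinuousLinearMap.inl ℝ E F).hasTemperateGrowth.comp hf).add
    ((ContinuousLinearMap.inr ℝ E F).hasTemperateGrowth.comp hg)
  convert! hsum using 1
  funext x
  simp

@[fun_prop]
lemma hasTemperateGrowth_fst {f : D → E × F} (hf : f.HasTemperateGrowth) :
    (fun x => (f x).1).HasTemperateGrowth :=
  (ContinuousLinearMap.fst ℝ E F).hasTemperateGrowth.comp hf

@[fun_prop]
lemma hasTemperateGrowth_snd {f : D → E × F} (hf : f.HasTemperateGrowth) :
    (fun x => (f x).2).HasTemperateGrowth :=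
  (ContinuousLinearMap.snd ℝ E F).hasTemperateGrowth.comp hf

lemma hasTemperateGrowth_pi {ι : Type*} [Fintype ι] {f : D → ι → E}
    (hf : ∀ i, (fun x => f x i).HasTemperateGrowth) : f.HasTemperateGrowth := by
  classical
  have hsum := Function.HasTemperateGrowth.sum (s := Finset.univ)
    fun i _ => (ContinuousLinearMap.single ℝ (fun _ : ι => E) i).hasTemperateGrowth.comp (hf i)
  convert! hsum using 1
  funext x
  simp [Finset.univ_sum_single]

lemma hasTemperateGrowth_cexp_I_mul_ofReal :
    (fun t : ℝ => Complex.exp (Complex.I * t)).HasTemperateGrowth := by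
  have iteratedDeriv_eq (n : ℕ) : iteratedDeriv n (fun t : ℝ => Complex.exp (Complex.I * t)) =
      fun t : ℝ => Complex.I ^ n * Complex.exp (Complex.I * t) := by
    induction n with
    | zero => simp
    | succ n ih =>
      rw [iteratedDeriv_succ, ih]
      funext t
      have hlin : HasDerivAt (fun t : ℝ => Complex.I * (t : ℂ)) Complex.I t := by
        simpa using (Complex.ofRealCLM.hasDerivAt (x := t)).const_mul Complex.I
      rw [(hlin.cexp.const_mul (Complex.I ^ n)).deriv]
      ring
  refine ⟨(contDiff_const.mul Complex.ofRealCLM.contDiff).cexp, fun n => ⟨0, 1, fun t => ?_⟩⟩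
  rw [norm_iteratedFDeriv_eq_norm_iteratedDeriv, iteratedDeriv_eq]
  simp [Complex.norm_exp]

@[fun_prop]
lemma hasTemperateGrowth_cexp_I_mul {f : D → ℝ} (hf : f.HasTemperateGrowth) :
    (fun x => Complex.exp (Complex.I * (f x : ℂ))).HasTemperateGrowth :=
  hasTemperateGrowth_cexp_I_mul_ofReal.comp hf

lemma exists_norm_le_of_leftInverse {Φ : D → E} {Ψ : E → D} (hΨ : Ψ.HasTemperateGrowth)
    (h : Function.LeftInverse Ψ Φ) : ∃ (k : ℕ) (C : ℝ), ∀ x, ‖x‖ ≤ C * (1 + ‖Φ x‖) ^ k := by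
  obtain ⟨k, C, hC⟩ := hΨ.2 0
  refine ⟨k, C, fun x => ?_⟩
  simpa [h x] using hC (Φ x)

/-- Composition of Schwartz functions with a map `Φ` of temperate growth that has a left inverse of
temperate growth: the left inverse is what bounds `x` polynomially in `Φ x`. -/
def compCLMOfLeftInverse {V : Type*} [NormedAddCommGroup V] [NormedSpace ℂ V] {Φ : D → E}
    {Ψ : E → D} (hΦ : Φ.HasTemperateGrowth) (hΨ : Ψ.HasTemperateGrowth)
    (h : Function.LeftInverse Ψ Φ) : 𝓢(E, V) →L[ℂ] 𝓢(D, V) :=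
  SchwartzMap.compCLM ℂ hΦ (exists_norm_le_of_leftInverse hΨ h)

end Temperate

/-! ### Continuous seminorms on Schwartz spaces -/

section SchwartzSup

variable {X V X' V' H : Type*} [NormedAddCommGroup X] [NormedSpace ℝ X] [NormedAddCommGroup V]
  [NormedSpace ℂ V] [NormedAddCommGroup X'] [NormedSpace ℝ X'] [NormedAddCommGroup V']
  [NormedSpace ℂ V'] [NormedAddCommGroup H] [NormedSpace ℂ H]

/-- The maximum of finitely many Schwartz seminorms. Up to constants these maxima dominate every
continuous seminorm, so that they serve to express the continuity of linear maps by bounds. -/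
def schwartzSup (s : Finset (ℕ × ℕ)) : Seminorm ℂ 𝓢(X, V) :=
  s.sup (schwartzSeminormFamily ℂ X V)

lemma seminorm_le_schwartzSup {s : Finset (ℕ × ℕ)} {k n : ℕ} (h : (k, n) ∈ s) (F : 𝓢(X, V)) :
    SchwartzMap.seminorm ℂ k n F ≤ schwartzSup s F :=
  Seminorm.le_finset_sup_apply (p := schwartzSeminormFamily ℂ X V) h

lemma schwartzSup_le {s : Finset (ℕ × ℕ)} {B : ℝ} (hB : 0 ≤ B) {F : 𝓢(X, V)}
    (h : ∀ k n, (k, n) ∈ s → SchwartzMap.seminorm ℂ k n F ≤ B) : schwartzSup s F ≤ B :=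
  Seminorm.finset_sup_apply_le hB fun q hq => h q.1 q.2 hq

lemma schwartzSup_mono {s t : Finset (ℕ × ℕ)} (h : s ⊆ t) (F : 𝓢(X, V)) :
    schwartzSup s F ≤ schwartzSup t F :=
  schwartzSup_le (apply_nonneg _ _) fun _ _ hq => seminorm_le_schwartzSup (h hq) F

lemma continuous_schwartzSup (s : Finset (ℕ × ℕ)) :
    Continuous (schwartzSup s : 𝓢(X, V) → ℝ) :=
  (schwartz_withSeminorms ℂ X V).finset_sups.continuous_seminorm s

lemma exists_le_schwartzSup {p : Seminorm ℂ 𝓢(X, V)} (hp : Continuous p) :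
    ∃ (s : Finset (ℕ × ℕ)) (C : ℝ), 0 ≤ C ∧ ∀ F, p F ≤ C * schwartzSup s F := by
  obtain ⟨s, C, -, hC⟩ := Seminorm.bound_of_continuous (schwartz_withSeminorms ℂ X V) p hp
  exact ⟨s, C, C.2, hC⟩

lemma exists_norm_map_le (W : 𝓢(X, V) →L[ℂ] H) :
    ∃ (s : Finset (ℕ × ℕ)) (C : ℝ), 0 ≤ C ∧ ∀ F, ‖W F‖ ≤ C * schwartzSup s F :=
  exists_le_schwartzSup (p := (normSeminorm ℂ H).comp W.toLinearMap)
    (continuous_norm.comp W.continuous)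

lemma exists_schwartzSup_map_le (T : 𝓢(X, V) →L[ℂ] 𝓢(X', V')) (s : Finset (ℕ × ℕ)) :
    ∃ (s' : Finset (ℕ × ℕ)) (C : ℝ), 0 ≤ C ∧
      ∀ F, schwartzSup s (T F) ≤ C * schwartzSup s' F := by
  have hp : Continuous ((schwartzSup s).comp (T : 𝓢(X, V) →ₗ[ℂ] 𝓢(X', V'))) :=
    (continuous_schwartzSup s).comp T.continuous
  exact exists_le_schwartzSup hp

lemma exists_forall_schwartzSup_le {ι : Type*} {g : ι → 𝓢(X, V)}
    (hg : ∀ a b : ℕ, ∃ C, ∀ i, SchwartzMap.seminorm ℂ a b (g i) ≤ C) (s : Finset (ℕ × ℕ)) :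
    ∃ C, ∀ i, schwartzSup s (g i) ≤ C := by
  choose B hB using hg
  exact ⟨∑ q ∈ s, |B q.1 q.2|, fun i =>
    schwartzSup_le (by positivity) fun k n hq => ((hB k n i).trans (le_abs_self _)).trans
      (Finset.single_le_sum (f := fun q : ℕ × ℕ => |B q.1 q.2|) (fun _ _ => abs_nonneg _) hq)⟩

lemma exists_forall_seminorm_map_le {ι : Type*} (T : 𝓢(X, V) →L[ℂ] 𝓢(X', V')) {g : ι → 𝓢(X, V)}
    (hg : ∀ a b : ℕ, ∃ C, ∀ i, SchwartzMap.seminorm ℂ a b (g i) ≤ C) (a b : ℕ) :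
    ∃ C, ∀ i, SchwartzMap.seminorm ℂ a b (T (g i)) ≤ C := by
  obtain ⟨s, C, hC, hT⟩ := exists_schwartzSup_map_le T {(a, b)}
  obtain ⟨B, hB⟩ := exists_forall_schwartzSup_le hg s
  exact ⟨C * B, fun i => ((seminorm_le_schwartzSup (by simp) _).trans (hT _)).trans
    (mul_le_mul_of_nonneg_left (hB i) hC)⟩

end SchwartzSup

/-! ### Tensor products and slices -/

lemma norm_prod_pow_le_add {X Y : Type*} [SeminormedAddCommGroup X] [SeminormedAddCommGroup Y]
    (z : X × Y) (k : ℕ) : ‖z‖ ^ k ≤ ‖z.1‖ ^ k + ‖z.2‖ ^ k := by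
  rcases max_cases ‖z.1‖ ‖z.2‖ with h | h <;> rw [Prod.norm_def, h.1]
  · exact le_add_of_nonneg_right (by positivity)
  · exact le_add_of_nonneg_left (by positivity)

section Tensor

variable {X Y A B V : Type*} [NormedAddCommGroup X] [NormedSpace ℝ X] [NormedAddCommGroup Y]
  [NormedSpace ℝ Y] [NormedAddCommGroup A] [NormedSpace ℂ A] [NormedAddCommGroup B]
  [NormedSpace ℂ B] [NormedAddCommGroup V] [NormedSpace ℂ V]

lemma norm_compContinuousLinearMap_le_of_norm_le_one {n : ℕ} {L : X →L[ℝ] Y} (hL : ‖L‖ ≤ 1)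
    (M : Y [×n]→L[ℝ] V) : ‖M.compContinuousLinearMap fun _ => L‖ ≤ ‖M‖ :=
  (ContinuousMultilinearMap.norm_compContinuousLinearMap_le _ _).trans <|
    mul_le_of_le_one_right (norm_nonneg _) <|
      Finset.prod_le_one (fun _ _ => norm_nonneg _) fun _ _ => hL

lemma norm_iteratedFDeriv_comp_le_of_norm_le_one {L : X →L[ℝ] Y} (hL : ‖L‖ ≤ 1) (f : 𝓢(Y, V))
    (n : ℕ) (x : X) :
    ‖iteratedFDeriv ℝ n (fun x => f (L x)) x‖ ≤ ‖iteratedFDeriv ℝ n f (L x)‖ := by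
  have h := L.iteratedFDeriv_comp_right (f.smooth n) x (i := n) le_rfl
  exact (congrArg norm h).trans_le (norm_compContinuousLinearMap_le_of_norm_le_one hL _)

lemma pow_mul_norm_iteratedFDeriv_fst_mul_snd_le (f : 𝓢(X, A)) (g : 𝓢(Y, B)) (k i j : ℕ)
    (z : X × Y) :
    ‖z‖ ^ k * (‖iteratedFDeriv ℝ i (fun z : X × Y => f z.1) z‖ *
        ‖iteratedFDeriv ℝ j (fun z : X × Y => g z.2) z‖) ≤
      SchwartzMap.seminorm ℂ k i f * SchwartzMap.seminorm ℂ 0 j g +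
        SchwartzMap.seminorm ℂ 0 i f * SchwartzMap.seminorm ℂ k j g := by
  have hf : ‖iteratedFDeriv ℝ i (fun z : X × Y => f z.1) z‖ ≤ ‖iteratedFDeriv ℝ i f z.1‖ :=
    norm_iteratedFDeriv_comp_le_of_norm_le_one (ContinuousLinearMap.norm_fst_le ℝ X Y) f i z
  have hg : ‖iteratedFDeriv ℝ j (fun z : X × Y => g z.2) z‖ ≤ ‖iteratedFDeriv ℝ j g z.2‖ :=
    norm_iteratedFDeriv_comp_le_of_norm_le_one (ContinuousLinearMap.norm_snd_le ℝ X Y) g j z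
  calc _ ≤ (‖z.1‖ ^ k + ‖z.2‖ ^ k) *
        (‖iteratedFDeriv ℝ i f z.1‖ * ‖iteratedFDeriv ℝ j g z.2‖) := by
        gcongr
        exact norm_prod_pow_le_add z k
    _ = ‖z.1‖ ^ k * ‖iteratedFDeriv ℝ i f z.1‖ * ‖iteratedFDeriv ℝ j g z.2‖ +
        ‖iteratedFDeriv ℝ i f z.1‖ * (‖z.2‖ ^ k * ‖iteratedFDeriv ℝ j g z.2‖) := by ring
    _ ≤ _ := by
        gcongr
        · exact SchwartzMap.le_seminorm ℂ k i f z.1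
        · exact SchwartzMap.norm_iteratedFDeriv_le_seminorm ℂ g j z.2
        · exact SchwartzMap.norm_iteratedFDeriv_le_seminorm ℂ f i z.1
        · exact SchwartzMap.le_seminorm ℂ k j g z.2

lemma pow_mul_norm_iteratedFDeriv_tensor_le (M : A →L[ℂ] B →L[ℂ] V) (f : 𝓢(X, A)) (g : 𝓢(Y, B))
    (k n : ℕ) (z : X × Y) :
    ‖z‖ ^ k * ‖iteratedFDeriv ℝ n (fun z : X × Y => M (f z.1) (g z.2)) z‖ ≤
      (‖M‖ * ∑ i ∈ Finset.range (n + 1), (n.choose i : ℝ) *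
        (SchwartzMap.seminorm ℂ k i f + SchwartzMap.seminorm ℂ 0 i f)) *
        schwartzSup (Finset.Iic (k, n)) g := by
  have leibniz := (M.bilinearRestrictScalars ℝ).norm_iteratedFDeriv_le_of_bilinear
    (f := fun z : X × Y => f z.1) (g := fun z : X × Y => g z.2) (n := n) (N := n)
    ((f.smooth n).comp contDiff_fst) ((g.smooth n).comp contDiff_snd) z le_rfl
  rw [ContinuousLinearMap.norm_bilinearRestrictScalars] at leibniz
  refine (mul_le_mul_of_nonneg_left leibniz (by positivity)).trans ?_
  rw [mul_left_comm, mul_assoc ‖M‖, Finset.mul_sum, Finset.sum_mul]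
  refine mul_le_mul_of_nonneg_left (Finset.sum_le_sum fun i _ => ?_) (by positivity)
  have hg (a : ℕ) (ha : a ≤ k) :
      SchwartzMap.seminorm ℂ a (n - i) g ≤ schwartzSup (Finset.Iic (k, n)) g :=
    seminorm_le_schwartzSup (by simp [ha]) g
  rw [mul_assoc, mul_left_comm, mul_assoc]
  refine mul_le_mul_of_nonneg_left ?_ (by positivity)
  refine (pow_mul_norm_iteratedFDeriv_fst_mul_snd_le f g k i (n - i) z).trans ?_
  rw [add_mul]
  gcongr
  exacts [hg 0 k.zero_le, hg k le_rfl]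

/-- The tensor product `(x, y) ↦ M (f x) (g y)` of two Schwartz functions with respect to a
bilinear product `M` of their values, as a continuous function of the second factor. -/
def tensorCLM (M : A →L[ℂ] B →L[ℂ] V) (f : 𝓢(X, A)) : 𝓢(Y, B) →L[ℂ] 𝓢(X × Y, V) :=
  SchwartzMap.mkCLM (fun g z => M (f z.1) (g z.2)) (fun _ _ _ => by simp) (fun _ _ _ => by simp)
    (fun g => ((M.bilinearRestrictScalars ℝ).isBoundedBilinearMap.contDiff).comp
      (((f.smooth ⊤).comp contDiff_fst).prodMk ((g.smooth ⊤).comp contDiff_snd)))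
    fun q => ⟨Finset.Iic q, _, by positivity,
      fun g z => pow_mul_norm_iteratedFDeriv_tensor_le M f g q.1 q.2 z⟩

@[simp]
lemma tensorCLM_apply (M : A →L[ℂ] B →L[ℂ] V) (f : 𝓢(X, A)) (g : 𝓢(Y, B)) (z : X × Y) :
    tensorCLM M f g z = M (f z.1) (g z.2) := rfl

lemma hasTemperateGrowth_prodMk_left (x : X) : (fun y : Y => (x, y)).HasTemperateGrowth := by
  fun_prop

/-- The restriction `y ↦ G(x, y)` of a Schwartz function of two variables, at fixed `x`. -/
def sliceCLM (x : X) : 𝓢(X × Y, V) →L[ℂ] 𝓢(Y, V) :=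
  SchwartzMap.compCLMOfAntilipschitz (g := fun y => (x, y)) (K := 1) ℂ
    (hasTemperateGrowth_prodMk_left x) fun y y' => by simp [Prod.edist_eq]

@[simp]
lemma sliceCLM_apply (x : X) (G : 𝓢(X × Y, V)) (y : Y) : sliceCLM x G y = G (x, y) := rfl

/-- Exchange of the two variables of a Schwartz function, `(y, x) ↦ G(x, y)`. -/
def swapCLM : 𝓢(X × Y, V) →L[ℂ] 𝓢(Y × X, V) :=
  SchwartzMap.compCLMOfContinuousLinearEquiv ℂ (ContinuousLinearEquiv.prodComm ℝ Y X)

@[simp]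
lemma swapCLM_apply (G : 𝓢(X × Y, V)) (z : Y × X) : swapCLM G z = G (z.2, z.1) := rfl

lemma iteratedFDeriv_sliceCLM (G : 𝓢(X × Y, V)) (n : ℕ) (x : X) (y : Y) :
    iteratedFDeriv ℝ n (sliceCLM x G) y =
      (iteratedFDeriv ℝ n G (x, y)).compContinuousLinearMap
        fun _ => ContinuousLinearMap.inr ℝ X Y := by
  have h : ⇑(sliceCLM x G) =
      (fun w => G ((x, (0 : Y)) + w)) ∘ ContinuousLinearMap.inr ℝ X Y := by
    funext y
    simp
  have hs : ContDiff ℝ n fun w => G ((x, (0 : Y)) + w) :=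
    (G.smooth n).comp (contDiff_const.add contDiff_id)
  rw [h, (ContinuousLinearMap.inr ℝ X Y).iteratedFDeriv_comp_right hs y le_rfl,
    iteratedFDeriv_comp_add_left]
  simp

lemma pow_mul_seminorm_sliceCLM_le (G : 𝓢(X × Y, V)) (m a b : ℕ) (x : X) :
    ‖x‖ ^ m * SchwartzMap.seminorm ℂ a b (sliceCLM x G) ≤ SchwartzMap.seminorm ℂ (m + a) b G := by
  rcases (show 0 ≤ ‖x‖ ^ m by positivity).eq_or_lt with hx | hx
  · rw [← hx, zero_mul]
    exact apply_nonneg _ _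
  rw [mul_comm, ← le_div_iff₀ hx]
  refine SchwartzMap.seminorm_le_bound ℂ a b _ (by positivity) fun y => ?_
  rw [le_div_iff₀ hx, iteratedFDeriv_sliceCLM]
  refine le_trans ?_ (SchwartzMap.le_seminorm ℂ (m + a) b G (x, y))
  calc _ ≤ ‖(x, y)‖ ^ a * ‖iteratedFDeriv ℝ b G (x, y)‖ * ‖(x, y)‖ ^ m := by
        gcongr
        · exact norm_snd_le (x, y)
        · exact norm_compContinuousLinearMap_le_of_norm_le_one
            (ContinuousLinearMap.norm_inr_le_one ℝ X Y) _
        · exact norm_fst_le (x, y)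
    _ = _ := by ring

lemma seminorm_sliceCLM_le (G : 𝓢(X × Y, V)) (a b : ℕ) (x : X) :
    SchwartzMap.seminorm ℂ a b (sliceCLM x G) ≤ SchwartzMap.seminorm ℂ a b G := by
  simpa using pow_mul_seminorm_sliceCLM_le G 0 a b x

lemma schwartzSup_sliceCLM_le (G : 𝓢(X × Y, V)) (s : Finset (ℕ × ℕ)) (x : X) :
    schwartzSup s (sliceCLM x G) ≤ schwartzSup s G :=
  schwartzSup_le (apply_nonneg _ _) fun a b hq =>
    (seminorm_sliceCLM_le G a b x).trans (seminorm_le_schwartzSup hq G)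

lemma pow_mul_schwartzSup_sliceCLM_le (G : 𝓢(X × Y, V)) (k : ℕ) (s : Finset (ℕ × ℕ)) (x : X) :
    ‖x‖ ^ k * schwartzSup s (sliceCLM x G) ≤
      schwartzSup (s.image fun q => (k + q.1, q.2)) G := by
  rcases (show 0 ≤ ‖x‖ ^ k by positivity).eq_or_lt with hx | hx
  · rw [← hx, zero_mul]
    exact apply_nonneg _ _
  rw [mul_comm, ← le_div_iff₀ hx]
  refine schwartzSup_le (by positivity) fun a b hq => ?_
  rw [le_div_iff₀ hx, mul_comm]
  exact (pow_mul_seminorm_sliceCLM_le G k a b x).trans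
    (seminorm_le_schwartzSup (Finset.mem_image_of_mem (fun q : ℕ × ℕ => (k + q.1, q.2)) hq) G)

lemma pow_mul_norm_iteratedFDeriv_sub_le (G : 𝓢(X × Y, V)) (a b : ℕ) (x x' : X) (y : Y) :
    ‖y‖ ^ a * ‖iteratedFDeriv ℝ b G (x, y) - iteratedFDeriv ℝ b G (x', y)‖ ≤
      SchwartzMap.seminorm ℂ a (b + 1) G * ‖x - x'‖ := by
  rcases (show 0 ≤ ‖y‖ ^ a by positivity).eq_or_lt with hy | hy
  · rw [← hy, zero_mul]
    positivity
  have hdiff : Differentiable ℝ (iteratedFDeriv ℝ b G) :=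
    (G.smooth ⊤).differentiable_iteratedFDeriv (by exact_mod_cast WithTop.coe_lt_top _)
  have hderiv (w : X) : HasFDerivAt (fun w : X => iteratedFDeriv ℝ b G (w, y))
      ((fderiv ℝ (iteratedFDeriv ℝ b G) (w, y)).comp (ContinuousLinearMap.inl ℝ X Y)) w :=
    (hdiff (w, y)).hasFDerivAt.comp (f := fun w => (w, y)) w (hasFDerivAt_prodMk_left w y)
  have hbound (w : X) : ‖(fderiv ℝ (iteratedFDeriv ℝ b G) (w, y)).comp
      (ContinuousLinearMap.inl ℝ X Y)‖ ≤ SchwartzMap.seminorm ℂ a (b + 1) G / ‖y‖ ^ a := by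
    rw [le_div_iff₀' hy]
    refine le_trans ?_ (SchwartzMap.le_seminorm ℂ a (b + 1) G (w, y))
    gcongr
    · exact norm_snd_le (w, y)
    · refine (ContinuousLinearMap.opNorm_comp_le _ _).trans ?_
      rw [← norm_fderiv_iteratedFDeriv]
      exact mul_le_of_le_one_right (norm_nonneg _) (ContinuousLinearMap.norm_inl_le_one ℝ X Y)
  have mean_value := convex_univ.norm_image_sub_le_of_norm_hasFDerivWithin_le
    (fun w _ => (hderiv w).hasFDerivWithinAt) (fun w _ => hbound w)
    (Set.mem_univ x') (Set.mem_univ x)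
  rwa [div_mul_eq_mul_div, le_div_iff₀' hy] at mean_value

lemma seminorm_sliceCLM_sub_le (G : 𝓢(X × Y, V)) (a b : ℕ) (x x' : X) :
    SchwartzMap.seminorm ℂ a b (sliceCLM x G - sliceCLM x' G) ≤
      SchwartzMap.seminorm ℂ a (b + 1) G * ‖x - x'‖ := by
  refine SchwartzMap.seminorm_le_bound ℂ a b _ (by positivity) fun y => ?_
  have h : iteratedFDeriv ℝ b (⇑(sliceCLM x G - sliceCLM x' G)) y =
      (iteratedFDeriv ℝ b G (x, y) - iteratedFDeriv ℝ b G (x', y)).compContinuousLinearMap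
        fun _ => ContinuousLinearMap.inr ℝ X Y := by
    have : ⇑(sliceCLM x G - sliceCLM x' G) = ⇑(sliceCLM x G) - ⇑(sliceCLM x' G) := rfl
    rw [this, iteratedFDeriv_sub_apply ((sliceCLM x G).smooth b).contDiffAt
      ((sliceCLM x' G).smooth b).contDiffAt, iteratedFDeriv_sliceCLM, iteratedFDeriv_sliceCLM]
    ext
    simp
  rw [h]
  refine le_trans ?_ (pow_mul_norm_iteratedFDeriv_sub_le G a b x x' y)
  gcongr
  exact norm_compContinuousLinearMap_le_of_norm_le_one (ContinuousLinearMap.norm_inr_le_one ℝ X Y) _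

lemma continuous_sliceCLM (G : 𝓢(X × Y, V)) : Continuous fun x : X => sliceCLM x G := by
  refine continuous_iff_continuousAt.2 fun x =>
    ((schwartz_withSeminorms ℂ Y V).tendsto_nhds _ _).2 fun ⟨a, b⟩ ε hε => ?_
  have h : Filter.Tendsto (fun x' => SchwartzMap.seminorm ℂ a (b + 1) G * ‖x' - x‖) (𝓝 x)
      (𝓝 0) := by
    have : Continuous fun x' => SchwartzMap.seminorm ℂ a (b + 1) G * ‖x' - x‖ := by fun_prop
    simpa using this.tendsto x
  filter_upwards [h.eventually (gt_mem_nhds hε)] with x' hx'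
  exact (seminorm_sliceCLM_sub_le G a b x' x).trans_lt hx'

end Tensor

/-! ### The partial Fourier transform -/

section PartialFourier

/-- Precomposition with a fixed real-linear map, as a complex-linear map. -/
def precompCLM {V X X' : Type*} [NormedAddCommGroup V] [NormedSpace ℂ V] [NormedAddCommGroup X]
    [NormedSpace ℝ X] [NormedAddCommGroup X'] [NormedSpace ℝ X'] (A : X' →L[ℝ] X) :
    (X →L[ℝ] V) →L[ℂ] (X' →L[ℝ] V) :=
  LinearMap.mkContinuous
    { toFun := fun T => T.comp A
      map_add' := fun _ _ => by ext; simp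
      map_smul' := fun _ _ => by ext; simp } ‖A‖ fun T => by
    rw [mul_comm]
    exact ContinuousLinearMap.opNorm_comp_le T A

variable {Y E : Type u} [NormedAddCommGroup Y] [NormedSpace ℝ Y]
  [NormedAddCommGroup E] [InnerProductSpace ℝ E]

/-- The pairing `(w, z) ↦ ⟪w₂, z₂⟫` of second components, the phase of the partial Fourier
transform. -/
def innerSnd : (Y × E) →L[ℝ] (Y × E) →L[ℝ] ℝ :=
  (innerSL ℝ).bilinearComp (ContinuousLinearMap.snd ℝ Y E) (ContinuousLinearMap.snd ℝ Y E)

/-- The Schwartz function whose partial Fourier transform is the derivative of the partial Fourier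
transform of `G`. It takes smoothness and decay of all derivatives of the partial Fourier transform
to the zeroth order, at the price of enlarging the target space. -/
def derivPartial {V : Type u} [NormedAddCommGroup V] [NormedSpace ℂ V] :
    𝓢(Y × E, V) →L[ℂ] 𝓢(Y × E, (Y × E) →L[ℝ] V) :=
  (-(2 * Real.pi * Complex.I)) • SchwartzMap.smulRightCLM ℂ V innerSnd +
    (SchwartzMap.postcompCLM (precompCLM ((ContinuousLinearMap.inl ℝ Y E).comp
      (ContinuousLinearMap.fst ℝ Y E)))).comp (SchwartzMap.fderivCLM ℂ (Y × E) V)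

lemma derivPartial_apply {V : Type u} [NormedAddCommGroup V] [NormedSpace ℂ V] (G : 𝓢(Y × E, V))
    (y : Y) (e : E) (w : Y × E) : derivPartial G (y, e) w =
      (-(2 * Real.pi * Complex.I)) • ⟪e, w.2⟫_ℝ • G (y, e) + fderiv ℝ G (y, e) (w.1, 0) := rfl

lemma hasFDerivAt_fourierChar_smul {V : Type u} [NormedAddCommGroup V] [NormedSpace ℂ V]
    (G : 𝓢(Y × E, V)) (e : E) (z : Y × E) :
    HasFDerivAt (fun z : Y × E => Real.fourierChar (-⟪e, z.2⟫_ℝ) • G (z.1, e))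
      (Real.fourierChar (-⟪e, z.2⟫_ℝ) • derivPartial G (z.1, e)) z := by
  have hasFDerivAt_char : HasFDerivAt (fun z : Y × E => (Real.fourierChar (-⟪e, z.2⟫_ℝ) : ℂ))
      (((-2 * Real.pi * Complex.I * Real.fourierChar (-⟪e, z.2⟫_ℝ)) •
        (Complex.ofRealCLM ∘L (innerSL ℝ e))).comp (ContinuousLinearMap.snd ℝ Y E)) z :=
    HasFDerivAt.comp (f := fun z : Y × E => z.2) z
      (Real.hasFDerivAt_fourierChar_neg_bilinear_right (innerSL ℝ) e z.2) hasFDerivAt_snd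
  have hasFDerivAt_fst_const : HasFDerivAt (fun z : Y × E => (z.1, e))
      ((ContinuousLinearMap.inl ℝ Y E).comp (ContinuousLinearMap.fst ℝ Y E)) z :=
    HasFDerivAt.comp (f := fun z : Y × E => z.1) (g := fun y : Y => (y, e)) z
      (hasFDerivAt_prodMk_left z.1 e) hasFDerivAt_fst
  convert! hasFDerivAt_char.smul ((G.hasFDerivAt (z.1, e)).comp z hasFDerivAt_fst_const) using 1
  refine ContinuousLinearMap.ext fun w => ?_
  change (Real.fourierChar (-⟪e, z.2⟫_ℝ) : ℂ) • derivPartial G (z.1, e) w =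
    (Real.fourierChar (-⟪e, z.2⟫_ℝ) : ℂ) • fderiv ℝ G (z.1, e) (w.1, 0) +
    ((-2 * Real.pi * Complex.I * Real.fourierChar (-⟪e, z.2⟫_ℝ)) * (⟪e, w.2⟫_ℝ : ℂ)) • G (z.1, e)
  rw [derivPartial_apply, smul_add, add_comm, ← Complex.coe_smul ⟪e, w.2⟫_ℝ, smul_smul, smul_smul]
  congr 2
  ring

variable [FiniteDimensional ℝ E] [MeasurableSpace E] [BorelSpace E]

lemma exists_integrable_forall_norm_le {V : Type u} [NormedAddCommGroup V] [NormedSpace ℂ V]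
    (G : 𝓢(Y × E, V)) : ∃ b : E → ℝ, Integrable b ∧ ∀ y e, ‖G (y, e)‖ ≤ b e := by
  set l := (volume : Measure E).integrablePower
  refine ⟨fun e => (2 ^ l * schwartzSup (Finset.Iic (l, 0)) G) * (1 + ‖e‖) ^ (-(l : ℝ)),
    (Measure.integrable_pow_neg_integrablePower volume).const_mul _, fun y e => ?_⟩
  have hG := SchwartzMap.one_add_le_sup_seminorm_apply (𝕜 := ℂ) (m := (l, 0)) le_rfl le_rfl G (y, e)
  have hpos : (0 : ℝ) < 1 + ‖e‖ := by positivity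
  simp only [norm_iteratedFDeriv_zero] at hG ⊢
  rw [Real.rpow_neg hpos.le, Real.rpow_natCast, ← div_eq_mul_inv, le_div_iff₀ (by positivity),
    mul_comm]
  refine le_trans ?_ hG
  gcongr
  exact norm_snd_le (y, e)

/-- The partial Fourier transform `(y, x) ↦ ∫ e^{-2πi⟪e, x⟫} G(y, e) de` in the second variable. -/
def partialFourier {V : Type u} [NormedAddCommGroup V] [NormedSpace ℂ V] (G : 𝓢(Y × E, V))
    (z : Y × E) : V := 𝓕 (fun e => G (z.1, e)) z.2

lemma partialFourier_eq {V : Type u} [NormedAddCommGroup V] [NormedSpace ℂ V] (G : 𝓢(Y × E, V))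
    (z : Y × E) : partialFourier G z = 𝓕 (sliceCLM z.1 G) z.2 := rfl

omit [FiniteDimensional ℝ E] [MeasurableSpace E] [BorelSpace E] in
lemma continuous_fourierChar_smul {V : Type u} [NormedAddCommGroup V] [NormedSpace ℂ V]
    (G : 𝓢(Y × E, V)) (z : Y × E) :
    Continuous fun e => Real.fourierChar (-⟪e, z.2⟫_ℝ) • G (z.1, e) :=
  (Real.continuous_fourierChar.comp (by fun_prop)).smul (sliceCLM z.1 G).continuous

lemma hasFDerivAt_partialFourier {V : Type u} [NormedAddCommGroup V] [NormedSpace ℂ V]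
    (G : 𝓢(Y × E, V)) (z : Y × E) :
    HasFDerivAt (partialFourier G)
      (partialFourier (V := (Y × E) →L[ℝ] V) (derivPartial G) z) z := by
  obtain ⟨b, hb, hbG⟩ :=
    exists_integrable_forall_norm_le (V := (Y × E) →L[ℝ] V) (derivPartial G)
  exact hasFDerivAt_integral_of_dominated_of_fderiv_le (𝕜 := ℝ) (μ := (volume : Measure E))
    (F := fun z e => Real.fourierChar (-⟪e, z.2⟫_ℝ) • G (z.1, e))
    (F' := fun z e => Real.fourierChar (-⟪e, z.2⟫_ℝ) • derivPartial G (z.1, e))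
    (x₀ := z) (s := Set.univ) (bound := b) Filter.univ_mem
    (.of_forall fun z => (continuous_fourierChar_smul G z).aestronglyMeasurable)
    ((Real.fourierIntegral_convergent_iff z.2).2 (sliceCLM z.1 G).integrable)
    (continuous_fourierChar_smul _ z).aestronglyMeasurable
    (.of_forall fun e z _ => by
      rw [Circle.smul_def, norm_smul, Circle.norm_coe, one_mul]
      exact hbG _ _)
    hb (.of_forall fun e z _ => hasFDerivAt_fourierChar_smul G e z)

lemma contDiff_partialFourier (n : ℕ) : ∀ {V : Type u} [NormedAddCommGroup V] [NormedSpace ℂ V]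
    (G : 𝓢(Y × E, V)), ContDiff ℝ n (partialFourier G) := by
  induction n with
  | zero =>
    intro V _ _ G
    exact contDiff_zero.2 (continuous_iff_continuousAt.2 fun z =>
      (hasFDerivAt_partialFourier G z).continuousAt)
  | succ n ih =>
    intro V _ _ G
    exact contDiff_succ_iff_hasFDerivAt.2
      ⟨_, ih (V := (Y × E) →L[ℝ] V) (derivPartial G), hasFDerivAt_partialFourier G⟩

lemma exists_pow_mul_norm_partialFourier_le {V : Type u} [NormedAddCommGroup V] [NormedSpace ℂ V]
    (k : ℕ) : ∃ (s : Finset (ℕ × ℕ)) (C : ℝ), 0 ≤ C ∧ ∀ (G : 𝓢(Y × E, V)) (z : Y × E),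
      ‖z‖ ^ k * ‖partialFourier G z‖ ≤ C * schwartzSup s G := by
  obtain ⟨s, C, hC, h⟩ := exists_schwartzSup_map_le
    (SchwartzMap.fourierTransformCLM ℂ : 𝓢(E, V) →L[ℂ] 𝓢(E, V)) {(k, 0), (0, 0)}
  let t := s.image fun q => (k + q.1, q.2)
  refine ⟨t ∪ s, C + C, by positivity, fun G z => ?_⟩
  have norm_le : ‖partialFourier G z‖ ≤ C * schwartzSup s (sliceCLM z.1 G) :=
    (SchwartzMap.norm_le_seminorm ℂ (𝓕 (sliceCLM z.1 G)) z.2).trans <|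
      (seminorm_le_schwartzSup (by simp) _).trans (h _)
  have pow_snd_mul_norm_le :
      ‖z.2‖ ^ k * ‖partialFourier G z‖ ≤ C * schwartzSup s (sliceCLM z.1 G) :=
    (SchwartzMap.norm_pow_mul_le_seminorm ℂ (𝓕 (sliceCLM z.1 G)) k z.2).trans <|
      (seminorm_le_schwartzSup (by simp) _).trans (h _)
  calc ‖z‖ ^ k * ‖partialFourier G z‖
      ≤ (‖z.1‖ ^ k + ‖z.2‖ ^ k) * ‖partialFourier G z‖ := by
        gcongr
        exact norm_prod_pow_le_add z k
    _ = ‖z.1‖ ^ k * ‖partialFourier G z‖ + ‖z.2‖ ^ k * ‖partialFourier G z‖ := by ring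
    _ ≤ ‖z.1‖ ^ k * (C * schwartzSup s (sliceCLM z.1 G)) + C * schwartzSup s (sliceCLM z.1 G) := by
        gcongr
    _ = C * (‖z.1‖ ^ k * schwartzSup s (sliceCLM z.1 G)) + C * schwartzSup s (sliceCLM z.1 G) := by
        ring
    _ ≤ C * schwartzSup t G + C * schwartzSup s G := by
        gcongr
        · exact pow_mul_schwartzSup_sliceCLM_le G k s z.1
        · exact schwartzSup_sliceCLM_le G s z.1
    _ ≤ C * schwartzSup (t ∪ s) G + C * schwartzSup (t ∪ s) G := by
        gcongr
        · exact schwartzSup_mono Finset.subset_union_left G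
        · exact schwartzSup_mono Finset.subset_union_right G
    _ = (C + C) * schwartzSup (t ∪ s) G := by ring

lemma exists_pow_mul_norm_iteratedFDeriv_partialFourier_le (n : ℕ) :
    ∀ {V : Type u} [NormedAddCommGroup V] [NormedSpace ℂ V] (k : ℕ),
    ∃ (s : Finset (ℕ × ℕ)) (C : ℝ), 0 ≤ C ∧ ∀ (G : 𝓢(Y × E, V)) (z : Y × E),
      ‖z‖ ^ k * ‖iteratedFDeriv ℝ n (partialFourier G) z‖ ≤ C * schwartzSup s G := by
  induction n with
  | zero =>
    intro V _ _ k
    simpa only [norm_iteratedFDeriv_zero] using exists_pow_mul_norm_partialFourier_le k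
  | succ n ih =>
    intro V _ _ k
    obtain ⟨s, C, hC, h⟩ := ih (V := (Y × E) →L[ℝ] V) k
    obtain ⟨s', C', hC', h'⟩ := exists_schwartzSup_map_le (V' := (Y × E) →L[ℝ] V)
      (derivPartial (Y := Y) (E := E) (V := V)) s
    refine ⟨s', C * C', by positivity, fun G z => ?_⟩
    have fderiv_eq : fderiv ℝ (partialFourier G) =
        partialFourier (V := (Y × E) →L[ℝ] V) (derivPartial G) :=
      funext fun z => (hasFDerivAt_partialFourier G z).fderiv
    rw [← norm_iteratedFDeriv_fderiv, fderiv_eq, mul_assoc]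
    exact (h _ z).trans (mul_le_mul_of_nonneg_left (h' G) hC)

variable {V : Type u} [NormedAddCommGroup V] [NormedSpace ℂ V]

/-- `partialFourier` as a continuous linear map of the Schwartz space. -/
def partialFourierCLM : 𝓢(Y × E, V) →L[ℂ] 𝓢(Y × E, V) :=
  SchwartzMap.mkCLM partialFourier
    (fun f g z => by
      rw [partialFourier_eq, map_add, FourierTransform.fourier_add]
      rfl)
    (fun c f z => by
      rw [partialFourier_eq, map_smul, FourierTransform.fourier_smul]
      rfl)
    (fun G => contDiff_infty.2 fun n => contDiff_partialFourier n G)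
    (fun n => exists_pow_mul_norm_iteratedFDeriv_partialFourier_le n.2 n.1)

lemma partialFourierCLM_apply (G : 𝓢(Y × E, V)) (y : Y) (x : E) :
    partialFourierCLM G (y, x) = 𝓕 (fun e => G (y, e)) x := rfl

/-- The integral `y ↦ ∫ q(e, y) de` over the first variable, encoded as the value at zero of a
partial Fourier transform. -/
def integrateCLM : 𝓢(E × Y, V) →L[ℂ] 𝓢(Y, V) :=
  (sliceCLM (0 : E)).comp (swapCLM.comp (partialFourierCLM.comp swapCLM))

@[simp]
lemma integrateCLM_apply (q : 𝓢(E × Y, V)) (y : Y) : integrateCLM q y = ∫ e, q (e, y) := by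
  simp only [integrateCLM, ContinuousLinearMap.comp_apply, sliceCLM_apply, swapCLM_apply,
    partialFourierCLM_apply, Real.fourier_eq]
  simp

end PartialFourier

/-! ### Continuous linear maps commute with integrals of Schwartz functions -/

section IntegralOfClosed

variable {α A B M : Type*} [MeasurableSpace α] {μ : Measure α} [NormedAddCommGroup A]
  [NormedSpace ℝ A] [CompleteSpace A] [NormedAddCommGroup B] [NormedSpace ℝ B] [CompleteSpace B]
  [AddCommGroup M] [Module ℝ M]

lemma integral_mem_of_isClosed {S : Submodule ℝ A} (hS : IsClosed (S : Set A)) {f : α → A}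
    (hf : ∀ x, f x ∈ S) : ∫ x, f x ∂μ ∈ S := by
  by_cases hint : Integrable f μ
  · have : IsClosed (S : Set A) := hS
    rw [← Submodule.Quotient.mk_eq_zero]
    change S.mkQL (∫ x, f x ∂μ) = 0
    rw [← S.mkQL.integral_comp_comm hint]
    exact integral_eq_zero_of_ae (.of_forall fun x => (Submodule.Quotient.mk_eq_zero _).2 (hf x))
  · rw [integral_undef hint]
    exact S.zero_mem

/-- The estimate makes the closure of the range of `(J, W)` the graph of a function of its first
component. -/
lemma integral_map_eq_of_norm_le {J : M →ₗ[ℝ] A} {W : M →ₗ[ℝ] B} {C : ℝ}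
    (h : ∀ F, ‖W F‖ ≤ C * ‖J F‖) {f : α → M} (hJ : Integrable (fun x => J (f x)) μ)
    (hW : Integrable (fun x => W (f x)) μ) {F₀ : M} (hF₀ : ∫ x, J (f x) ∂μ = J F₀) :
    ∫ x, W (f x) ∂μ = W F₀ := by
  let S := LinearMap.range (J.prod W)
  have norm_snd_le_of_mem : ∀ p ∈ S.topologicalClosure, ‖p.2‖ ≤ C * ‖p.1‖ := by
    refine fun p hp => closure_minimal (t := {p : A × B | ‖p.2‖ ≤ C * ‖p.1‖}) ?_
      (isClosed_le (by fun_prop) (by fun_prop)) hp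
    rintro _ ⟨F, rfl⟩
    exact h F
  have integral_mem : ∫ x, (J (f x), W (f x)) ∂μ ∈ S.topologicalClosure :=
    integral_mem_of_isClosed S.isClosed_topologicalClosure
      fun x => S.le_topologicalClosure ⟨f x, rfl⟩
  rw [integral_pair hJ hW, hF₀] at integral_mem
  have norm_sub_le := norm_snd_le_of_mem _
    (S.topologicalClosure.sub_mem integral_mem (S.le_topologicalClosure ⟨F₀, rfl⟩))
  simp only [LinearMap.prod_apply, Function.prod_apply, Prod.mk_sub_mk, sub_self, norm_zero,
    mul_zero, norm_le_zero_iff] at norm_sub_le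
  exact sub_eq_zero.1 norm_sub_le

end IntegralOfClosed

section WeightedDerivatives

variable {Y V : Type*} [NormedAddCommGroup Y] [NormedSpace ℝ Y] [NormedAddCommGroup V]
  [NormedSpace ℂ V]

/-- The space of values of the `n`-th derivative, as a type synonym that hides the continuous
multilinear maps from instance search in families indexed by `n`. -/
def Jet (Y V : Type*) [NormedAddCommGroup Y] [NormedSpace ℝ Y] [NormedAddCommGroup V]
    [NormedSpace ℂ V] (n : ℕ) : Type _ := Y [×n]→L[ℝ] V

instance (n : ℕ) : NormedAddCommGroup (Jet Y V n) :=
  inferInstanceAs (NormedAddCommGroup (Y [×n]→L[ℝ] V))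

instance (n : ℕ) : NormedSpace ℝ (Jet Y V n) :=
  inferInstanceAs (NormedSpace ℝ (Y [×n]→L[ℝ] V))

instance [CompleteSpace V] (n : ℕ) : CompleteSpace (Jet Y V n) :=
  inferInstanceAs (CompleteSpace (Y [×n]→L[ℝ] V))

/-- The `n`-th derivative of a Schwartz function. -/
def jet (n : ℕ) (F : 𝓢(Y, V)) (y : Y) : Jet Y V n := iteratedFDeriv ℝ n F y

lemma continuous_jet (n : ℕ) (F : 𝓢(Y, V)) : Continuous (jet n F) :=
  (F.smooth n).continuous_iteratedFDeriv le_rfl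

lemma pow_mul_norm_jet_le (k n : ℕ) (F : 𝓢(Y, V)) (y : Y) :
    ‖y‖ ^ k * ‖jet n F y‖ ≤ SchwartzMap.seminorm ℂ k n F :=
  SchwartzMap.le_seminorm ℂ k n F y

/-- The bounded continuous function `y ↦ ‖y‖ᵏ Dⁿ F(y)`, whose supremum norm is a Schwartz
seminorm of `F`. -/
def weightedDeriv (k n : ℕ) (F : 𝓢(Y, V)) : Y →ᵇ Jet Y V n :=
  BoundedContinuousFunction.ofNormedAddCommGroup (fun y => ‖y‖ ^ k • jet n F y)
    ((continuous_norm.pow k).smul (continuous_jet n F)) (SchwartzMap.seminorm ℂ k n F) fun y => by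
      rw [norm_smul, norm_pow, norm_norm]
      exact pow_mul_norm_jet_le k n F y

lemma weightedDeriv_apply (k n : ℕ) (F : 𝓢(Y, V)) (y : Y) :
    weightedDeriv k n F y = ‖y‖ ^ k • jet n F y := rfl

lemma norm_weightedDeriv (k n : ℕ) (F : 𝓢(Y, V)) :
    ‖weightedDeriv k n F‖ = SchwartzMap.seminorm ℂ k n F := by
  refine le_antisymm (BoundedContinuousFunction.norm_ofNormedAddCommGroup_le _ (apply_nonneg _ _) _)
    (SchwartzMap.seminorm_le_bound ℂ k n F (norm_nonneg _) fun y => ?_)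
  refine le_trans (le_of_eq ?_) ((weightedDeriv k n F).norm_coe_le_norm y)
  rw [weightedDeriv_apply, norm_smul, norm_pow, norm_norm]
  rfl

/-- The weighted derivatives of finitely many orders, a linear map from the Schwartz space to a
Banach space in which Bochner integrals are available. -/
def weightedDerivs (s : Finset (ℕ × ℕ)) :
    𝓢(Y, V) →ₗ[ℝ] ((q : s) → Y →ᵇ Jet Y V q.1.2) where
  toFun F q := weightedDeriv q.1.1 q.1.2 F
  map_add' F G := by
    funext q
    ext1 y
    simp only [weightedDeriv_apply, Pi.add_apply, BoundedContinuousFunction.coe_add]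
    rw [← smul_add]
    congr 1
    exact iteratedFDeriv_add_apply (F.smooth _).contDiffAt (G.smooth _).contDiffAt
  map_smul' c F := by
    funext q
    ext1 y
    simp only [weightedDeriv_apply, Pi.smul_apply, BoundedContinuousFunction.coe_smul,
      RingHom.id_apply]
    rw [smul_comm]
    congr 1
    exact iteratedFDeriv_const_smul_apply (F.smooth _).contDiffAt

lemma norm_weightedDerivs (s : Finset (ℕ × ℕ)) (F : 𝓢(Y, V)) :
    ‖weightedDerivs s F‖ = schwartzSup s F := by
  refine le_antisymm ((pi_norm_le_iff_of_nonneg (apply_nonneg _ _)).2 fun q => ?_)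
    (schwartzSup_le (norm_nonneg _) fun k n hq => ?_)
  · exact (norm_weightedDeriv q.1.1 q.1.2 F).trans_le (seminorm_le_schwartzSup q.2 F)
  · rw [← norm_weightedDeriv]
    exact norm_le_pi_norm (weightedDerivs s F) ⟨(k, n), hq⟩

lemma continuous_weightedDerivs (s : Finset (ℕ × ℕ)) :
    Continuous (weightedDerivs s : 𝓢(Y, V) →ₗ[ℝ] _) := by
  refine continuous_of_continuousAt_zero (weightedDerivs s).toAddMonoidHom ?_
  change ContinuousAt (weightedDerivs s) 0
  rw [ContinuousAt, map_zero, tendsto_zero_iff_norm_tendsto_zero]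
  simpa only [norm_weightedDerivs, map_zero] using
    (continuous_schwartzSup (X := Y) (V := V) s).tendsto 0

end WeightedDerivatives

section Integration

variable {Y E : Type u} [NormedAddCommGroup Y] [NormedSpace ℝ Y]
  [NormedAddCommGroup E] [InnerProductSpace ℝ E]

/-- The partial derivative `(e, y) ↦ D_y q(e, y)`. -/
def derivSnd {V : Type u} [NormedAddCommGroup V] [NormedSpace ℂ V] :
    𝓢(E × Y, V) →L[ℂ] 𝓢(E × Y, Y →L[ℝ] V) :=
  (SchwartzMap.postcompCLM (precompCLM (ContinuousLinearMap.inr ℝ E Y))).comp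
    (SchwartzMap.fderivCLM ℂ (E × Y) V)

lemma hasFDerivAt_derivSnd {V : Type u} [NormedAddCommGroup V] [NormedSpace ℂ V]
    (q : 𝓢(E × Y, V)) (e : E) (y : Y) :
    HasFDerivAt (fun y => q (e, y)) (derivSnd q (e, y)) y :=
  (q.hasFDerivAt (e, y)).comp y (hasFDerivAt_prodMk_right e y)

variable [FiniteDimensional ℝ E] [MeasurableSpace E] [BorelSpace E]

lemma hasFDerivAt_integral {V : Type u} [NormedAddCommGroup V] [NormedSpace ℂ V]
    (q : 𝓢(E × Y, V)) (y : Y) :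
    HasFDerivAt (fun y => ∫ e, q (e, y)) (∫ e, derivSnd q (e, y)) y := by
  obtain ⟨b, hb, hbq⟩ :=
    exists_integrable_forall_norm_le (V := Y →L[ℝ] V) (swapCLM (V := Y →L[ℝ] V) (derivSnd q))
  exact hasFDerivAt_integral_of_dominated_of_fderiv_le (𝕜 := ℝ) (μ := (volume : Measure E))
    (F := fun y e => q (e, y)) (F' := fun y e => derivSnd q (e, y)) (s := Set.univ) (bound := b)
    Filter.univ_mem
    (.of_forall fun y => (sliceCLM y (swapCLM q)).continuous.aestronglyMeasurable)
    (sliceCLM y (swapCLM q)).integrable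
    (sliceCLM (V := Y →L[ℝ] V) y
      (swapCLM (V := Y →L[ℝ] V) (derivSnd q))).continuous.aestronglyMeasurable
    (.of_forall fun e y _ => hbq y e) hb (.of_forall fun e y _ => hasFDerivAt_derivSnd q e y)

lemma iteratedFDeriv_integral (n : ℕ) : ∀ {V : Type u} [NormedAddCommGroup V]
    [NormedSpace ℂ V] [CompleteSpace V] (q : 𝓢(E × Y, V)) (y : Y),
    iteratedFDeriv ℝ n (fun y => ∫ e, q (e, y)) y =
      ∫ e, iteratedFDeriv ℝ n (fun y => q (e, y)) y := by
  induction n with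
  | zero =>
    intro V _ _ _ q y
    simp only [iteratedFDeriv_zero_eq_comp, Function.comp_apply]
    exact (ContinuousLinearEquiv.integral_comp_comm (μ := (volume : Measure E))
      (continuousMultilinearCurryFin0 ℝ Y V).symm.toContinuousLinearEquiv fun e => q (e, y)).symm
  | succ n ih =>
    intro V _ _ _ q y
    have fderiv_integral : fderiv ℝ (fun y => ∫ e, q (e, y)) = fun y => ∫ e, derivSnd q (e, y) :=
      funext fun y => (hasFDerivAt_integral q y).fderiv
    have fderiv_slice e : fderiv ℝ (fun y => q (e, y)) = fun y => derivSnd q (e, y) :=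
      funext fun y => (hasFDerivAt_derivSnd q e y).fderiv
    simp only [iteratedFDeriv_succ_eq_comp_right, Function.comp_apply, fderiv_integral,
      fderiv_slice]
    rw [ih (V := Y →L[ℝ] V) (derivSnd q) y]
    exact (ContinuousLinearEquiv.integral_comp_comm (μ := (volume : Measure E)) (𝕜 := ℝ)
      (E := Y [×n]→L[ℝ] (Y →L[ℝ] V)) (F := Y [×(n + 1)]→L[ℝ] V)
      (continuousMultilinearCurryRightEquiv' ℝ n Y V).symm.toContinuousLinearEquiv _).symm

lemma integrable_schwartzSup_sliceCLM {V : Type*} [NormedAddCommGroup V] [NormedSpace ℂ V]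
    (q : 𝓢(E × Y, V)) (s : Finset (ℕ × ℕ)) :
    Integrable fun e => schwartzSup s (sliceCLM e q) := by
  have norm_eq e : ‖schwartzSup s (sliceCLM e q)‖ = schwartzSup s (sliceCLM e q) :=
    Real.norm_of_nonneg (apply_nonneg _ _)
  have h := integrable_of_le_of_pow_mul_le (μ := (volume : Measure E)) (k := 0)
    (fun e => (norm_eq e).trans_le (schwartzSup_sliceCLM_le q s e))
    (fun e => (congrArg _ (norm_eq e)).trans_le (pow_mul_schwartzSup_sliceCLM_le q _ s e))
    ((continuous_schwartzSup s).comp (continuous_sliceCLM q)).aestronglyMeasurable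
  simpa only [pow_zero, one_mul, norm_eq] using h

lemma integrable_map_sliceCLM {V H : Type*} [NormedAddCommGroup V] [NormedSpace ℂ V]
    [NormedAddCommGroup H] [NormedSpace ℂ H] (W : 𝓢(Y, V) →L[ℂ] H) (q : 𝓢(E × Y, V)) :
    Integrable fun e => W (sliceCLM e q) := by
  obtain ⟨s, C, -, h⟩ := exists_norm_map_le W
  exact ((integrable_schwartzSup_sliceCLM q s).const_mul C).mono'
    (W.continuous.comp (continuous_sliceCLM q)).aestronglyMeasurable (.of_forall fun e => h _)

variable {V : Type u} [NormedAddCommGroup V] [NormedSpace ℂ V]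

lemma integrable_weightedDerivs_sliceCLM (s : Finset (ℕ × ℕ)) (q : 𝓢(E × Y, V)) :
    Integrable fun e => weightedDerivs s (sliceCLM e q) :=
  (integrable_schwartzSup_sliceCLM q s).mono'
    ((continuous_weightedDerivs s).comp (continuous_sliceCLM q)).aestronglyMeasurable
    (.of_forall fun _ => (norm_weightedDerivs s _).le)

variable [CompleteSpace V]

lemma integral_weightedDerivs_sliceCLM (s : Finset (ℕ × ℕ)) (q : 𝓢(E × Y, V)) :
    ∫ e, weightedDerivs s (sliceCLM e q) = weightedDerivs s (integrateCLM q) := by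
  funext p
  ext1 y
  let ev : ((q : s) → Y →ᵇ Jet Y V q.1.2) →L[ℝ] Jet Y V p.1.2 :=
    (BoundedContinuousFunction.evalCLM ℝ y).comp (ContinuousLinearMap.proj p)
  change ev (∫ e, weightedDerivs s (sliceCLM e q)) = _
  rw [← ev.integral_comp_comm (integrable_weightedDerivs_sliceCLM s q)]
  change ∫ e, ‖y‖ ^ p.1.1 • jet p.1.2 (sliceCLM e q) y = ‖y‖ ^ p.1.1 • jet p.1.2 (integrateCLM q) y
  rw [integral_smul, jet, show ⇑(integrateCLM q) = fun y => ∫ e, q (e, y) from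
    funext (integrateCLM_apply q), iteratedFDeriv_integral]
  rfl

theorem map_integrateCLM {H : Type*} [NormedAddCommGroup H] [NormedSpace ℂ H] [CompleteSpace H]
    (W : 𝓢(Y, V) →L[ℂ] H) (q : 𝓢(E × Y, V)) :
    W (integrateCLM q) = ∫ e, W (sliceCLM e q) := by
  obtain ⟨s, C, -, h⟩ := exists_norm_map_le W
  refine (integral_map_eq_of_norm_le (J := weightedDerivs s) (C := C)
    (W := W.toLinearMap.restrictScalars ℝ) (fun F => ?_)
    (integrable_weightedDerivs_sliceCLM s q) (integrable_map_sliceCLM W q)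
    (integral_weightedDerivs_sliceCLM s q)).symm
  rw [norm_weightedDerivs]
  exact h F

end Integration

/-! ### Mollification, and density of tensor products -/

section Mollify

/-- The product of a scalar Schwartz function and a Schwartz function of other variables. -/
abbrev smulTensor {X Y V : Type*} [NormedAddCommGroup X] [NormedSpace ℝ X] [NormedAddCommGroup Y]
    [NormedSpace ℝ Y] [NormedAddCommGroup V] [NormedSpace ℂ V] (f : 𝓢(X, ℂ)) :
    𝓢(Y, V) →L[ℂ] 𝓢(X × Y, V) := tensorCLM (ContinuousLinearMap.lsmul ℂ ℂ) f

lemma exists_schwartz_eq_one (X : Type*) [NormedAddCommGroup X] [InnerProductSpace ℝ X]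
    [FiniteDimensional ℝ X] (R : ℝ) : ∃ χ : 𝓢(X, ℂ), ∀ x, ‖x‖ ≤ R → χ x = 1 := by
  let f : ContDiffBump (0 : X) := ⟨|R| + 1, |R| + 2, by positivity, by linarith⟩
  have hsupport : HasCompactSupport fun x => (f x : ℂ) :=
    f.hasCompactSupport.comp_left Complex.ofReal_zero
  refine ⟨hsupport.toSchwartzMap (Complex.ofRealCLM.contDiff.comp f.contDiff), fun x hx => ?_⟩
  change (f x : ℂ) = 1
  rw [f.one_of_mem_closedBall, Complex.ofReal_one]
  rw [mem_closedBall_zero_iff]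
  change ‖x‖ ≤ |R| + 1
  linarith [le_abs_self R]

variable {E : Type u} [NormedAddCommGroup E] [InnerProductSpace ℝ E] [FiniteDimensional ℝ E]
  [MeasurableSpace E] [BorelSpace E]

variable (E) in
lemma exists_schwartz_integral_eq_one : ∃ ρ : 𝓢(E, ℂ), ∫ x, ρ x = 1 := by
  let f : ContDiffBump (0 : E) := ⟨1, 2, one_pos, one_lt_two⟩
  have hsupport : HasCompactSupport fun x => (f.normed volume x : ℂ) :=
    f.hasCompactSupport_normed.comp_left Complex.ofReal_zero
  refine ⟨hsupport.toSchwartzMap (Complex.ofRealCLM.contDiff.comp f.contDiff_normed), ?_⟩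
  change ∫ x, (f.normed volume x : ℂ) = 1
  rw [integral_complex_ofReal, f.integral_normed, Complex.ofReal_one]

variable (E) in
/-- A fixed Schwartz function of integral one. -/
def mollifier : 𝓢(E, ℂ) := (exists_schwartz_integral_eq_one E).choose

lemma integral_mollifier : ∫ x, mollifier E x = 1 := (exists_schwartz_integral_eq_one E).choose_spec

variable (E) in
/-- The factor `ε⁻ᵈ` that gives the dilated mollifier integral one. -/
def mollifierScale (ε : ℝ) : ℂ := (|ε ^ Module.finrank ℝ E|⁻¹ : ℝ)

/-- The dilated mollifier, centred at `u`. -/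
def scaledMollifier {ε : ℝ} (hε : ε ≠ 0) (u : E) : 𝓢(E, ℂ) :=
  mollifierScale E ε • compCLMOfLeftInverse (Φ := fun x => ε⁻¹ • (x - u))
    (Ψ := fun z => ε • z + u) (by fun_prop) (by fun_prop)
    (fun x => by simp [smul_inv_smul₀ hε]) (mollifier E)

lemma scaledMollifier_apply {ε : ℝ} (hε : ε ≠ 0) (u x : E) :
    scaledMollifier hε u x = mollifierScale E ε * mollifier E (ε⁻¹ • (x - u)) := rfl

variable {Y V : Type u} [NormedAddCommGroup Y] [NormedSpace ℝ Y] [NormedAddCommGroup V]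
  [NormedSpace ℂ V]

/-- The family `u ↦ ρ_ε(· - u) ⊗ F(u, ·)` as one Schwartz function. -/
def mollifyKernel {ε : ℝ} (hε : ε ≠ 0) (F : 𝓢(E × Y, V)) : 𝓢(E × (E × Y), V) :=
  mollifierScale E ε • compCLMOfLeftInverse
    (Φ := fun w : E × (E × Y) => (ε⁻¹ • (w.2.1 - w.1), (w.1, w.2.2)))
    (Ψ := fun z : E × (E × Y) => (z.2.1, (ε • z.1 + z.2.1, z.2.2))) (by fun_prop) (by fun_prop)
    (fun w => by simp [smul_inv_smul₀ hε]) (smulTensor (mollifier E) F)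

lemma mollifyKernel_apply {ε : ℝ} (hε : ε ≠ 0) (F : 𝓢(E × Y, V)) (u x : E) (y : Y) :
    mollifyKernel hε F (u, (x, y)) =
      mollifierScale E ε • mollifier E (ε⁻¹ • (x - u)) • F (u, y) := rfl

lemma sliceCLM_mollifyKernel {ε : ℝ} (hε : ε ≠ 0) (F : 𝓢(E × Y, V)) (u : E) :
    sliceCLM u (mollifyKernel hε F) = smulTensor (scaledMollifier hε u) (sliceCLM u F) := by
  ext ⟨x, y⟩
  rw [sliceCLM_apply, mollifyKernel_apply, tensorCLM_apply, scaledMollifier_apply, sliceCLM_apply,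
    smul_smul]
  rfl

lemma integrateCLM_mollifyKernel_apply {ε : ℝ} (hε : ε ≠ 0) (F : 𝓢(E × Y, V)) [CompleteSpace V]
    (x : E) (y : Y) :
    integrateCLM (mollifyKernel hε F) (x, y) = ∫ z, mollifier E z • F (x - ε • z, y) := by
  have htranslate := integral_sub_left_eq_self (μ := (volume : Measure E))
    (fun u => mollifier E (ε⁻¹ • (x - u)) • F (u, y)) x
  have hdilate := Measure.integral_comp_smul (volume : Measure E)
    (fun u => mollifier E (ε⁻¹ • u) • F (x - u, y)) ε
  simp only [sub_sub_cancel] at htranslate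
  simp only [inv_smul_smul₀ hε] at hdilate
  rw [integrateCLM_apply, hdilate, htranslate]
  simp only [mollifyKernel_apply]
  rw [integral_smul, mollifierScale, ← Complex.coe_smul, abs_inv]

/-- The scale `0` is included: this makes the limit of the mollifications a value at `m = 0`. -/
lemma exists_mollify_family (F : 𝓢(E × Y, V)) [CompleteSpace V] : ∃ Q : 𝓢(ℝ × (E × Y), V),
    sliceCLM 0 Q = F ∧ ∀ (m : ℝ) (hm : m ≠ 0), |m| ≤ 1 →
      sliceCLM m Q = integrateCLM (mollifyKernel hm F) := by
  obtain ⟨η, hη⟩ := exists_schwartz_eq_one ℝ 1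
  let Q : 𝓢(ℝ × (E × Y), V) := integrateCLM (compCLMOfLeftInverse
    (Φ := fun w : E × (ℝ × (E × Y)) => (w.1, (w.2.1, (w.2.2.1 - w.2.1 • w.1, w.2.2.2))))
    (Ψ := fun z : E × (ℝ × (E × Y)) => (z.1, (z.2.1, (z.2.2.1 + z.2.1 • z.1, z.2.2.2))))
    (by fun_prop) (by fun_prop) (fun w => by simp) (smulTensor (mollifier E) (smulTensor η F)))
  have hQ (t x y) : Q (t, (x, y)) = ∫ z, mollifier E z • η t • F (x - t • z, y) :=
    integrateCLM_apply _ _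
  refine ⟨Q, ?_, fun m hm hm1 => ?_⟩
  · ext ⟨x, y⟩
    rw [sliceCLM_apply, hQ, hη 0 (by simp)]
    simp only [one_smul, zero_smul, sub_zero]
    rw [integral_smul_const, integral_mollifier, one_smul]
  · ext ⟨x, y⟩
    rw [sliceCLM_apply, hQ, hη m (by simpa using hm1), integrateCLM_mollifyKernel_apply]
    simp only [one_smul]

/-- The scale of the `m`-th mollifier. -/
def mollifyStep (m : ℕ) : ℝ := 1 / ((m : ℝ) + 1)

lemma mollifyStep_ne_zero (m : ℕ) : mollifyStep m ≠ 0 := by unfold mollifyStep; positivity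

lemma abs_mollifyStep_le_one (m : ℕ) : |mollifyStep m| ≤ 1 := by
  unfold mollifyStep
  rw [abs_of_nonneg (by positivity), div_le_one (by positivity)]
  linarith [(Nat.cast_nonneg m : (0 : ℝ) ≤ m)]

variable {H : Type*} [NormedAddCommGroup H] [NormedSpace ℂ H]

lemma continuous_mollify (W : 𝓢(E × Y, V) →L[ℂ] H) (F : 𝓢(E × Y, V)) {ε : ℝ} (hε : ε ≠ 0) :
    Continuous fun u => W (smulTensor (scaledMollifier hε u) (sliceCLM u F)) := by
  simp only [← sliceCLM_mollifyKernel]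
  exact W.continuous.comp (continuous_sliceCLM _)

variable [CompleteSpace H] [CompleteSpace V]

theorem tendsto_integral_mollify (W : 𝓢(E × Y, V) →L[ℂ] H) (F : 𝓢(E × Y, V)) :
    Filter.Tendsto (fun m => ∫ u, W (smulTensor (scaledMollifier (mollifyStep_ne_zero m) u)
      (sliceCLM u F))) Filter.atTop (𝓝 (W F)) := by
  obtain ⟨Q, hQ0, hQ⟩ := exists_mollify_family F
  have hlim : Filter.Tendsto (fun m => W (sliceCLM (mollifyStep m) Q)) Filter.atTop
      (𝓝 (W F)) := by
    have hcont : Continuous fun t => W (sliceCLM t Q) := W.continuous.comp (continuous_sliceCLM Q)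
    have htendsto := (hcont.tendsto 0).comp tendsto_one_div_add_atTop_nhds_zero_nat
    rw [hQ0] at htendsto
    exact htendsto
  refine hlim.congr fun m => ?_
  rw [hQ _ (mollifyStep_ne_zero m) (abs_mollifyStep_le_one m), map_integrateCLM]
  simp only [sliceCLM_mollifyKernel]

theorem eq_zero_of_forall_smulTensor (W : 𝓢(E × Y, V) →L[ℂ] H)
    (h : ∀ f g, W (smulTensor f g) = 0) : W = 0 := by
  ext F
  have hlim := tendsto_integral_mollify W F
  simp only [h, integral_zero] at hlim
  exact tendsto_nhds_unique hlim tendsto_const_nhds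

lemma ext_of_smulTensor {W W' : 𝓢(E × Y, V) →L[ℂ] H}
    (h : ∀ f g, W (smulTensor f g) = W' (smulTensor f g)) : W = W' :=
  sub_eq_zero.1 (eq_zero_of_forall_smulTensor _ fun f g => sub_eq_zero.2 (h f g))

theorem stronglyMeasurable_map_of_sliceCLM {Θ : Type*} [MeasurableSpace Θ] (g : Θ → 𝓢(E × Y, V))
    (hg : ∀ (W : 𝓢(Y, V) →L[ℂ] H) (u : E), StronglyMeasurable fun θ => W (sliceCLM u (g θ)))
    (W : 𝓢(E × Y, V) →L[ℂ] H) : StronglyMeasurable fun θ => W (g θ) := by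
  refine stronglyMeasurable_of_tendsto Filter.atTop (f := fun (m : ℕ) θ => ∫ u, W
    (smulTensor (scaledMollifier (mollifyStep_ne_zero m) u) (sliceCLM u (g θ)))) (fun m => ?_)
    (tendsto_pi_nhds.2 fun θ => tendsto_integral_mollify W (g θ))
  refine StronglyMeasurable.integral_prod_left (f := fun u θ => W
    (smulTensor (scaledMollifier (mollifyStep_ne_zero m) u) (sliceCLM u (g θ)))) ?_
  exact stronglyMeasurable_uncurry_of_continuous_of_stronglyMeasurable
    (fun θ => continuous_mollify W (g θ) (mollifyStep_ne_zero m))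
    (fun u => hg (W.comp (smulTensor (scaledMollifier (mollifyStep_ne_zero m) u))) u)

end Mollify

/-! ### Test functions of several spacetime variables -/

section SeveralVariables

variable {V : Type*} [NormedAddCommGroup V] [NormedSpace ℂ V]

/-- The identification of a list of `n + 1` spacetime points with its head and its tail. -/
def consCLE (n : ℕ) : (Mink × (Fin n → Mink)) ≃L[ℝ] (Fin (n + 1) → Mink) :=
  Fin.consEquivL ℝ fun _ => Mink

/-- A Schwartz function of `n + 1` variables as a function of the first and the other ones. -/
def uncons (n : ℕ) : 𝓢(Fin (n + 1) → Mink, V) →L[ℂ] 𝓢(Mink × (Fin n → Mink), V) :=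
  SchwartzMap.compCLMOfContinuousLinearEquiv ℂ (consCLE n)

/-- The inverse of `uncons`. -/
def recons (n : ℕ) : 𝓢(Mink × (Fin n → Mink), V) →L[ℂ] 𝓢(Fin (n + 1) → Mink, V) :=
  SchwartzMap.compCLMOfContinuousLinearEquiv ℂ (consCLE n).symm

lemma uncons_apply {n : ℕ} (F : 𝓢(Fin (n + 1) → Mink, V)) (z : Mink × (Fin n → Mink)) :
    uncons n F z = F (Fin.cons z.1 z.2) := rfl

lemma recons_apply {n : ℕ} (F : 𝓢(Mink × (Fin n → Mink), V)) (x : Fin (n + 1) → Mink) :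
    recons n F x = F (x 0, Fin.tail x) := rfl

lemma recons_uncons {n : ℕ} (F : 𝓢(Fin (n + 1) → Mink, V)) : recons n (uncons n F) = F := by
  ext x
  simp [recons_apply, uncons_apply]

/-- A vector as a Schwartz function of no variables. -/
def constZero (v : V) : 𝓢(Fin 0 → Mink, V) :=
  HasCompactSupport.toSchwartzMap (f := fun _ => v)
    (HasCompactSupport.of_compactSpace _) contDiff_const

lemma constZero_apply (v : V) (x : Fin 0 → Mink) : constZero v x = v := rfl

lemma eq_constZero (F : 𝓢(Fin 0 → Mink, V)) : F = constZero (F 0) := by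
  ext x
  rw [constZero_apply, Subsingleton.elim x 0]

variable {H : Type*} [NormedAddCommGroup H] [NormedSpace ℂ H] [CompleteSpace H]

theorem stronglyMeasurable_map {V : Type} [NormedAddCommGroup V] [NormedSpace ℂ V]
    [FiniteDimensional ℂ V] {Θ : Type*} [MeasurableSpace Θ] {n : ℕ} (g : Θ → 𝓢(Fin n → Mink, V))
    (hg : ∀ x, StronglyMeasurable fun θ => g θ x)
    (W : 𝓢(Fin n → Mink, V) →L[ℂ] H) : StronglyMeasurable fun θ => W (g θ) := by
  have : CompleteSpace V := FiniteDimensional.complete ℂ V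
  induction n with
  | zero =>
    let c : V →ₗ[ℂ] 𝓢(Fin 0 → Mink, V) :=
      { toFun := constZero
        map_add' := fun _ _ => rfl
        map_smul' := fun _ _ => rfl }
    have hc : Continuous c := c.continuous_of_finiteDimensional
    have hW : (fun θ => W (g θ)) = fun θ => (W ∘ c) (g θ 0) :=
      funext fun θ => congrArg W (eq_constZero (g θ))
    rw [hW]
    exact (W.continuous.comp hc).comp_stronglyMeasurable (hg 0)
  | succ n ih =>
    have hW : (fun θ => W (g θ)) = fun θ => (W.comp (recons n)) (uncons n (g θ)) := by
      funext θ
      rw [ContinuousLinearMap.comp_apply, recons_uncons]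
    rw [hW]
    refine stronglyMeasurable_map_of_sliceCLM (fun θ => uncons n (g θ)) (fun W u => ?_) _
    exact ih (fun θ => sliceCLM u (uncons n (g θ))) (fun x => hg _) W

end SeveralVariables

section Tensors

variable {K : ℕ}

/-- The product of components, `(a, b) ↦ (k ↦ a_{k₀} b_{k₁ … kₙ})`. -/
def mulComponents (K n : ℕ) :
    (Fin K → ℂ) →L[ℂ] ((Fin n → Fin K) → ℂ) →L[ℂ] ((Fin (n + 1) → Fin K) → ℂ) :=
  LinearMap.mkContinuous₂
    (LinearMap.mk₂ ℂ (fun a b k => a (k 0) * b (Fin.tail k))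
      (fun _ _ _ => by ext; simp [add_mul]) (fun _ _ _ => by ext; simp [mul_assoc])
      (fun _ _ _ => by ext; simp [mul_add]) (fun _ _ _ => by ext; simp; ring)) 1
    (fun a b => by
      rw [one_mul]
      refine (pi_norm_le_iff_of_nonneg (by positivity)).2 fun k => ?_
      change ‖a (k 0) * b (Fin.tail k)‖ ≤ _
      rw [norm_mul]
      gcongr
      · exact norm_le_pi_norm a _
      · exact norm_le_pi_norm b _)

@[simp]
lemma mulComponents_apply {n : ℕ} (a : Fin K → ℂ) (b : (Fin n → Fin K) → ℂ)
    (k : Fin (n + 1) → Fin K) : mulComponents K n a b k = a (k 0) * b (Fin.tail k) := rfl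

/-- The tensor product `f ⊗ G`, with the variable of `f` first. -/
def consTensor {n : ℕ} (f : Test K) : TestN K n →L[ℂ] TestN K (n + 1) :=
  (recons n).comp (tensorCLM (mulComponents K n) f)

lemma consTensor_apply {n : ℕ} (f : Test K) (G : TestN K n) (x : Fin (n + 1) → Mink)
    (k : Fin (n + 1) → Fin K) :
    consTensor f G x k = f (x 0) (k 0) * G (Fin.tail x) (Fin.tail k) := rfl

lemma IsTensor.cons {n : ℕ} {f : Fin (n + 1) → Test K} {G : TestN K n}
    (h : IsTensor (fun j => f j.succ) G) : IsTensor f (consTensor (f 0) G) := by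
  intro x k
  rw [consTensor_apply, h, Fin.prod_univ_succ]
  rfl

lemma isTensor_constZero_one (f : Fin 0 → Test K) : IsTensor f (constZero fun _ => 1) :=
  fun x k => by simp [constZero_apply]

lemma eq_smul_constZero_one (F : TestN K 0) : F = F 0 default • constZero fun _ => 1 := by
  ext x k
  rw [Subsingleton.elim x 0, Subsingleton.elim k default]
  simp [constZero_apply]

lemma exists_isTensor {n : ℕ} (f : Fin n → Test K) : ∃ F : TestN K n, IsTensor f F := by
  induction n with
  | zero => exact ⟨_, isTensor_constZero_one f⟩
  | succ n ih =>
    obtain ⟨G, hG⟩ := ih fun j => f j.succ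
    exact ⟨_, hG.cons⟩

/-- The Schwartz function `f e_k` with values in `ℂᴷ`. -/
def singleComponent {ι X : Type*} [Fintype ι] [DecidableEq ι] [NormedAddCommGroup X]
    [NormedSpace ℝ X] (k : ι) : 𝓢(X, ℂ) →L[ℂ] 𝓢(X, ι → ℂ) :=
  SchwartzMap.postcompCLM (ContinuousLinearMap.single ℂ (fun _ : ι => ℂ) k)

lemma singleComponent_apply {ι X : Type*} [Fintype ι] [DecidableEq ι] [NormedAddCommGroup X]
    [NormedSpace ℝ X] (k l : ι) (f : 𝓢(X, ℂ)) (x : X) :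
    singleComponent k f x l = if l = k then f x else 0 := by
  change (Pi.single k (f x) : ι → ℂ) l = _
  rw [Pi.single_apply]

/-- The component `F_k` of a multi-component Schwartz function. -/
def component {ι X : Type*} [Fintype ι] [NormedAddCommGroup X]
    [NormedSpace ℝ X] (k : ι) : 𝓢(X, ι → ℂ) →L[ℂ] 𝓢(X, ℂ) :=
  SchwartzMap.postcompCLM (ContinuousLinearMap.proj k)

lemma component_apply {ι X : Type*} [Fintype ι] [NormedAddCommGroup X]
    [NormedSpace ℝ X] (k : ι) (F : 𝓢(X, ι → ℂ)) (x : X) : component k F x = F x k := rfl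

lemma recons_smulTensor_eq_sum {n : ℕ} (f : 𝓢(Mink, ℂ))
    (g : 𝓢(Fin n → Mink, (Fin (n + 1) → Fin K) → ℂ)) :
    recons n (smulTensor f g) = ∑ k : Fin (n + 1) → Fin K,
      consTensor (singleComponent (k 0) f) (singleComponent (Fin.tail k) (component k g)) := by
  ext x l
  have cons_eq_iff (k : Fin (n + 1) → Fin K) : l 0 = k 0 ∧ Fin.tail l = Fin.tail k ↔ l = k := by
    rw [← Fin.cons_inj (α := fun _ => Fin K), Fin.cons_self_tail, Fin.cons_self_tail]
  simp [consTensor_apply, recons_apply, singleComponent_apply,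
    component_apply, ← ite_and, and_comm, cons_eq_iff]

variable {H : Type*} [NormedAddCommGroup H] [NormedSpace ℂ H] [CompleteSpace H]

lemma eq_zero_of_forall_consTensor {n : ℕ} (W : TestN K (n + 1) →L[ℂ] H)
    (h : ∀ f G, W (consTensor f G) = 0) : W = 0 := by
  have hW : W.comp (recons n) = 0 := by
    refine eq_zero_of_forall_smulTensor _ fun f g => ?_
    rw [ContinuousLinearMap.comp_apply, recons_smulTensor_eq_sum, map_sum]
    exact Finset.sum_eq_zero fun k _ => h _ _
  ext F
  rw [← recons_uncons F]
  exact congrArg (fun T => T (uncons n F)) hW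

lemma eq_zero_of_forall_isTensor {n : ℕ} (W : TestN K n →L[ℂ] H)
    (h : ∀ (f : Fin n → Test K) F, IsTensor f F → W F = 0) : W = 0 := by
  induction n with
  | zero =>
    ext F
    rw [eq_smul_constZero_one F, map_smul, h Fin.elim0 _ (isTensor_constZero_one _), smul_zero]
    rfl
  | succ n ih =>
    refine eq_zero_of_forall_consTensor W fun f G => ?_
    have hcons := ih (W.comp (consTensor f)) fun f' G' hG' =>
      h (Fin.cons f f') _ (IsTensor.cons (f := Fin.cons f f') (by simpa using hG'))
    exact congrArg (fun T => T G) hcons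

theorem ext_of_isTensor {n : ℕ} {W W' : TestN K n →L[ℂ] H}
    (h : ∀ (f : Fin n → Test K) F, IsTensor f F → W F = W' F) : W = W' :=
  sub_eq_zero.1 <| eq_zero_of_forall_isTensor _ fun f F hF => sub_eq_zero.2 (h f F hF)

end Tensors

/-! ### The undeformed theory -/

namespace Theory

variable {K : ℕ} {H : Type*} [NormedAddCommGroup H] [InnerProductSpace ℂ H] (T : Theory K H)

lemma Ψ_mem (n : ℕ) (F : TestN K n) : T.Ψ n F ∈ T.D := by
  rw [T.D_eq]
  exact Submodule.subset_span ⟨n, F, rfl⟩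

lemma Ψ_zero (F : TestN K 0) : T.Ψ 0 F = F 0 default • T.Ω := by
  conv_lhs => rw [eq_smul_constZero_one F]
  rw [map_smul, T.Ψ_tensor 0 Fin.elim0 _ (isTensor_constZero_one _)]
  simp

lemma φ_Ψ_of_isTensor {n : ℕ} {f : Fin n → Test K} {G : TestN K n} (h : IsTensor f G)
    (f₀ : Test K) : (T.φ f₀ ⟨T.Ψ n G, T.Ψ_mem n G⟩ : H) = T.Ψ (n + 1) (consTensor f₀ G) := by
  have hcons := T.Ψ_tensor (n + 1) (Fin.cons f₀ f) (consTensor f₀ G)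
    (IsTensor.cons (f := Fin.cons f₀ f) (by simpa using h))
  rw [hcons, List.ofFn_succ]
  simp only [Fin.cons_zero, Fin.cons_succ, List.foldr_cons]
  congr 2
  exact Subtype.ext (T.Ψ_tensor n f G h)

lemma U_foldr_φ (y : Mink) (l : List (Test K)) :
    T.U y ((l.foldr (fun g v => T.φ g v) ⟨T.Ω, T.Ω_mem⟩ : T.D) : H) =
      (((l.map (SchwartzMap.compSubConstCLM ℂ y)).foldr (fun g v => T.φ g v)
        ⟨T.Ω, T.Ω_mem⟩ : T.D) : H) := by
  induction l with
  | nil => exact T.U_Ω y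
  | cons f l ih =>
    simp only [List.foldr_cons, List.map_cons]
    rw [T.φ_covariant]
    congr 2
    exact Subtype.ext ih

/-- The field `φ(f)` is only weakly continuous, so the identity is extended from tensor products
after pairing with a vector of the dense domain. -/
theorem φ_Ψ {n : ℕ} (f : Test K) (G : TestN K n) :
    (T.φ f ⟨T.Ψ n G, T.Ψ_mem n G⟩ : H) = T.Ψ (n + 1) (consTensor f G) := by
  refine T.D_dense.eq_of_inner_right ℂ fun w hw => ?_
  have hW : (innerSL ℂ (T.φ (starTest T.bar f) ⟨w, hw⟩ : H)).comp (T.Ψ n) =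
      (innerSL ℂ w).comp ((T.Ψ (n + 1)).comp (consTensor f)) := by
    refine ext_of_isTensor fun f' G' hG' => ?_
    have hadjoint := T.φ_adjoint f ⟨w, hw⟩ ⟨T.Ψ n G', T.Ψ_mem n G'⟩
    rw [T.φ_Ψ_of_isTensor hG'] at hadjoint
    exact hadjoint.symm
  rw [T.φ_adjoint f ⟨w, hw⟩ ⟨T.Ψ n G, T.Ψ_mem n G⟩]
  exact congrArg (fun W => W G) hW

variable [CompleteSpace H]

lemma U_Ψ {n : ℕ} (y : Mink) (F : TestN K n) :
    T.U y (T.Ψ n F) = T.Ψ n (SchwartzMap.compSubConstCLM ℂ (fun _ => y) F) := by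
  have hW : ((T.U y).toContinuousLinearEquiv : H →L[ℂ] H).comp (T.Ψ n) =
      (T.Ψ n).comp (SchwartzMap.compSubConstCLM ℂ fun _ => y) := by
    refine ext_of_isTensor fun f G hG => ?_
    have hG' : IsTensor (fun j => SchwartzMap.compSubConstCLM ℂ y (f j))
        (SchwartzMap.compSubConstCLM ℂ (fun _ => y) G) := fun x k => by
      rw [SchwartzMap.compSubConstCLM_apply, hG]
      rfl
    have htranslate := T.U_foldr_φ y (List.ofFn f)
    rw [List.map_ofFn, ← T.Ψ_tensor n f G hG] at htranslate
    exact htranslate.trans (T.Ψ_tensor n _ _ hG').symm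
  exact congrArg (fun W => W F) hW

theorem npoint_translate {n : ℕ} (y : Mink) (F : TestN K n) :
    T.npoint n (SchwartzMap.compSubConstCLM ℂ (fun _ => y) F) = T.npoint n F := by
  have hinner := (T.U y).inner_map_map T.Ω (T.Ψ n F)
  rw [T.U_Ω, T.U_Ψ] at hinner
  exact hinner

end Theory

/-! ### Fourier transformation in spacetime variables -/

section Transform

section LinearEquiv

variable {X E V : Type*} [NormedAddCommGroup X] [NormedSpace ℝ X] [NormedAddCommGroup E]
  [NormedSpace ℝ E] [NormedAddCommGroup V] [NormedSpace ℂ V] (e : X ≃L[ℝ] E)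

lemma compCLMOfContinuousLinearEquiv_symm_comp (G : 𝓢(E, V)) :
    SchwartzMap.compCLMOfContinuousLinearEquiv ℂ e.symm
      (SchwartzMap.compCLMOfContinuousLinearEquiv ℂ e G) = G := by
  ext
  simp

lemma compCLMOfContinuousLinearEquiv_comp_symm (G : 𝓢(X, V)) :
    SchwartzMap.compCLMOfContinuousLinearEquiv ℂ e
      (SchwartzMap.compCLMOfContinuousLinearEquiv ℂ e.symm G) = G := by
  ext
  simp

end LinearEquiv

section Total

variable {X E V : Type*} [NormedAddCommGroup X] [NormedSpace ℝ X]
  [NormedAddCommGroup E] [InnerProductSpace ℝ E] [FiniteDimensional ℝ E] [MeasurableSpace E]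
  [BorelSpace E] [NormedAddCommGroup V] [NormedSpace ℂ V]

/-- The Fourier transformation `F ↦ c 𝓕(F ∘ e⁻¹) ∘ A` in coordinates `e` of the positions and `A`
of the momenta. -/
def transform (e A : X ≃L[ℝ] E) (c : ℂ) : 𝓢(X, V) →L[ℂ] 𝓢(X, V) :=
  c • (SchwartzMap.compCLMOfContinuousLinearEquiv ℂ A).comp
    ((FourierTransform.fourierCLM ℂ 𝓢(E, V)).comp
      (SchwartzMap.compCLMOfContinuousLinearEquiv ℂ e.symm))

/-- The inverse of `transform`. -/
def invTransform (e A : X ≃L[ℝ] E) (c : ℂ) [CompleteSpace V] : 𝓢(X, V) →L[ℂ] 𝓢(X, V) :=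
  c⁻¹ • (SchwartzMap.compCLMOfContinuousLinearEquiv ℂ e).comp
    ((FourierTransform.fourierInvCLM ℂ 𝓢(E, V)).comp
      (SchwartzMap.compCLMOfContinuousLinearEquiv ℂ A.symm))

lemma transform_apply (e A : X ≃L[ℝ] E) (c : ℂ) (F : 𝓢(X, V)) (p : X) :
    transform e A c F p = c • ∫ y, Complex.exp (↑(-2 * Real.pi * ⟪y, A p⟫_ℝ) * Complex.I) •
      F (e.symm y) := by
  rw [← Real.fourier_eq' (fun y => F (e.symm y))]
  rfl

variable [CompleteSpace V]

lemma transform_invTransform (e A : X ≃L[ℝ] E) {c : ℂ} (hc : c ≠ 0) (F : 𝓢(X, V)) :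
    transform e A c (invTransform e A c F) = F := by
  simp only [transform, invTransform, smul_apply, ContinuousLinearMap.comp_apply, map_smul,
    compCLMOfContinuousLinearEquiv_symm_comp, FourierTransform.fourierCLM_apply,
    FourierTransform.fourierInvCLM_apply, FourierTransform.fourier_fourierInv_eq,
    compCLMOfContinuousLinearEquiv_comp_symm, smul_smul, inv_mul_cancel₀ hc, one_smul]

lemma invTransform_transform (e A : X ≃L[ℝ] E) {c : ℂ} (hc : c ≠ 0) (F : 𝓢(X, V)) :
    invTransform e A c (transform e A c F) = F := by
  simp only [transform, invTransform, smul_apply, ContinuousLinearMap.comp_apply, map_smul,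
    compCLMOfContinuousLinearEquiv_symm_comp, FourierTransform.fourierCLM_apply,
    FourierTransform.fourierInvCLM_apply, FourierTransform.fourierInv_fourier_eq,
    compCLMOfContinuousLinearEquiv_comp_symm, smul_smul, mul_inv_cancel₀ hc, one_smul]

end Total

section Partial

variable {P X E V : Type u} [NormedAddCommGroup P] [NormedSpace ℝ P]
  [NormedAddCommGroup X] [NormedSpace ℝ X]
  [NormedAddCommGroup E] [InnerProductSpace ℝ E] [FiniteDimensional ℝ E] [MeasurableSpace E]
  [BorelSpace E] [NormedAddCommGroup V] [NormedSpace ℂ V]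

/-- `transform` in the second variable. -/
def partialTransform (e A : X ≃L[ℝ] E) (c : ℂ) : 𝓢(P × X, V) →L[ℂ] 𝓢(P × X, V) :=
  c • (SchwartzMap.compCLMOfContinuousLinearEquiv ℂ
      ((ContinuousLinearEquiv.refl ℝ P).prodCongr A)).comp (partialFourierCLM.comp
      (SchwartzMap.compCLMOfContinuousLinearEquiv ℂ
        ((ContinuousLinearEquiv.refl ℝ P).prodCongr e.symm)))

/-- `invTransform` in the second variable. -/
def partialInvTransform (e A : X ≃L[ℝ] E) (c : ℂ) : 𝓢(P × X, V) →L[ℂ] 𝓢(P × X, V) :=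
  c⁻¹ • (SchwartzMap.compCLMOfContinuousLinearEquiv ℂ
      ((ContinuousLinearEquiv.refl ℝ P).prodCongr
        (e.trans (ContinuousLinearEquiv.neg ℝ)))).comp (partialFourierCLM.comp
      (SchwartzMap.compCLMOfContinuousLinearEquiv ℂ
        ((ContinuousLinearEquiv.refl ℝ P).prodCongr A.symm)))

lemma sliceCLM_partialTransform (e A : X ≃L[ℝ] E) (c : ℂ) (s : P) (G : 𝓢(P × X, V)) :
    sliceCLM s (partialTransform e A c G) = transform e A c (sliceCLM s G) := by
  ext x
  rfl

lemma sliceCLM_partialInvTransform [CompleteSpace V] (e A : X ≃L[ℝ] E) (c : ℂ) (s : P)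
    (G : 𝓢(P × X, V)) :
    sliceCLM s (partialInvTransform e A c G) = invTransform e A c (sliceCLM s G) := by
  ext x
  have hneg := congrArg (fun F : E → V => F (e x)) (SchwartzMap.fourierInv_coe
    (SchwartzMap.compCLMOfContinuousLinearEquiv ℂ A.symm (sliceCLM s G)))
  simp only [Real.fourierInv_eq_fourier_neg] at hneg
  exact congrArg (c⁻¹ • ·) hneg.symm

end Partial

section VolumeFactor

variable {X E : Type*} [NormedAddCommGroup X] [NormedSpace ℝ X] [MeasureSpace X] [BorelSpace X]
  [(volume : Measure X).IsAddHaarMeasure] [NormedAddCommGroup E] [InnerProductSpace ℝ E]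
  [FiniteDimensional ℝ E] [MeasurableSpace E] [BorelSpace E] (e : X ≃L[ℝ] E)

/-- The quotient of the volume of `X` by the one transported from `E`. -/
def volumeFactor : NNReal :=
  have := e.symm.isAddHaarMeasure_map volume
  Measure.addHaarScalarFactor volume (Measure.map e.symm (volume : Measure E))

lemma volumeFactor_pos : 0 < volumeFactor e :=
  have := e.symm.isAddHaarMeasure_map volume
  Measure.addHaarScalarFactor_pos_of_isAddHaarMeasure _ _

lemma integral_eq_volumeFactor_smul {V : Type*} [NormedAddCommGroup V] [NormedSpace ℝ V]
    (F : X → V) : ∫ x, F x = volumeFactor e • ∫ y, F (e.symm y) := by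
  have := e.symm.toLinearEquiv.finiteDimensional
  have := e.symm.isAddHaarMeasure_map volume
  conv_lhs => rw [Measure.isAddLeftInvariant_eq_smul (volume : Measure X)
    (Measure.map e.symm (volume : Measure E))]
  rw [integral_smul_nnreal_measure]
  exact congrArg (volumeFactor e • ·) (e.symm.toHomeomorph.measurableEmbedding.integral_map F)

end VolumeFactor

end Transform

/-! ### Minkowski momenta -/

lemma eta_mul_eta (μ : Fin 4) : eta μ * eta μ = 1 := by
  unfold eta
  split_ifs <;> norm_num

/-- `p ↦ (2π)⁻¹ η p`, which turns Mathlib's Fourier kernel `e^{-2πi⟪x, ·⟫}` into `e^{-ip·x}`. -/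
def momentum : Mink ≃L[ℝ] Mink :=
  LinearEquiv.toContinuousLinearEquiv
    { toFun := fun p => WithLp.toLp 2 fun μ => (2 * Real.pi)⁻¹ * (eta μ * p μ)
      map_add' := fun p q => by ext μ; simp; ring
      map_smul' := fun c p => by ext μ; simp; ring
      invFun := fun p => WithLp.toLp 2 fun μ => (2 * Real.pi) * (eta μ * p μ)
      left_inv := fun p => by
        ext μ
        simp only
        field_simp
        linear_combination p μ * eta_mul_eta μ
      right_inv := fun p => by
        ext μ
        simp only
        field_simp
        linear_combination p μ * eta_mul_eta μ }

lemma momentum_apply (p : Mink) (μ : Fin 4) :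
    momentum p μ = (2 * Real.pi)⁻¹ * (eta μ * p μ) := rfl

lemma inner_momentum (p x : Mink) : 2 * Real.pi * ⟪x, momentum p⟫_ℝ = mdot p x := by
  simp only [PiLp.inner_apply, momentum_apply, mdot, Finset.mul_sum]
  refine Finset.sum_congr rfl fun μ _ => ?_
  simp
  field_simp

/-- `n` spacetime variables with the Euclidean norm. -/
abbrev euclid (n : ℕ) : (Fin n → Mink) ≃L[ℝ] PiLp 2 (fun _ : Fin n => Mink) :=
  (PiLp.continuousLinearEquiv 2 ℝ fun _ : Fin n => Mink).symm

/-- `momentum` for each of `n` variables. -/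
def momentumN (n : ℕ) : (Fin n → Mink) ≃L[ℝ] PiLp 2 (fun _ : Fin n => Mink) :=
  (ContinuousLinearEquiv.piCongrRight fun _ => momentum).trans (euclid n)

lemma inner_momentumN {n : ℕ} (p : Fin n → Mink) (y : PiLp 2 (fun _ : Fin n => Mink)) :
    2 * Real.pi * ⟪y, momentumN n p⟫_ℝ = ∑ j, mdot (p j) ((euclid n).symm y j) := by
  rw [PiLp.inner_apply, Finset.mul_sum]
  exact Finset.sum_congr rfl fun j _ => inner_momentum _ _

lemma two_pi_pow_inv_ne_zero (n : ℕ) : ((((2 * Real.pi) ^ n)⁻¹ : ℝ) : ℂ) ≠ 0 := by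
  exact_mod_cast (by positivity : ((2 * Real.pi) ^ n)⁻¹ ≠ 0)

/-- The normalization of the Fourier transform in `n` variables: the factor `(2π)⁻²ⁿ`, corrected by
the volume of the Euclidean norm, which is the one of Mathlib's Fourier transform. -/
def normalization (n : ℕ) : ℂ :=
  (((2 * Real.pi) ^ (2 * n))⁻¹ : ℝ) * ((volumeFactor (euclid n) : ℝ) : ℂ)

lemma normalization_ne_zero (n : ℕ) : normalization n ≠ 0 :=
  mul_ne_zero (two_pi_pow_inv_ne_zero _) (by exact_mod_cast (volumeFactor_pos _).ne')

/-- The Fourier transformation in `n` variables. -/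
def fourierNCLM {V : Type*} [NormedAddCommGroup V] [NormedSpace ℂ V] (n : ℕ) :
    𝓢(Fin n → Mink, V) →L[ℂ] 𝓢(Fin n → Mink, V) :=
  transform (euclid n) (momentumN n) (normalization n)

/-- The Fourier transformation in one variable. -/
def fourierCLM {V : Type*} [NormedAddCommGroup V] [NormedSpace ℂ V] :
    𝓢(Mink, V) →L[ℂ] 𝓢(Mink, V) :=
  transform (ContinuousLinearEquiv.refl ℝ Mink) momentum ((((2 * Real.pi) ^ 2)⁻¹ : ℝ) : ℂ)

lemma fourierNCLM_apply {V : Type*} [NormedAddCommGroup V] [NormedSpace ℂ V] {n : ℕ}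
    (F : 𝓢(Fin n → Mink, V)) (p : Fin n → Mink) :
    fourierNCLM n F p = ((((2 * Real.pi) ^ (2 * n))⁻¹ : ℝ) : ℂ) • ∫ x : Fin n → Mink,
      Complex.exp (-Complex.I * (∑ j, mdot (p j) (x j) : ℝ)) • F x := by
  rw [fourierNCLM, transform_apply, normalization, mul_smul,
    integral_eq_volumeFactor_smul (euclid n), Complex.coe_smul]
  congr 3
  funext y
  rw [← inner_momentumN]
  congr 2
  push_cast
  ring

lemma fourierCLM_apply {V : Type*} [NormedAddCommGroup V] [NormedSpace ℂ V]
    (F : 𝓢(Mink, V)) (p : Mink) :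
    fourierCLM F p = ((((2 * Real.pi) ^ 2)⁻¹ : ℝ) : ℂ) • ∫ x : Mink,
      Complex.exp (-Complex.I * (mdot p x : ℝ)) • F x := by
  rw [fourierCLM, transform_apply]
  congr 2
  funext y
  rw [← inner_momentum]
  congr 2
  push_cast
  ring

lemma integrable_cexp_smul {X V : Type*} [NormedAddCommGroup X] [NormedSpace ℝ X]
    [FiniteDimensional ℝ X] [MeasureSpace X] [BorelSpace X]
    [(volume : Measure X).IsAddHaarMeasure] [NormedAddCommGroup V] [NormedSpace ℂ V]
    (F : 𝓢(X, V)) {u : X → ℝ} (hu : Continuous u) :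
    Integrable fun x => Complex.exp (-Complex.I * (u x : ℝ)) • F x := by
  refine (F.integrable (μ := volume)).norm.mono'
    (Continuous.aestronglyMeasurable (by fun_prop)) (.of_forall fun x => ?_)
  rw [norm_smul, show -Complex.I * (u x : ℂ) = ((-u x : ℝ) : ℂ) * Complex.I by push_cast; ring,
    Complex.norm_exp_ofReal_mul_I, one_mul]

lemma continuous_mdot (p : Mink) : Continuous fun x => mdot p x := by unfold mdot; fun_prop

lemma fourierN_eq {K n : ℕ} (F : TestN K n) (p : Fin n → Mink) (k : Fin n → Fin K) :
    fourierN F p k = fourierNCLM n F p k := by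
  rw [fourierNCLM_apply, fourierN, Pi.smul_apply, smul_eq_mul]
  congr 1
  refine Eq.trans ?_ ((ContinuousLinearMap.proj (R := ℂ) (φ := fun _ => ℂ) k).integral_comp_comm
    (integrable_cexp_smul F (by unfold mdot; fun_prop)))
  exact integral_congr_ae (.of_forall fun x => mul_comm _ _)

lemma fourier_eq {K : ℕ} (f : Test K) (p : Mink) (k : Fin K) :
    fourier f p k = fourierCLM f p k := by
  rw [fourierCLM_apply, fourier, Pi.smul_apply, smul_eq_mul]
  congr 1
  refine Eq.trans ?_ ((ContinuousLinearMap.proj (R := ℂ) (φ := fun _ => ℂ) k).integral_comp_comm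
    (integrable_cexp_smul f (continuous_mdot p)))
  exact integral_congr_ae (.of_forall fun x => mul_comm _ _)

section Inverse

variable {P V : Type} [NormedAddCommGroup P] [NormedSpace ℝ P] [NormedAddCommGroup V]
  [NormedSpace ℂ V]

/-- The Fourier transformation in `n` variables of functions with a parameter. -/
def partialFourierNCLM (n : ℕ) : 𝓢(P × (Fin n → Mink), V) →L[ℂ] 𝓢(P × (Fin n → Mink), V) :=
  partialTransform (euclid n) (momentumN n) (normalization n)

/-- The inverse Fourier transformation in `n` variables of functions with a parameter. -/
def partialInvFourierNCLM (n : ℕ) : 𝓢(P × (Fin n → Mink), V) →L[ℂ] 𝓢(P × (Fin n → Mink), V) :=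
  partialInvTransform (euclid n) (momentumN n) (normalization n)

/-- The inverse Fourier transformation in one variable of functions with a parameter. -/
def partialInvFourierCLM : 𝓢(P × Mink, V) →L[ℂ] 𝓢(P × Mink, V) :=
  partialInvTransform (ContinuousLinearEquiv.refl ℝ Mink) momentum
    ((((2 * Real.pi) ^ 2)⁻¹ : ℝ) : ℂ)

lemma sliceCLM_partialFourierNCLM {n : ℕ} (s : P) (G : 𝓢(P × (Fin n → Mink), V)) :
    sliceCLM s (partialFourierNCLM n G) = fourierNCLM n (sliceCLM s G) :=
  sliceCLM_partialTransform _ _ _ s G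

variable [CompleteSpace V]

/-- The inverse Fourier transformation in `n` variables. -/
def invFourierNCLM (n : ℕ) : 𝓢(Fin n → Mink, V) →L[ℂ] 𝓢(Fin n → Mink, V) :=
  invTransform (euclid n) (momentumN n) (normalization n)

/-- The inverse Fourier transformation in one variable. -/
def invFourierCLM : 𝓢(Mink, V) →L[ℂ] 𝓢(Mink, V) :=
  invTransform (ContinuousLinearEquiv.refl ℝ Mink) momentum ((((2 * Real.pi) ^ 2)⁻¹ : ℝ) : ℂ)

lemma fourierNCLM_invFourierNCLM {n : ℕ} (F : 𝓢(Fin n → Mink, V)) :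
    fourierNCLM n (invFourierNCLM n F) = F :=
  transform_invTransform _ _ (normalization_ne_zero n) F

lemma fourierCLM_invFourierCLM (F : 𝓢(Mink, V)) : fourierCLM (invFourierCLM F) = F :=
  transform_invTransform _ _ (two_pi_pow_inv_ne_zero 2) F

lemma fourierNCLM_sliceCLM_partialInvFourierNCLM {n : ℕ} (s : P) (G : 𝓢(P × (Fin n → Mink), V)) :
    fourierNCLM n (sliceCLM s (partialInvFourierNCLM n G)) = sliceCLM s G := by
  rw [partialInvFourierNCLM, sliceCLM_partialInvTransform]
  exact transform_invTransform _ _ (normalization_ne_zero n) _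

lemma fourierCLM_sliceCLM_partialInvFourierCLM (s : P) (G : 𝓢(P × Mink, V)) :
    fourierCLM (sliceCLM s (partialInvFourierCLM G)) = sliceCLM s G := by
  rw [partialInvFourierCLM, sliceCLM_partialInvTransform]
  exact transform_invTransform _ _ (two_pi_pow_inv_ne_zero 2) _

lemma fourierNCLM_injective {n : ℕ} : Function.Injective (fourierNCLM (V := V) n) :=
  Function.LeftInverse.injective (g := invFourierNCLM n)
    fun F => invTransform_transform _ _ (normalization_ne_zero n) F

lemma fourierCLM_injective : Function.Injective (fourierCLM (V := V)) :=
  Function.LeftInverse.injective (g := invFourierCLM)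
    fun F => invTransform_transform _ _ (two_pi_pow_inv_ne_zero 2) F

end Inverse

lemma fourierN_injective {K n : ℕ} {F G : TestN K n}
    (h : ∀ p k, fourierN F p k = fourierN G p k) : F = G := by
  refine fourierNCLM_injective ?_
  ext p k
  rw [← fourierN_eq, h, fourierN_eq]

lemma fourier_injective {K : ℕ} {f g : Test K} (h : ∀ p k, fourier f p k = fourier g p k) :
    f = g := by
  refine fourierCLM_injective ?_
  ext p k
  rw [← fourier_eq, h, fourier_eq]

lemma integral_fin_succ {n : ℕ} {V : Type*} [NormedAddCommGroup V] [NormedSpace ℝ V]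
    (F : (Fin (n + 1) → Mink) → V) :
    ∫ x, F x = ∫ z : Mink × (Fin n → Mink), F (Fin.cons z.1 z.2) := by
  have h := (volume_preserving_piFinSuccAbove (fun _ : Fin (n + 1) => Mink) 0).symm
  rw [← h.integral_comp (MeasurableEquiv.measurableEmbedding _)]
  refine integral_congr_ae (.of_forall fun z => congrArg F ?_)
  exact Fin.insertNth_zero' z.1 z.2

lemma fourierN_consTensor {K n : ℕ} (f : Test K) (G : TestN K n) (p : Fin (n + 1) → Mink)
    (k : Fin (n + 1) → Fin K) :
    fourierN (consTensor f G) p k =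
      fourier f (p 0) (k 0) * fourierN G (Fin.tail p) (Fin.tail k) := by
  rw [fourierN, integral_fin_succ, fourier, fourierN, mul_mul_mul_comm,
    ← integral_prod_mul (μ := (volume : Measure Mink))
      (ν := (volume : Measure (Fin n → Mink))), ← Measure.volume_eq_prod]
  congr 1
  · push_cast
    rw [mul_add, pow_add]
    field_simp
    ring
  · refine integral_congr_ae (.of_forall fun z => ?_)
    simp only [consTensor_apply, Fin.sum_univ_succ, Fin.cons_zero, Fin.cons_succ, Fin.tail_cons]
    rw [mul_mul_mul_comm, ← Complex.exp_add]
    congr 2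
    simp only [Fin.tail]
    push_cast
    ring

lemma mdot_neg_left (p x : Mink) : mdot (-p) x = -mdot p x := by
  simp [mdot, Finset.sum_neg_distrib]

lemma fourier_starTest {K : ℕ} (bar : Fin K → Fin K) (f : Test K) (p : Mink) (k : Fin K) :
    fourier (starTest bar f) p k = (starRingEnd ℂ) (fourier f (-p) (bar k)) := by
  rw [fourier, fourier, map_mul, Complex.conj_ofReal, ← integral_conj]
  congr 1
  refine integral_congr_ae (.of_forall fun x => ?_)
  simp only [map_mul, ← Complex.exp_conj, mdot_neg_left, map_neg, Complex.conj_I,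
    Complex.conj_ofReal]
  congr 2
  push_cast
  ring

/-! ### The product `f × g` with a test function -/

section Coordinates

variable {D : Type*} [NormedAddCommGroup D] [NormedSpace ℝ D]

@[fun_prop]
lemma hasTemperateGrowth_coord {ι : Type*} [Fintype ι] {f : D → EuclideanSpace ℝ ι}
    (hf : f.HasTemperateGrowth) (i : ι) : (fun x => f x i).HasTemperateGrowth :=
  (EuclideanSpace.proj (𝕜 := ℝ) i).hasTemperateGrowth.comp hf

lemma hasTemperateGrowth_toLp {ι : Type*} [Fintype ι] {f : D → ι → ℝ}
    (hf : ∀ i, (fun x => f x i).HasTemperateGrowth) :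
    (fun x => (WithLp.toLp 2 (f x) : EuclideanSpace ℝ ι)).HasTemperateGrowth :=
  (EuclideanSpace.equiv ι ℝ).symm.toContinuousLinearMap.hasTemperateGrowth.comp
    (hasTemperateGrowth_pi hf)

@[fun_prop]
lemma hasTemperateGrowth_coeff {f : D → MatSpace} {g : D → Mink} (hf : f.HasTemperateGrowth)
    (hg : g.HasTemperateGrowth) (ν : Fin 4) :
    (fun x => coeff (toMat (f x)) (g x) ν).HasTemperateGrowth := by
  simp only [coeff, toMat, Matrix.of_apply, Fin.sum_univ_four]
  fun_prop

@[fun_prop]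
lemma hasTemperateGrowth_shift (κe κm : ℝ) {f : D → MatSpace} {g : D → Mink}
    (hf : f.HasTemperateGrowth) (hg : g.HasTemperateGrowth) :
    (fun x => shift κe κm (toMat (f x)) (g x)).HasTemperateGrowth := by
  refine hasTemperateGrowth_toLp fun i => ?_
  fin_cases i
  · exact (Function.HasTemperateGrowth.const κe).mul (hasTemperateGrowth_coeff hf hg 1)
  · exact (Function.HasTemperateGrowth.const κm).mul (hasTemperateGrowth_coeff hf hg 3)

/-- The exponent in the phase factor of `e^{ip·X}`, without the factor `i`. -/
def weylPhase (κe κm : ℝ) (L : Matrix (Fin 4) (Fin 4) ℝ) (p : Mink) (s : Plane) : ℝ :=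
  coeff L p 0 * s 0 + coeff L p 2 * s 1 +
      (κe * coeff L p 0 * coeff L p 1 + κm * coeff L p 2 * coeff L p 3) / 2

lemma weyl_eq (κe κm : ℝ) (L : Matrix (Fin 4) (Fin 4) ℝ) (p : Mink) (w : Plane → ℂ) (s : Plane) :
    weyl κe κm L p w s =
      Complex.exp (Complex.I * (weylPhase κe κm L p s : ℂ)) * w (s + shift κe κm L p) := rfl

lemma weyl_const_zero (κe κm : ℝ) (L : Matrix (Fin 4) (Fin 4) ℝ) (p : Mink) (s : Plane) :
    weyl κe κm L p (fun _ => 0) s = 0 := mul_zero _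

@[fun_prop]
lemma hasTemperateGrowth_weylPhase (κe κm : ℝ) {f : D → MatSpace} {g : D → Mink} {h : D → Plane}
    (hf : f.HasTemperateGrowth) (hg : g.HasTemperateGrowth) (hh : h.HasTemperateGrowth) :
    (fun x => weylPhase κe κm (toMat (f x)) (g x) (h x)).HasTemperateGrowth := by
  unfold weylPhase
  simp only [div_eq_mul_inv]
  fun_prop

end Coordinates

section Kernel

variable (κe κm : ℝ) {Y A B V : Type*} [NormedAddCommGroup Y] [NormedSpace ℝ Y]
  [NormedAddCommGroup A] [NormedSpace ℂ A] [NormedAddCommGroup B] [NormedSpace ℂ B]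
  [NormedAddCommGroup V] [NormedSpace ℂ V]

/-- Composition with `(L, p, s, y) ↦ (L, p, s + shift, y)`. -/
def weylShear : 𝓢(MatSpace × (Mink × (Plane × Y)), V) →L[ℂ] 𝓢(MatSpace × (Mink × (Plane × Y)), V) :=
  compCLMOfLeftInverse
    (Φ := fun z => (z.1, (z.2.1, (z.2.2.1 + shift κe κm (toMat z.1) z.2.1, z.2.2.2))))
    (Ψ := fun z => (z.1, (z.2.1, (z.2.2.1 - shift κe κm (toMat z.1) z.2.1, z.2.2.2))))
    (by fun_prop) (by fun_prop) fun z => by simp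

/-- The function `χ(L) f(p) (e^{ip·X} G)(s, y)` of `(L, p, s, y)`. Since `L = Λ_θ` is bounded on
compact sets of `θ`, the cutoff `χ` makes the actions of all these `Λ_θ` slices of a single Schwartz
function. -/
def weylKernel (M : A →L[ℂ] B →L[ℂ] V) (χ : 𝓢(MatSpace, ℂ)) (f : 𝓢(Mink, A)) :
    𝓢(Plane × Y, B) →L[ℂ] 𝓢(MatSpace × (Mink × (Plane × Y)), V) :=
  (SchwartzMap.smulLeftCLM V fun z : MatSpace × (Mink × (Plane × Y)) =>
      Complex.exp (Complex.I * (weylPhase κe κm (toMat z.1) z.2.1 z.2.2.1 : ℂ))).comp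
    ((weylShear κe κm).comp ((smulTensor χ).comp (tensorCLM M f)))

lemma weylKernel_apply (M : A →L[ℂ] B →L[ℂ] V) (χ : 𝓢(MatSpace, ℂ)) (f : 𝓢(Mink, A))
    (G : 𝓢(Plane × Y, B)) (ℓ : MatSpace) (p : Mink) (s : Plane) (y : Y) :
    weylKernel κe κm M χ f G (ℓ, (p, (s, y))) =
      Complex.exp (Complex.I * (weylPhase κe κm (toMat ℓ) p s : ℂ)) •
        χ ℓ • M (f p) (G (s + shift κe κm (toMat ℓ) p, y)) := by
  rw [weylKernel, ContinuousLinearMap.comp_apply, SchwartzMap.smulLeftCLM_apply_apply (by fun_prop)]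
  rfl

lemma continuous_shift (p : Mink) : Continuous fun ℓ : MatSpace => shift κe κm (toMat ℓ) p :=
  (hasTemperateGrowth_shift κe κm (f := fun ℓ : MatSpace => ℓ) (g := fun _ => p)
    (by fun_prop) (by fun_prop)).1.continuous

lemma continuous_weylPhase (p : Mink) (s : Plane) :
    Continuous fun ℓ : MatSpace => weylPhase κe κm (toMat ℓ) p s :=
  (hasTemperateGrowth_weylPhase κe κm (f := fun ℓ : MatSpace => ℓ) (g := fun _ => p)
    (h := fun _ => s) (by fun_prop) (by fun_prop) (by fun_prop)).1.continuous

end Kernel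

section Action

variable (κe κm : ℝ) {K : ℕ}

lemma slice_eq_sliceCLM {n : ℕ} (s : Plane) :
    (slice s : 𝓢(Plane × (Fin n → Mink), (Fin n → Fin K) → ℂ) →L[ℂ] TestN K n) = sliceCLM s := rfl

/-- Moving the first of `n + 1` spacetime variables to the front. -/
def frontCLE (n : ℕ) : (Plane × (Fin (n + 1) → Mink)) ≃L[ℝ] Mink × (Plane × (Fin n → Mink)) :=
  LinearEquiv.toContinuousLinearEquiv
    { toFun := fun z => (z.2 0, (z.1, Fin.tail z.2))
      map_add' := fun _ _ => rfl
      map_smul' := fun _ _ => rfl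
      invFun := fun z => (z.2.1, Fin.cons z.1 z.2.2)
      left_inv := fun z => by simp
      right_inv := fun z => by simp }

/-- The operation `g ↦ f × g` in momentum space, in the fibre with `Λ_θ = ℓ` and cut off by `χ`. -/
def momentumAction (χ : 𝓢(MatSpace, ℂ)) (ℓ : MatSpace) (f : Test K) (n : ℕ) :
    𝓢(Plane × (Fin n → Mink), (Fin n → Fin K) → ℂ) →L[ℂ]
      𝓢(Plane × (Fin (n + 1) → Mink), (Fin (n + 1) → Fin K) → ℂ) :=
  (SchwartzMap.compCLMOfContinuousLinearEquiv ℂ (frontCLE n)).comp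
    ((sliceCLM ℓ).comp (weylKernel κe κm (mulComponents K n) χ (fourierCLM f)))

/-- The operation `g ↦ f × g` in the fibre with `Λ_θ = ℓ`, cut off by `χ`. -/
def action (χ : 𝓢(MatSpace, ℂ)) (ℓ : MatSpace) (f : Test K) (n : ℕ) :
    𝓢(Plane × (Fin n → Mink), (Fin n → Fin K) → ℂ) →L[ℂ]
      𝓢(Plane × (Fin (n + 1) → Mink), (Fin (n + 1) → Fin K) → ℂ) :=
  (partialInvFourierNCLM (n + 1)).comp
    ((momentumAction κe κm χ ℓ f n).comp (partialFourierNCLM n))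

lemma momentumAction_apply (χ : 𝓢(MatSpace, ℂ)) (ℓ : MatSpace) (f : Test K) (n : ℕ)
    (G : 𝓢(Plane × (Fin n → Mink), (Fin n → Fin K) → ℂ)) (s : Plane) (p : Fin (n + 1) → Mink) :
    momentumAction κe κm χ ℓ f n G (s, p) =
      Complex.exp (Complex.I * (weylPhase κe κm (toMat ℓ) (p 0) s : ℂ)) •
        χ ℓ • mulComponents K n (fourierCLM f (p 0))
          (G (s + shift κe κm (toMat ℓ) (p 0), Fin.tail p)) :=
  weylKernel_apply κe κm _ χ (fourierCLM f) G ℓ (p 0) s (Fin.tail p)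

theorem fourierN_slice_action {χ : 𝓢(MatSpace, ℂ)} {ℓ : MatSpace} (hχ : χ ℓ = 1) (f : Test K)
    {n : ℕ} (G : 𝓢(Plane × (Fin n → Mink), (Fin n → Fin K) → ℂ)) (s : Plane)
    (p : Fin (n + 1) → Mink) (k : Fin (n + 1) → Fin K) :
    fourierN (slice s (action κe κm χ ℓ f n G)) p k = fourier f (p 0) (k 0) *
      weyl κe κm (toMat ℓ) (p 0)
        (fun s' => fourierN (slice s' G) (Fin.tail p) (Fin.tail k)) s := by
  have hslice (s' : Plane) : fourierNCLM n (sliceCLM s' G) (Fin.tail p) (Fin.tail k) =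
      partialFourierNCLM n G (s', Fin.tail p) (Fin.tail k) := by
    rw [← sliceCLM_partialFourierNCLM, sliceCLM_apply]
  simp only [slice_eq_sliceCLM, fourierN_eq, fourier_eq, hslice, action,
    ContinuousLinearMap.comp_apply]
  rw [fourierNCLM_sliceCLM_partialInvFourierNCLM, sliceCLM_apply, momentumAction_apply, hχ,
    one_smul, weyl_eq, Pi.smul_apply, mulComponents_apply, smul_eq_mul]
  ring

lemma exists_forall_seminorm_action_le {ι : Type*} (χ : 𝓢(MatSpace, ℂ)) (ℓ : ι → MatSpace)
    (f : Test K) {n : ℕ} {g : ι → 𝓢(Plane × (Fin n → Mink), (Fin n → Fin K) → ℂ)}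
    (hg : ∀ a b : ℕ, ∃ C, ∀ i, SchwartzMap.seminorm ℂ a b (g i) ≤ C) (a b : ℕ) :
    ∃ C, ∀ i, SchwartzMap.seminorm ℂ a b (action κe κm χ (ℓ i) f n (g i)) ≤ C := by
  have hkernel := exists_forall_seminorm_map_le
    ((weylKernel κe κm (mulComponents K n) χ (fourierCLM f)).comp (partialFourierNCLM n)) hg
  refine exists_forall_seminorm_map_le ((partialInvFourierNCLM (n + 1)).comp
    (SchwartzMap.compCLMOfContinuousLinearEquiv ℂ (frontCLE n))) (g := fun i => sliceCLM (ℓ i)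
      (weylKernel κe κm (mulComponents K n) χ (fourierCLM f) (partialFourierNCLM n (g i))))
    (fun a b => ?_) a b
  obtain ⟨C, hC⟩ := hkernel a b
  exact ⟨C, fun i => (seminorm_sliceCLM_le _ a b _).trans (hC i)⟩

theorem stronglyMeasurable_map_plane {V : Type} [NormedAddCommGroup V] [NormedSpace ℂ V]
    [FiniteDimensional ℂ V] {H : Type*} [NormedAddCommGroup H] [NormedSpace ℂ H] [CompleteSpace H]
    {Θ : Type*} [MeasurableSpace Θ] {n : ℕ} (g : Θ → 𝓢(Plane × (Fin n → Mink), V))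
    (hg : ∀ z, StronglyMeasurable fun θ => g θ z) (W : 𝓢(Plane × (Fin n → Mink), V) →L[ℂ] H) :
    StronglyMeasurable fun θ => W (g θ) := by
  have : CompleteSpace V := FiniteDimensional.complete ℂ V
  refine stronglyMeasurable_map_of_sliceCLM g (fun W u => ?_) W
  exact stronglyMeasurable_map (fun θ => sliceCLM u (g θ)) (fun x => hg _) W

/-- Evaluation at a point, as a continuous linear map on Schwartz functions. -/
def evalCLM {X V : Type*} [NormedAddCommGroup X] [NormedSpace ℝ X] [NormedAddCommGroup V]
    [NormedSpace ℂ V] (x : X) : 𝓢(X, V) →L[ℂ] V :=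
  (BoundedContinuousFunction.evalCLM ℂ x).comp (SchwartzMap.toBoundedContinuousFunctionCLM ℂ X V)

section Measurability

variable {Θ : Type*} [MeasurableSpace Θ] (χ : 𝓢(MatSpace, ℂ)) {ℓ : Θ → MatSpace}
  (hℓ : Measurable ℓ) (f : Test K) {n : ℕ}
  (g : Θ → 𝓢(Plane × (Fin n → Mink), (Fin n → Fin K) → ℂ))
  (hg : ∀ z, StronglyMeasurable fun θ => g θ z) (z : Plane × (Fin (n + 1) → Mink))

include hℓ hg

lemma stronglyMeasurable_momentumAction :
    StronglyMeasurable fun θ => momentumAction κe κm χ (ℓ θ) f n (g θ) z := by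
  have hjoint : StronglyMeasurable fun w : Plane × Θ => g w.2 (w.1, Fin.tail z.2) :=
    stronglyMeasurable_uncurry_of_continuous_of_stronglyMeasurable
      (u := fun (s : Plane) θ => g θ (s, Fin.tail z.2))
      (fun θ => (g θ).continuous.comp (by fun_prop)) (fun s => hg _)
  have hshift : Measurable fun θ => (z.1 + shift κe κm (toMat (ℓ θ)) (z.2 0), θ) :=
    (((continuous_shift κe κm _).measurable.comp hℓ).const_add _).prodMk measurable_id
  have hvalue : StronglyMeasurable fun θ => mulComponents K n (fourierCLM f (z.2 0))
      (g θ (z.1 + shift κe κm (toMat (ℓ θ)) (z.2 0), Fin.tail z.2)) :=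
    (mulComponents K n (fourierCLM f (z.2 0))).continuous.comp_stronglyMeasurable
      (hjoint.comp_measurable hshift)
  have hcutoff : StronglyMeasurable fun θ => χ (ℓ θ) :=
    χ.continuous.comp_stronglyMeasurable hℓ.stronglyMeasurable
  have hcontinuous := continuous_weylPhase κe κm (z.2 0) z.1
  have hphase : StronglyMeasurable fun θ =>
      Complex.exp (Complex.I * (weylPhase κe κm (toMat (ℓ θ)) (z.2 0) z.1 : ℂ)) :=
    Continuous.comp_stronglyMeasurable (f := ℓ) (g := fun ℓ : MatSpace =>
      Complex.exp (Complex.I * (weylPhase κe κm (toMat ℓ) (z.2 0) z.1 : ℂ)))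
      (by fun_prop) hℓ.stronglyMeasurable
  exact (funext fun θ => momentumAction_apply κe κm χ (ℓ θ) f n _ z.1 z.2) ▸
    hphase.smul (hcutoff.smul hvalue)

lemma stronglyMeasurable_action :
    StronglyMeasurable fun θ => action κe κm χ (ℓ θ) f n (g θ) z := by
  have hfourier (z) : StronglyMeasurable fun θ => partialFourierNCLM n (g θ) z :=
    stronglyMeasurable_map_plane g hg ((evalCLM z).comp (partialFourierNCLM n))
  exact stronglyMeasurable_map_plane _
    (stronglyMeasurable_momentumAction κe κm χ hℓ f _ hfourier)
    ((evalCLM z).comp (partialInvFourierNCLM (n + 1)))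

end Measurability

end Action

section Existence

variable {κe κm : ℝ} {K : ℕ} {Λ : Spec κe κm → Matrix (Fin 4) (Fin 4) ℝ}

/-- A matrix as a point of `ℝ¹⁶`; the inverse of `toMat`. -/
def ofMat (L : Matrix (Fin 4) (Fin 4) ℝ) : MatSpace := WithLp.toLp 2 fun i => L i.1 i.2

lemma IsFrame.measurable_ofMat (hΛ : IsFrame κe κm Λ) : Measurable fun θ => ofMat (Λ θ) := by
  refine (EuclideanSpace.equiv (Fin 4 × Fin 4) ℝ).symm.continuous.measurable.comp
    (g := (EuclideanSpace.equiv (Fin 4 × Fin 4) ℝ).symm) (f := fun θ i => Λ θ i.1 i.2) ?_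
  exact measurable_pi_lambda _ fun i => hΛ.measurable i.1 i.2

lemma IsFrame.exists_cutoff (hΛ : IsFrame κe κm Λ) {C : Set (Spec κe κm)} (hC : IsCompact C) :
    ∃ χ : 𝓢(MatSpace, ℂ), ∀ θ ∈ C, χ (ofMat (Λ θ)) = 1 := by
  obtain ⟨B, hB⟩ := hΛ.bounded C hC
  obtain ⟨χ, hχ⟩ := exists_schwartz_eq_one MatSpace (Real.sqrt (∑ _i : Fin 4 × Fin 4, B ^ 2))
  refine ⟨χ, fun θ hθ => hχ _ ?_⟩
  rw [EuclideanSpace.norm_eq]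
  refine Real.sqrt_le_sqrt (Finset.sum_le_sum fun i _ => ?_)
  exact pow_le_pow_left₀ (norm_nonneg _) (hB θ hθ i.1 i.2) 2

lemma fourierN_zero {n : ℕ} (p : Fin n → Mink) (k : Fin n → Fin K) :
    fourierN (0 : TestN K n) p k = 0 := by simp [fourierN]

lemma eq_of_forall_slice_eq {n : ℕ} {G G' : 𝓢(Plane × (Fin n → Mink), (Fin n → Fin K) → ℂ)}
    (h : ∀ s, slice s G = slice s G') : G = G' := by
  ext z : 1
  exact congrArg (fun F => F z.2) (h z.1)

lemma IsAction.unique {f : Test K} {g h h' : BigTest κe κm K} (hh : IsAction Λ f g h)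
    (hh' : IsAction Λ f g h') : h = h' := by
  funext n
  cases n with
  | zero => rw [hh.1, hh'.1]
  | succ n =>
    funext θ
    refine eq_of_forall_slice_eq fun s => fourierN_injective fun p k => ?_
    rw [hh.2, hh'.2]

/-- The sequence `f × g`, provided that for each `n` the cutoff `χ n` is `1` at those `Λ_θ` for
which `gⁿ_θ ≠ 0`. -/
def bigAction (Λ : Spec κe κm → Matrix (Fin 4) (Fin 4) ℝ) (χ : ℕ → 𝓢(MatSpace, ℂ)) (f : Test K)
    (g : BigTest κe κm K) : BigTest κe κm K
  | 0 => 0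
  | n + 1 => fun θ => action κe κm (χ n) (ofMat (Λ θ)) f n (g n θ)

lemma bigAction_succ_eq_zero {χ : ℕ → 𝓢(MatSpace, ℂ)} {f : Test K} {g : BigTest κe κm K} {n : ℕ}
    {θ : Spec κe κm} (hg : g n θ = 0) : bigAction Λ χ f g (n + 1) θ = 0 := by
  simp only [WeylWigner.bigAction, hg, map_zero]

lemma IsBigTest.bigAction (hΛ : IsFrame κe κm Λ) (χ : ℕ → 𝓢(MatSpace, ℂ)) (f : Test K)
    {g : BigTest κe κm K} (hg : IsBigTest g) : IsBigTest (bigAction Λ χ f g) where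
  terminating := by
    obtain ⟨N, hN⟩ := hg.terminating
    refine ⟨N + 1, fun n hn => ?_⟩
    obtain ⟨m, rfl⟩ := Nat.exists_eq_add_of_le' (Nat.one_le_of_lt hn)
    exact funext fun θ => bigAction_succ_eq_zero (congrFun (hN m (by lia)) θ)
  measurable
    | 0, _ => measurable_const
    | n + 1, z => (stronglyMeasurable_action κe κm (χ n) hΛ.measurable_ofMat f (g n)
        (fun z => (hg.measurable n z).stronglyMeasurable) z).measurable
  bounded
    | 0, _, _ => ⟨0, fun _ => (map_zero _).le⟩
    | n + 1, a, b => exists_forall_seminorm_action_le κe κm (χ n) (fun θ => ofMat (Λ θ)) f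
        (hg.bounded n) a b
  support
    | 0 => ⟨∅, isCompact_empty, fun _ _ => rfl⟩
    | n + 1 =>
      have ⟨C, hC, hgC⟩ := hg.support n
      ⟨C, hC, fun θ hθ => bigAction_succ_eq_zero (hgC θ hθ)⟩

lemma isAction_bigAction {χ : ℕ → 𝓢(MatSpace, ℂ)} (f : Test K) {g : BigTest κe κm K}
    (hχ : ∀ n θ, g n θ ≠ 0 → χ n (ofMat (Λ θ)) = 1) : IsAction Λ f g (bigAction Λ χ f g) := by
  refine ⟨rfl, fun n θ s p k => ?_⟩
  by_cases hθ : g n θ = 0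
  · rw [bigAction_succ_eq_zero hθ, hθ]
    simp only [map_zero, fourierN_zero, weyl_const_zero, mul_zero]
  · exact fourierN_slice_action κe κm (hχ n θ hθ) f (g n θ) s p k

theorem existsUnique_isAction (hΛ : IsFrame κe κm Λ) (f : Test K) {g : BigTest κe κm K}
    (hg : IsBigTest g) : ∃! h : BigTest κe κm K, IsBigTest h ∧ IsAction Λ f g h := by
  choose C hC hgC using hg.support
  choose χ hχ using fun n => hΛ.exists_cutoff (hC n)
  have haction := isAction_bigAction (Λ := Λ) f
    fun n θ hθ => hχ n θ (not_imp_comm.1 (hgC n θ) hθ)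
  exact ⟨_, ⟨hg.bigAction hΛ χ f, haction⟩, fun h hh => hh.2.unique haction⟩

end Existence

/-! ### The adjoint relation in a single fibre -/

section WeylTest

variable (κe κm : ℝ) {K : ℕ}

/-- A function of `s` as a function of `s` and no further variables. -/
def planeCLE : (Plane × (Fin 0 → Mink)) ≃L[ℝ] Plane :=
  LinearEquiv.toContinuousLinearEquiv
    { toFun := fun z => z.1
      map_add' := fun _ _ => rfl
      map_smul' := fun _ _ => rfl
      invFun := fun s => (s, 0)
      left_inv := fun _ => Prod.ext rfl (Subsingleton.elim _ _)
      right_inv := fun _ => rfl }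

/-- Moving the spacetime variable to the front. -/
def planeFrontCLE : (Plane × Mink) ≃L[ℝ] Mink × (Plane × (Fin 0 → Mink)) :=
  LinearEquiv.toContinuousLinearEquiv
    { toFun := fun z => (z.2, (z.1, 0))
      map_add' := fun _ _ => by simp
      map_smul' := fun _ _ => by simp
      invFun := fun z => (z.2.1, z.1)
      left_inv := fun _ => rfl
      right_inv := fun z => Prod.ext rfl (Prod.ext rfl (Subsingleton.elim _ _)) }

/-- The test functions, depending on `s`, with Fourier transform `χ(ℓ) f̃(p) (e^{ip·X} u)(s)`. -/
def weylTest (χ : 𝓢(MatSpace, ℂ)) (ℓ : MatSpace) (f : Test K) (u : 𝓢(Plane, ℂ)) :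
    𝓢(Plane × Mink, Fin K → ℂ) :=
  partialInvFourierCLM (SchwartzMap.compCLMOfContinuousLinearEquiv ℂ planeFrontCLE (sliceCLM ℓ
    (weylKernel κe κm (ContinuousLinearMap.lsmul ℂ ℂ).flip χ (fourierCLM f)
      (SchwartzMap.compCLMOfContinuousLinearEquiv ℂ planeCLE u))))

lemma fourier_slice_weylTest {χ : 𝓢(MatSpace, ℂ)} {ℓ : MatSpace} (hχ : χ ℓ = 1) (f : Test K)
    (u : 𝓢(Plane, ℂ)) (s : Plane) (p : Mink) (k : Fin K) :
    fourier (sliceCLM s (weylTest κe κm χ ℓ f u)) p k =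
      fourier f p k * weyl κe κm (toMat ℓ) p u s := by
  rw [fourier_eq, weylTest, fourierCLM_sliceCLM_partialInvFourierCLM, sliceCLM_apply]
  change weylKernel κe κm (ContinuousLinearMap.lsmul ℂ ℂ).flip χ (fourierCLM f)
      (SchwartzMap.compCLMOfContinuousLinearEquiv ℂ planeCLE u) (ℓ, (p, (s, 0))) k = _
  rw [weylKernel_apply, hχ, one_smul, fourier_eq, weyl_eq]
  change _ * (u (s + shift κe κm (toMat ℓ) p) * fourierCLM f p k) = _
  ring

lemma sliceCLM_smulTensor {X Y V : Type*} [NormedAddCommGroup X] [NormedSpace ℝ X]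
    [NormedAddCommGroup Y] [NormedSpace ℝ Y] [NormedAddCommGroup V] [NormedSpace ℂ V]
    (u : 𝓢(X, ℂ)) (G : 𝓢(Y, V)) (x : X) : sliceCLM x (smulTensor u G) = u x • G := rfl

lemma sliceCLM_action_smulTensor {χ : 𝓢(MatSpace, ℂ)} {ℓ : MatSpace} (hχ : χ ℓ = 1) (f : Test K)
    {n : ℕ} (u : 𝓢(Plane, ℂ)) (G : TestN K n) (s : Plane) :
    sliceCLM s (action κe κm χ ℓ f n (smulTensor u G)) =
      consTensor (sliceCLM s (weylTest κe κm χ ℓ f u)) G := by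
  have hslice (s' : Plane) (p : Fin n → Mink) (k : Fin n → Fin K) :
      fourierN (slice s' (smulTensor u G)) p k = u s' * fourierN G p k := by
    rw [slice_eq_sliceCLM, sliceCLM_smulTensor, fourierN_eq, fourierN_eq, map_smul]
    rfl
  refine fourierN_injective fun p k => ?_
  rw [fourierN_consTensor, fourier_slice_weylTest κe κm hχ]
  refine (fourierN_slice_action κe κm hχ f _ s p k).trans ?_
  simp only [hslice, weyl_eq]
  ring

lemma hasTemperateGrowth_conj_comp_fst {X Y : Type*} [NormedAddCommGroup X] [NormedSpace ℝ X]
    [NormedAddCommGroup Y] [NormedSpace ℝ Y] (u : 𝓢(X, ℂ)) :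
    (fun z : X × Y => (starRingEnd ℂ) (u z.1)).HasTemperateGrowth :=
  (Complex.conjCLE : ℂ →L[ℝ] ℂ).hasTemperateGrowth.comp
    (u.hasTemperateGrowth.comp (by fun_prop))

/-- The average of `weylTest` over `s` with the weight `conj u'`. Its Fourier transform is
`f̃(p) ⟨u', e^{ip·X} u⟩` where `χ(ℓ) = 1`. -/
def weylAverage (χ : 𝓢(MatSpace, ℂ)) (ℓ : MatSpace) (f : Test K) (u u' : 𝓢(Plane, ℂ)) : Test K :=
  integrateCLM (SchwartzMap.smulLeftCLM (Fin K → ℂ)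
    (fun z : Plane × Mink => (starRingEnd ℂ) (u' z.1)) (weylTest κe κm χ ℓ f u))

lemma map_weylAverage {H : Type*} [NormedAddCommGroup H] [NormedSpace ℂ H] [CompleteSpace H]
    (χ : 𝓢(MatSpace, ℂ)) (ℓ : MatSpace) (f : Test K) (u u' : 𝓢(Plane, ℂ)) (W : Test K →L[ℂ] H) :
    W (weylAverage κe κm χ ℓ f u u') =
      ∫ s, (starRingEnd ℂ) (u' s) • W (sliceCLM s (weylTest κe κm χ ℓ f u)) := by
  have hslice (s : Plane) : sliceCLM s (SchwartzMap.smulLeftCLM (Fin K → ℂ)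
      (fun z : Plane × Mink => (starRingEnd ℂ) (u' z.1)) (weylTest κe κm χ ℓ f u)) =
      (starRingEnd ℂ) (u' s) • sliceCLM s (weylTest κe κm χ ℓ f u) := by
    ext x : 1
    rw [sliceCLM_apply,
      SchwartzMap.smulLeftCLM_apply_apply (hasTemperateGrowth_conj_comp_fst u')]
    rfl
  simp only [weylAverage, map_integrateCLM, hslice, map_smul]

lemma fourier_weylAverage {χ : 𝓢(MatSpace, ℂ)} {ℓ : MatSpace} (hχ : χ ℓ = 1) (f : Test K)
    (u u' : 𝓢(Plane, ℂ)) (p : Mink) (k : Fin K) :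
    fourier (weylAverage κe κm χ ℓ f u u') p k = fourier f p k *
      ∫ s, (starRingEnd ℂ) (u' s) * weyl κe κm (toMat ℓ) p u s := by
  calc fourier (weylAverage κe κm χ ℓ f u u') p k
      = ∫ s, (starRingEnd ℂ) (u' s) * fourier (sliceCLM s (weylTest κe κm χ ℓ f u)) p k := by
        simp only [fourier_eq]
        exact map_weylAverage κe κm χ ℓ f u u' ((ContinuousLinearMap.proj (R := ℂ)
          (φ := fun _ : Fin K => ℂ) k).comp ((evalCLM p).comp fourierCLM))
    _ = _ := by
        rw [← integral_const_mul]
        exact integral_congr_ae (.of_forall fun s => by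
          simp only [fourier_slice_weylTest κe κm hχ, mul_left_comm])

lemma coeff_neg (L : Matrix (Fin 4) (Fin 4) ℝ) (p : Mink) (ν : Fin 4) :
    coeff L (-p) ν = -coeff L p ν := by
  simpa using coeff_smul L (-1) p ν

lemma shift_neg (L : Matrix (Fin 4) (Fin 4) ℝ) (p : Mink) :
    shift κe κm L (-p) = -shift κe κm L p := by
  simpa using shift_smul κe κm L (-1) p

lemma weylPhase_neg_add_shift (L : Matrix (Fin 4) (Fin 4) ℝ) (p : Mink) (s : Plane) :
    weylPhase κe κm L (-p) (s + shift κe κm L p) = -weylPhase κe κm L p s := by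
  simp only [weylPhase, coeff_neg, shift, PiLp.add_apply, Matrix.cons_val_zero, Matrix.cons_val_one]
  ring

lemma integral_conj_mul_weyl (L : Matrix (Fin 4) (Fin 4) ℝ) (p : Mink) (u u' : Plane → ℂ) :
    ∫ s, (starRingEnd ℂ) (u s) * weyl κe κm L p u' s =
      (starRingEnd ℂ) (∫ s, (starRingEnd ℂ) (u' s) * weyl κe κm L (-p) u s) := by
  rw [← integral_conj, ← integral_add_right_eq_self
    (fun s => (starRingEnd ℂ) ((starRingEnd ℂ) (u' s) * weyl κe κm L (-p) u s)) (shift κe κm L p)]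
  refine integral_congr_ae (.of_forall fun s => ?_)
  simp only [weyl_eq, shift_neg, add_neg_cancel_right, weylPhase_neg_add_shift, map_mul,
    Complex.conj_conj, ← Complex.exp_conj, Complex.conj_I, Complex.conj_ofReal, Complex.ofReal_neg,
    map_neg, neg_mul_neg]
  ring

lemma weylAverage_starTest {χ : 𝓢(MatSpace, ℂ)} {ℓ : MatSpace} (hχ : χ ℓ = 1)
    (bar : Fin K → Fin K) (f : Test K) (u u' : 𝓢(Plane, ℂ)) :
    weylAverage κe κm χ ℓ (starTest bar f) u' u =
      starTest bar (weylAverage κe κm χ ℓ f u u') := by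
  refine fourier_injective fun p k => ?_
  rw [fourier_weylAverage κe κm hχ, fourier_starTest, fourier_starTest,
    fourier_weylAverage κe κm hχ, map_mul, integral_conj_mul_weyl]

end WeylTest

section Pairing

variable {E Y V Y' V' : Type u} [NormedAddCommGroup E] [InnerProductSpace ℝ E]
  [FiniteDimensional ℝ E] [MeasurableSpace E] [BorelSpace E]
  [NormedAddCommGroup Y] [NormedSpace ℝ Y] [NormedAddCommGroup V] [NormedSpace ℂ V]
  [NormedAddCommGroup Y'] [NormedSpace ℝ Y'] [NormedAddCommGroup V'] [NormedSpace ℂ V']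
  {H : Type*} [NormedAddCommGroup H] [InnerProductSpace ℂ H]

lemma exists_norm_inner_sliceCLM_le (W' : 𝓢(Y', V') →L[ℂ] H) (F : 𝓢(E × Y', V'))
    (W : 𝓢(Y, V) →L[ℂ] H) : ∃ (t : Finset (ℕ × ℕ)) (b : E → ℝ), Integrable b ∧
      ∀ (G : 𝓢(E × Y, V)) (x : E),
        ‖⟪W' (sliceCLM x F), W (sliceCLM x G)⟫_ℂ‖ ≤ b x * schwartzSup t G := by
  obtain ⟨t, C, hC, hW⟩ := exists_norm_map_le W
  refine ⟨t, fun x => ‖W' (sliceCLM x F)‖ * C, (integrable_map_sliceCLM W' F).norm.mul_const C,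
    fun G x => ?_⟩
  calc ‖⟪W' (sliceCLM x F), W (sliceCLM x G)⟫_ℂ‖
      ≤ ‖W' (sliceCLM x F)‖ * ‖W (sliceCLM x G)‖ := norm_inner_le_norm _ _
    _ ≤ ‖W' (sliceCLM x F)‖ * (C * schwartzSup t G) := by
        gcongr
        exact (hW _).trans (by gcongr; exact schwartzSup_sliceCLM_le G t x)
    _ = _ := (mul_assoc ..).symm

lemma integrable_inner_sliceCLM (W' : 𝓢(Y', V') →L[ℂ] H) (F : 𝓢(E × Y', V'))
    (W : 𝓢(Y, V) →L[ℂ] H) (G : 𝓢(E × Y, V)) :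
    Integrable fun x => ⟪W' (sliceCLM x F), W (sliceCLM x G)⟫_ℂ := by
  obtain ⟨t, b, hb, hle⟩ := exists_norm_inner_sliceCLM_le (E := E) W' F W
  refine (hb.mul_const _).mono' (Continuous.aestronglyMeasurable ?_) (.of_forall (hle G))
  exact (W'.continuous.comp (continuous_sliceCLM F)).inner
    (W.continuous.comp (continuous_sliceCLM G))

/-- The continuous functional `G ↦ ∫ dx ⟨W'(F_x), W(G_x)⟩`. -/
def pairing (W' : 𝓢(Y', V') →L[ℂ] H) (F : 𝓢(E × Y', V')) (W : 𝓢(Y, V) →L[ℂ] H) :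
    𝓢(E × Y, V) →L[ℂ] ℂ :=
  SchwartzMap.mkCLMtoNormedSpace (fun G => ∫ x, ⟪W' (sliceCLM x F), W (sliceCLM x G)⟫_ℂ)
    (fun G G' => by
      simp only [map_add, inner_add_right]
      exact integral_add (integrable_inner_sliceCLM W' F W G) (integrable_inner_sliceCLM W' F W G'))
    (fun c G => by
      simp only [map_smul, inner_smul_right]
      exact integral_const_mul _ _)
    (by
      obtain ⟨t, b, hb, hle⟩ := exists_norm_inner_sliceCLM_le (E := E) W' F W
      refine ⟨t, ∫ x, ‖b x‖, by positivity, fun G => ?_⟩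
      rw [← integral_mul_const]
      refine norm_integral_le_of_norm_le (hb.norm.mul_const _) (.of_forall fun x => ?_)
      exact (hle G x).trans
        (mul_le_mul_of_nonneg_right (Real.le_norm_self _) (apply_nonneg _ _)))

lemma pairing_apply (W' : 𝓢(Y', V') →L[ℂ] H) (F : 𝓢(E × Y', V')) (W : 𝓢(Y, V) →L[ℂ] H)
    (G : 𝓢(E × Y, V)) :
    pairing W' F W G = ∫ x, ⟪W' (sliceCLM x F), W (sliceCLM x G)⟫_ℂ := rfl

lemma conj_pairing (W' : 𝓢(Y', V') →L[ℂ] H) (F : 𝓢(E × Y', V')) (W : 𝓢(Y, V) →L[ℂ] H)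
    (G : 𝓢(E × Y, V)) : (starRingEnd ℂ) (pairing W' F W G) = pairing W G W' F := by
  simp only [pairing_apply, ← integral_conj, inner_conj_symm]

theorem pairing_eq_pairing_of_smulTensor [CompleteSpace V] [CompleteSpace V']
    {Z B Z' B' : Type u} [NormedAddCommGroup Z]
    [NormedSpace ℝ Z] [NormedAddCommGroup B] [NormedSpace ℂ B] [NormedAddCommGroup Z']
    [NormedSpace ℝ Z'] [NormedAddCommGroup B'] [NormedSpace ℂ B']
    (W₁' : 𝓢(Y', V') →L[ℂ] H) (W₁ : 𝓢(Z, B) →L[ℂ] H) (W₂' : 𝓢(Z', B') →L[ℂ] H)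
    (W₂ : 𝓢(Y, V) →L[ℂ] H) (A : 𝓢(E × Y, V) →L[ℂ] 𝓢(E × Z, B))
    (A' : 𝓢(E × Y', V') →L[ℂ] 𝓢(E × Z', B'))
    (h : ∀ u' F u G, pairing W₁' (smulTensor u' F) W₁ (A (smulTensor u G)) =
      pairing W₂' (A' (smulTensor u' F)) W₂ (smulTensor u G))
    (F : 𝓢(E × Y', V')) (G : 𝓢(E × Y, V)) :
    pairing W₁' F W₁ (A G) = pairing W₂' (A' F) W₂ G := by
  have hG : (pairing W₁' F W₁).comp A = pairing W₂' (A' F) W₂ := by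
    refine ext_of_smulTensor fun u G => ?_
    have hF : pairing W₁ (A (smulTensor u G)) W₁' =
        (pairing W₂ (smulTensor u G) W₂').comp A' := by
      refine ext_of_smulTensor fun u' F => ?_
      rw [ContinuousLinearMap.comp_apply, ← conj_pairing W₁', ← conj_pairing W₂', h]
    rw [ContinuousLinearMap.comp_apply, ← conj_pairing W₁, ← conj_pairing W₂, hF,
      ContinuousLinearMap.comp_apply]
  exact congrArg (fun W => W G) hG

end Pairing

section Fibre

variable (κe κm : ℝ) {K : ℕ} {H : Type*} [NormedAddCommGroup H] [InnerProductSpace ℂ H]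
  (T : Theory K H)

/-- The matrix elements `f ↦ ⟨v, φ(f) w⟩`. -/
def Theory.matrixElement (v w : T.D) : Test K →L[ℂ] ℂ where
  toFun f := ⟪(v : H), (T.φ f w : H)⟫_ℂ
  map_add' f g := by simp
  map_smul' c f := by simp
  cont := T.φ_tempered v w

lemma pairing_smulTensor_action {χ : 𝓢(MatSpace, ℂ)} {ℓ : MatSpace} (hχ : χ ℓ = 1) (f : Test K)
    {m n : ℕ} (u u' : 𝓢(Plane, ℂ)) (F : TestN K m) (G : TestN K n) :
    pairing (T.Ψ m) (smulTensor u' F) (T.Ψ (n + 1)) (action κe κm χ ℓ f n (smulTensor u G)) =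
      ⟪T.Ψ m F, (T.φ (weylAverage κe κm χ ℓ f u u') ⟨T.Ψ n G, T.Ψ_mem n G⟩ : H)⟫_ℂ := by
  have haverage := map_weylAverage κe κm χ ℓ f u u'
    (T.matrixElement ⟨T.Ψ m F, T.Ψ_mem m F⟩ ⟨T.Ψ n G, T.Ψ_mem n G⟩)
  refine Eq.trans (integral_congr_ae (.of_forall fun s => ?_)) haverage.symm
  change ⟪T.Ψ m (u' s • F), T.Ψ (n + 1) (sliceCLM s (action κe κm χ ℓ f n (smulTensor u G)))⟫_ℂ =
    (starRingEnd ℂ) (u' s) • ⟪T.Ψ m F, (T.φ (sliceCLM s (weylTest κe κm χ ℓ f u))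
      ⟨T.Ψ n G, T.Ψ_mem n G⟩ : H)⟫_ℂ
  rw [sliceCLM_action_smulTensor κe κm hχ, T.φ_Ψ, map_smul, inner_smul_left, smul_eq_mul]

lemma pairing_action_smulTensor {χ : 𝓢(MatSpace, ℂ)} {ℓ : MatSpace} (hχ : χ ℓ = 1) (f : Test K)
    {m n : ℕ} (u u' : 𝓢(Plane, ℂ)) (F : TestN K m) (G : TestN K n) :
    pairing (T.Ψ (m + 1)) (action κe κm χ ℓ (starTest T.bar f) m (smulTensor u' F)) (T.Ψ n)
        (smulTensor u G) =
      ⟪(T.φ (starTest T.bar (weylAverage κe κm χ ℓ f u u')) ⟨T.Ψ m F, T.Ψ_mem m F⟩ : H),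
        T.Ψ n G⟫_ℂ := by
  rw [← conj_pairing, pairing_smulTensor_action κe κm T hχ, weylAverage_starTest κe κm hχ,
    inner_conj_symm]

theorem pairing_action {χ : 𝓢(MatSpace, ℂ)} {ℓ : MatSpace} (hχ : χ ℓ = 1) (f : Test K)
    {m n : ℕ} (F : 𝓢(Plane × (Fin m → Mink), (Fin m → Fin K) → ℂ))
    (G : 𝓢(Plane × (Fin n → Mink), (Fin n → Fin K) → ℂ)) :
    pairing (T.Ψ m) F (T.Ψ (n + 1)) (action κe κm χ ℓ f n G) =
      pairing (T.Ψ (m + 1)) (action κe κm χ ℓ (starTest T.bar f) m F) (T.Ψ n) G := by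
  refine pairing_eq_pairing_of_smulTensor _ _ _ _ (action κe κm χ ℓ f n)
    (action κe κm χ ℓ (starTest T.bar f) m) (fun u' F u G => ?_) F G
  rw [pairing_smulTensor_action κe κm T hχ, pairing_action_smulTensor κe κm T hχ]
  exact T.φ_adjoint _ ⟨T.Ψ m F, T.Ψ_mem m F⟩ ⟨T.Ψ n G, T.Ψ_mem n G⟩

end Fibre

/-! ### Local finiteness of the surface measure of `Σ` -/

section HausdorffMeasure

theorem hausdorffMeasure_lt_top_of_dist_le {X ι : Type*} [MetricSpace X] [MeasurableSpace X]
    [BorelSpace X] [Fintype ι] {s : Set X} {f : X → ι → ℝ} {C : ℝ} (hC : 0 ≤ C)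
    (hf : ∀ x ∈ s, ∀ y ∈ s, dist x y ≤ C * dist (f x) (f y)) (hb : Bornology.IsBounded (f '' s)) :
    μH[Fintype.card ι] s < ⊤ := by
  have hanti : AntilipschitzWith C.toNNReal (s.domRestrict f) :=
    AntilipschitzWith.of_le_mul_dist fun x y => by
      rw [Real.coe_toNNReal _ hC]
      exact hf x x.2 y y.2
  have hs := isometry_subtype_coe.hausdorffMeasure_image (d := (Fintype.card ι : ℝ))
    (Or.inl (Nat.cast_nonneg _)) (Set.univ : Set s)
  rw [Set.image_univ, Subtype.range_coe] at hs
  rw [hs]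
  refine (hanti.le_hausdorffMeasure_image (Nat.cast_nonneg _) Set.univ).trans_lt ?_
  refine ENNReal.mul_lt_top
    (ENNReal.rpow_lt_top_of_nonneg (Nat.cast_nonneg _) ENNReal.coe_ne_top) ?_
  rw [hausdorffMeasure_pi_real, Set.image_univ, Set.range_domRestrict]
  exact hb.measure_lt_top

end HausdorffMeasure

section NormedField

variable {𝕜 : Type*} [NormedField 𝕜] {a z w : 𝕜}

lemma norm_lt_norm_add_of_norm_sub_lt [NormedSpace ℝ 𝕜] (hz : ‖z - a‖ < ‖a‖ / 2)
    (hw : ‖w - a‖ < ‖a‖ / 2) : ‖a‖ < ‖z + w‖ := by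
  have htriangle : ‖(2 : ℝ) • a‖ ≤ ‖z + w‖ + (‖z - a‖ + ‖w - a‖) := by
    calc ‖(2 : ℝ) • a‖ = ‖(z + w) - ((z - a) + (w - a))‖ := by
          rw [two_smul]
          congr 1
          ring
      _ ≤ _ := (norm_sub_le _ _).trans (by gcongr; exact norm_add_le _ _)
  rw [norm_smul, Real.norm_ofNat] at htriangle
  linarith

lemma norm_sub_mul_norm_add_le_of_sum_sq_eq {z₀ z₁ z₂ w₀ w₁ w₂ : 𝕜} {B : ℝ}
    (h : z₀ ^ 2 + z₁ ^ 2 + z₂ ^ 2 = w₀ ^ 2 + w₁ ^ 2 + w₂ ^ 2) (h₁ : ‖z₁ + w₁‖ ≤ B)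
    (h₂ : ‖z₂ + w₂‖ ≤ B) :
    ‖z₀ - w₀‖ * ‖z₀ + w₀‖ ≤ (‖z₁ - w₁‖ + ‖z₂ - w₂‖) * B := by
  have hfactor : (z₀ - w₀) * (z₀ + w₀) = -((z₁ - w₁) * (z₁ + w₁) + (z₂ - w₂) * (z₂ + w₂)) := by
    linear_combination h
  rw [← norm_mul, hfactor, norm_neg, add_mul]
  refine (norm_add_le _ _).trans ?_
  rw [norm_mul, norm_mul]
  gcongr

end NormedField

section SurfaceMeasure

lemma sum_sign_mul {R : Type*} [CommRing R] {a : Fin 4 → Fin 4 → R} (ha : ∀ i j, a j i = -a i j) :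
    ∑ τ : Equiv.Perm (Fin 4), ((Equiv.Perm.sign τ : ℤ) : R) * (a (τ 0) (τ 1) * a (τ 2) (τ 3)) =
      8 * (a 0 1 * a 2 3 - a 0 2 * a 1 3 + a 0 3 * a 1 2) := by
  have apply_two {n : ℕ} (p : Fin (n + 3)) (e : Equiv.Perm (Fin (n + 2))) :
      Equiv.Perm.decomposeFin.symm (p, e) 2 = Equiv.swap 0 p (e 1).succ :=
    Equiv.Perm.decomposeFin_symm_apply_succ e p 1
  have apply_three (p : Fin 4) (e : Equiv.Perm (Fin 3)) :
      Equiv.Perm.decomposeFin.symm (p, e) 3 = Equiv.swap 0 p (e 2).succ :=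
    Equiv.Perm.decomposeFin_symm_apply_succ e p 2
  simp [Finset.univ_perm_fin_succ, ← Finset.univ_product_univ, Finset.sum_product,
    Fin.sum_univ_succ, Equiv.swap_apply_def, apply_two, apply_three, ha 0 1, ha 0 2, ha 0 3,
    ha 1 2, ha 1 3, ha 2 3]
  ring

lemma sum_fin_three_rotate {M : Type*} [AddCommMonoid M] (x : Fin 3 → M) (j : Fin 3) :
    ∑ k, x k = x j + x (j + 1) + x (j + 2) := by
  refine (Equiv.sum_comp (Equiv.addLeft j) x).symm.trans ?_
  simp only [Fin.sum_univ_three, Equiv.coe_addLeft, add_zero]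

/-- The complex field strength `E + iB` of an antisymmetric matrix `θ`, with `E` the first row of
`θ` and `B` its spatial part. The two equations defining `Σ` are the real and imaginary part of one
equation for its complex square. -/
def fieldStrength (θ : MatSpace) : Fin 3 → ℂ :=
  ![⟨θ (0, 1), θ (2, 3)⟩, ⟨θ (0, 2), θ (3, 1)⟩, ⟨θ (0, 3), θ (1, 2)⟩]

lemma continuous_fieldStrength (k : Fin 3) : Continuous fun θ => fieldStrength θ k := by
  have hmk : ∀ i j : Fin 4 × Fin 4, Continuous fun θ : MatSpace => (⟨θ i, θ j⟩ : ℂ) := fun i j => by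
    simp only [Complex.mk_eq_add_mul_I]
    fun_prop
  fin_cases k <;> exact hmk _ _

variable {κe κm : ℝ}

lemma Spec.antisymm {θ : MatSpace} (hθ : θ ∈ Spec κe κm) (i j : Fin 4) :
    θ (j, i) = -θ (i, j) := by
  simpa [toMat] using congrFun (congrFun hθ.1 i) j

lemma Spec.sum_sq_fieldStrength {θ : MatSpace} (hθ : θ ∈ Spec κe κm) :
    ∑ k, fieldStrength θ k ^ 2 = ((κe : ℂ) + κm * Complex.I) ^ 2 := by
  have ha := Spec.antisymm hθ
  have hdiag : ∀ i, θ (i, i) = 0 := fun i => by linarith [ha i i]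
  obtain ⟨-, hinvariant, hpfaffian⟩ := hθ
  rw [sum_sign_mul (a := raise (toMat θ)) (fun i j => by simp [raise, toMat, ha i j]; ring)]
    at hpfaffian
  simp [raise, toMat, eta, Fin.sum_univ_four, ha 0 1, ha 0 2, ha 0 3, ha 1 2, ha 1 3, ha 2 3,
    hdiag] at hinvariant hpfaffian
  simp only [Fin.sum_univ_three, fieldStrength, Matrix.cons_val_zero, Matrix.cons_val_one,
    Matrix.cons_val]
  apply Complex.ext <;> simp [pow_two, ha 1 3] <;> linarith

lemma Spec.dist_sq {θ θ' : MatSpace} (hθ : θ ∈ Spec κe κm) (hθ' : θ' ∈ Spec κe κm) :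
    dist θ θ' ^ 2 = 2 * ∑ k, ‖fieldStrength θ k - fieldStrength θ' k‖ ^ 2 := by
  have ha := Spec.antisymm hθ
  have ha' := Spec.antisymm hθ'
  have hdiag : ∀ i, θ (i, i) = 0 := fun i => by linarith [ha i i]
  have hdiag' : ∀ i, θ' (i, i) = 0 := fun i => by linarith [ha' i i]
  rw [EuclideanSpace.dist_eq, Real.sq_sqrt (by positivity)]
  simp only [fieldStrength, Complex.sq_norm, Complex.normSq_apply, Complex.sub_re, Complex.sub_im,
    Matrix.cons_val_zero, Matrix.cons_val_one, Matrix.cons_val, Fin.sum_univ_three,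
    Fintype.sum_prod_type, Fin.sum_univ_four, Real.dist_eq, sq_abs, ha 0 1, ha 0 2, ha 0 3, ha 1 2,
    ha 1 3, ha 2 3, hdiag, ha' 0 1, ha' 0 2, ha' 0 3, ha' 1 2, ha' 1 3, ha' 2 3, hdiag']
  ring

lemma Spec.dist_le {θ θ' : MatSpace} (hθ : θ ∈ Spec κe κm) (hθ' : θ' ∈ Spec κe κm) :
    dist θ θ' ≤ 2 * ∑ k, ‖fieldStrength θ k - fieldStrength θ' k‖ := by
  refine le_of_sq_le_sq ?_ (by positivity)
  rw [Spec.dist_sq hθ hθ', mul_pow]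
  have hsq := Finset.sum_sq_le_sq_sum_of_nonneg (s := Finset.univ)
    (f := fun k => ‖fieldStrength θ k - fieldStrength θ' k‖) fun _ _ => norm_nonneg _
  gcongr
  norm_num

/-- Local coordinates of `Σ`: the real and imaginary parts of two of the three components of the
field strength. -/
def chart (j : Fin 3) (θ : MatSpace) : Fin 4 → ℝ :=
  ![(fieldStrength θ (j + 1)).re, (fieldStrength θ (j + 1)).im,
    (fieldStrength θ (j + 2)).re, (fieldStrength θ (j + 2)).im]

lemma norm_sub_le_dist_chart (j : Fin 3) (θ θ' : MatSpace) :
    ‖fieldStrength θ (j + 1) - fieldStrength θ' (j + 1)‖ ≤ 2 * dist (chart j θ) (chart j θ') ∧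
    ‖fieldStrength θ (j + 2) - fieldStrength θ' (j + 2)‖ ≤ 2 * dist (chart j θ) (chart j θ') := by
  have hcoord := fun i => dist_le_pi_dist (chart j θ) (chart j θ') i
  rw [two_mul]
  exact ⟨(Complex.norm_le_abs_re_add_abs_im _).trans (add_le_add (hcoord 0) (hcoord 1)),
    (Complex.norm_le_abs_re_add_abs_im _).trans (add_le_add (hcoord 2) (hcoord 3))⟩

lemma norm_chart_le {j : Fin 3} {θ : MatSpace} {R : ℝ} (h : ∀ k, ‖fieldStrength θ k‖ ≤ R) :
    ‖chart j θ‖ ≤ R := by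
  rw [pi_norm_le_iff_of_nonneg ((norm_nonneg _).trans (h j))]
  have hre := fun k => (Complex.abs_re_le_norm _).trans (h k)
  have him := fun k => (Complex.abs_im_le_norm _).trans (h k)
  intro i
  fin_cases i
  exacts [hre _, him _, hre _, him _]

/-- An open subset of `Σ` on which the `j`-th component of the field strength stays away from `0`,
so that it is a Lipschitz function of the other two and `chart j` is a coordinate system. -/
def chartDomain (j : Fin 3) (a : ℂ) (R : ℝ) : Set (Spec κe κm) :=
  {θ | ‖fieldStrength θ j - a‖ < ‖a‖ / 2 ∧ ∀ k, ‖fieldStrength θ k‖ < R}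

lemma isOpen_chartDomain (j : Fin 3) (a : ℂ) (R : ℝ) :
    IsOpen (chartDomain j a R : Set (Spec κe κm)) := by
  have hcont : ∀ k, Continuous fun θ : Spec κe κm => fieldStrength θ k := fun k =>
    (continuous_fieldStrength k).comp continuous_subtype_val
  refine (isOpen_lt ((hcont j).sub continuous_const).norm continuous_const).and ?_
  simp only [Set.ofPred_forall]
  exact isOpen_iInter_of_finite fun k => isOpen_lt (hcont k).norm continuous_const

lemma dist_le_dist_chart {j : Fin 3} {a : ℂ} {R : ℝ} (ha : a ≠ 0) {θ θ' : Spec κe κm}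
    (hθ : θ ∈ chartDomain j a R) (hθ' : θ' ∈ chartDomain j a R) :
    dist θ θ' ≤ (8 + 16 * R / ‖a‖) * dist (chart j θ) (chart j θ') := by
  set D := dist (chart j θ) (chart j θ') with hD
  obtain ⟨h₁, h₂⟩ := norm_sub_le_dist_chart j (θ : MatSpace) θ'
  rw [← hD] at h₁ h₂
  have hR : 0 ≤ R := (norm_nonneg _).trans (hθ.2 j).le
  have hadd : ∀ k, ‖fieldStrength θ k + fieldStrength θ' k‖ ≤ 2 * R := fun k =>
    (norm_add_le _ _).trans (by linarith [hθ.2 k, hθ'.2 k])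
  have hsq := (Spec.sum_sq_fieldStrength θ.2).trans (Spec.sum_sq_fieldStrength θ'.2).symm
  simp only [sum_fin_three_rotate _ j] at hsq
  have h₀ : ‖fieldStrength θ j - fieldStrength θ' j‖ ≤ 8 * R * D / ‖a‖ := by
    rw [le_div_iff₀ (norm_pos_iff.2 ha)]
    calc ‖fieldStrength θ j - fieldStrength θ' j‖ * ‖a‖
        ≤ ‖fieldStrength θ j - fieldStrength θ' j‖ * ‖fieldStrength θ j + fieldStrength θ' j‖ := by
          gcongr
          exact (norm_lt_norm_add_of_norm_sub_lt hθ.1 hθ'.1).le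
      _ ≤ (2 * D + 2 * D) * (2 * R) :=
          (norm_sub_mul_norm_add_le_of_sum_sq_eq hsq (hadd _) (hadd _)).trans (by gcongr)
      _ = 8 * R * D := by ring
  calc dist θ θ' ≤ 2 * (8 * R * D / ‖a‖ + 2 * D + 2 * D) := by
        refine (Spec.dist_le θ.2 θ'.2).trans ?_
        rw [sum_fin_three_rotate _ j]
        gcongr
    _ = (8 + 16 * R / ‖a‖) * D := by ring

lemma hausdorffMeasure_chartDomain_lt_top {j : Fin 3} {a : ℂ} {R : ℝ} (ha : a ≠ 0) :
    (μH[(4 : ℕ)] : Measure (Spec κe κm)) (chartDomain j a R) < ⊤ := by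
  rcases (chartDomain j a R : Set (Spec κe κm)).eq_empty_or_nonempty with hempty | ⟨θ₀, hθ₀⟩
  · simp [hempty]
  have hR : 0 ≤ R := (norm_nonneg _).trans (hθ₀.2 j).le
  have hbounded : Bornology.IsBounded ((fun θ : Spec κe κm => chart j θ) '' chartDomain j a R) := by
    refine isBounded_iff_forall_norm_le.2 ⟨R, ?_⟩
    rintro _ ⟨θ, hθ, rfl⟩
    exact norm_chart_le fun k => (hθ.2 k).le
  simpa using hausdorffMeasure_lt_top_of_dist_le (X := Spec κe κm) (C := 8 + 16 * R / ‖a‖)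
    (by positivity) (fun θ hθ θ' hθ' => dist_le_dist_chart ha hθ hθ') hbounded

theorem isLocallyFiniteMeasure_spec (hκ : ¬(κe = 0 ∧ κm = 0)) :
    IsLocallyFiniteMeasure (μHE[4] : Measure (Spec κe κm)) := by
  refine ⟨fun θ => ?_⟩
  have hne : ((κe : ℂ) + κm * Complex.I) ^ 2 ≠ 0 := fun h => hκ (by
    rw [pow_eq_zero_iff two_ne_zero] at h
    exact ⟨by simpa using congrArg Complex.re h, by simpa using congrArg Complex.im h⟩)
  obtain ⟨j, hj⟩ : ∃ j, fieldStrength θ j ≠ 0 := by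
    by_contra! hzero
    exact hne (by simp [← Spec.sum_sq_fieldStrength θ.2, hzero])
  refine ⟨chartDomain j (fieldStrength θ j) (∑ k, ‖fieldStrength θ k‖ + 1),
    (isOpen_chartDomain _ _ _).mem_nhds ⟨by simpa using hj, fun k => ?_⟩, ?_⟩
  · have hk := Finset.single_le_sum (f := fun k => ‖fieldStrength θ k‖) (fun _ _ => norm_nonneg _)
      (Finset.mem_univ k)
    linarith
  · rw [Measure.euclideanHausdorffMeasure_def, Measure.smul_apply, ENNReal.smul_def, smul_eq_mul]
    exact ENNReal.mul_lt_top ENNReal.coe_lt_top (hausdorffMeasure_chartDomain_lt_top hj)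

end SurfaceMeasure

/-! ### The vectors `Ψ^⊗(𝐠)` -/

section Vectors

variable {κe κm : ℝ} {K : ℕ} {H : Type*} [NormedAddCommGroup H] [InnerProductSpace ℂ H]
  (T : Theory K H)

lemma stronglyMeasurable_Ψ_slice [CompleteSpace H] {g : BigTest κe κm K} (hg : IsBigTest g)
    (n : ℕ) : StronglyMeasurable fun z : Plane × Spec κe κm => T.Ψ n (slice z.1 (g n z.2)) :=
  stronglyMeasurable_uncurry_of_continuous_of_stronglyMeasurable
    (u := fun s θ => T.Ψ n (slice s (g n θ)))
    (fun θ => (T.Ψ n).continuous.comp (continuous_sliceCLM (g n θ)))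
    (fun s => stronglyMeasurable_map_plane (g n)
      (fun z => (hg.measurable n z).stronglyMeasurable) ((T.Ψ n).comp (slice s)))

lemma exists_pow_mul_norm_Ψ_slice_le {g : BigTest κe κm K} (hg : IsBigTest g) (n m : ℕ) :
    ∃ B, ∀ s θ, ‖s‖ ^ m * ‖T.Ψ n (slice s (g n θ))‖ ≤ B := by
  obtain ⟨t, C, hC, hΨ⟩ := exists_norm_map_le (T.Ψ n)
  obtain ⟨B, hB⟩ := exists_forall_schwartzSup_le (hg.bounded n) (t.image fun q => (m + q.1, q.2))
  refine ⟨C * B, fun s θ => ?_⟩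
  calc ‖s‖ ^ m * ‖T.Ψ n (slice s (g n θ))‖
      ≤ ‖s‖ ^ m * (C * schwartzSup t (sliceCLM s (g n θ))) :=
        mul_le_mul_of_nonneg_left (hΨ _) (by positivity)
    _ = C * (‖s‖ ^ m * schwartzSup t (sliceCLM s (g n θ))) := by ring
    _ ≤ C * B := mul_le_mul_of_nonneg_left
        ((pow_mul_schwartzSup_sliceCLM_le (g n θ) m t s).trans (hB θ)) hC

lemma exists_norm_Ψ_slice_le {g : BigTest κe κm K} (hg : IsBigTest g) (n : ℕ) :
    ∃ B, ∀ s θ, ‖T.Ψ n (slice s (g n θ))‖ ≤ B * (1 + ‖s‖) ^ (-3 : ℝ) := by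
  obtain ⟨B₀, hB₀⟩ := exists_pow_mul_norm_Ψ_slice_le T hg n 0
  obtain ⟨B₃, hB₃⟩ := exists_pow_mul_norm_Ψ_slice_le T hg n 3
  refine ⟨2 ^ 3 * (B₀ + B₃), fun s θ => ?_⟩
  simpa using pow_mul_le_of_le_of_pow_mul_le (k := 0) (l := 3) (norm_nonneg s)
    (norm_nonneg (T.Ψ n (slice s (g n θ)))) (by simpa using hB₀ s θ) (by simpa using hB₃ s θ)

lemma memLp_Ψ_slice [CompleteSpace H] [IsLocallyFiniteMeasure (μHE[4] : Measure (Spec κe κm))]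
    {g : BigTest κe κm K} (hg : IsBigTest g) (n : ℕ) :
    MemLp (fun z : Plane × Spec κe κm => T.Ψ n (slice z.1 (g n z.2))) 2 (specMeasure κe κm) := by
  obtain ⟨B, hB⟩ := exists_norm_Ψ_slice_le T hg n
  obtain ⟨C, hC, hgC⟩ := hg.support n
  have hm := (stronglyMeasurable_Ψ_slice T hg n).aestronglyMeasurable (μ := specMeasure κe κm)
  rw [memLp_two_iff_integrable_sq_norm hm]
  have hdecay : Integrable fun s : Plane => B ^ 2 * (1 + ‖s‖) ^ (-6 : ℝ) :=
    (integrable_one_add_norm (by simp; norm_num)).const_mul _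
  have hsupport : Integrable (C.indicator fun _ => (1 : ℝ)) (μHE[4] : Measure (Spec κe κm)) :=
    (integrable_indicator_iff hC.measurableSet).2 (integrableOn_const hC.measure_lt_top.ne)
  refine (hdecay.mul_prod hsupport).mono' (hm.norm.pow 2) (.of_forall fun z => ?_)
  rw [Real.norm_of_nonneg (by positivity)]
  by_cases hz : z.2 ∈ C
  · have hsq : (1 + ‖z.1‖) ^ (-6 : ℝ) = ((1 + ‖z.1‖) ^ (-3 : ℝ)) ^ 2 := by
      rw [← Real.rpow_natCast, ← Real.rpow_mul (by positivity)]
      norm_num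
    rw [Set.indicator_of_mem hz, mul_one, hsq, ← mul_pow]
    exact pow_le_pow_left₀ (norm_nonneg _) (hB z.1 z.2) 2
  · simp [hgC _ hz, Set.indicator_of_notMem hz]

lemma bigPsi_eq_sum {g : BigTest κe κm K} {N : ℕ} (hN : ∀ n, N ≤ n → g n = 0) :
    bigPsi T g = fun z => ∑ n ∈ Finset.range N, T.Ψ n (slice z.1 (g n z.2)) := by
  funext z
  refine finsum_eq_sum_of_support_subset _ fun n hn => ?_
  by_contra h
  exact hn (by simp [hN n (by simpa using h)])

theorem memLp_bigPsi [CompleteSpace H] [IsLocallyFiniteMeasure (μHE[4] : Measure (Spec κe κm))]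
    {g : BigTest κe κm K} (hg : IsBigTest g) : MemLp (bigPsi T g) 2 (specMeasure κe κm) := by
  obtain ⟨N, hN⟩ := hg.terminating
  rw [bigPsi_eq_sum T hN]
  exact memLp_finsetSum _ fun n _ => memLp_Ψ_slice T hg n

end Vectors

/-! ### The deformed fields as operators -/

section Operators

variable {κe κm : ℝ} {K : ℕ} {H : Type*} [NormedAddCommGroup H] [InnerProductSpace ℂ H]
  (T : Theory K H) {Λ : Spec κe κm → Matrix (Fin 4) (Fin 4) ℝ}

lemma IsAction.eq_action {f : Test K} {g h : BigTest κe κm K} (hact : IsAction Λ f g h)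
    {χ : 𝓢(MatSpace, ℂ)} {θ : Spec κe κm} (hχ : χ (ofMat (Λ θ)) = 1) (n : ℕ) :
    h (n + 1) θ = action κe κm χ (ofMat (Λ θ)) f n (g n θ) := by
  refine eq_of_forall_slice_eq fun s => fourierN_injective fun p k => ?_
  rw [hact.2, fourierN_slice_action κe κm hχ]
  rfl

lemma IsAction.pairing_eq {f : Test K} {g h g' h' : BigTest κe κm K} (hact : IsAction Λ f g h)
    (hact' : IsAction Λ (starTest T.bar f) g' h') (θ : Spec κe κm) (m n : ℕ) :
    pairing (T.Ψ m) (g' m θ) (T.Ψ (n + 1)) (h (n + 1) θ) =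
      pairing (T.Ψ (m + 1)) (h' (m + 1) θ) (T.Ψ n) (g n θ) := by
  obtain ⟨χ, hχ⟩ := exists_schwartz_eq_one MatSpace ‖ofMat (Λ θ)‖
  have hχ_one := hχ _ le_rfl
  rw [hact.eq_action hχ_one, hact'.eq_action hχ_one, pairing_action κe κm T hχ_one]

lemma map_snd_fieldGraph_le (f : Test K) :
    (fieldGraph Λ T f).map (LinearMap.snd ℂ (BigHilbert κe κm H) (BigHilbert κe κm H)) ≤
      bigDomain κe κm T := by
  rw [fieldGraph, Submodule.map_span, bigDomain]
  refine Submodule.span_mono ?_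
  rintro _ ⟨ξ, ⟨g, h, -, hh, -, -, hξ⟩, rfl⟩
  exact ⟨h, hh, hξ⟩

variable [CompleteSpace H] [IsLocallyFiniteMeasure (μHE[4] : Measure (Spec κe κm))]

lemma integrable_inner_Ψ {g g' : BigTest κe κm K} (hg : IsBigTest g) (hg' : IsBigTest g')
    (m n : ℕ) : Integrable (fun z : Plane × Spec κe κm =>
      ⟪T.Ψ m (slice z.1 (g' m z.2)), T.Ψ n (slice z.1 (g n z.2))⟫_ℂ) (specMeasure κe κm) := by
  have hm := memLp_Ψ_slice T hg' m
  have hn := memLp_Ψ_slice T hg n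
  refine (L2.integrable_inner (𝕜 := ℂ) (hm.toLp _) (hn.toLp _)).congr ?_
  filter_upwards [hm.coeFn_toLp, hn.coeFn_toLp] with z hzm hzn
  rw [hzm, hzn]

lemma integral_inner_Ψ {g g' : BigTest κe κm K} (hg : IsBigTest g) (hg' : IsBigTest g')
    (m n : ℕ) : ∫ z, ⟪T.Ψ m (slice z.1 (g' m z.2)), T.Ψ n (slice z.1 (g n z.2))⟫_ℂ
      ∂(specMeasure κe κm) = ∫ θ, pairing (T.Ψ m) (g' m θ) (T.Ψ n) (g n θ) ∂μHE[4] :=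
  integral_prod_symm _ (integrable_inner_Ψ T hg hg' m n)

lemma inner_eq_sum_pairing {g g' : BigTest κe κm K} (hg : IsBigTest g) (hg' : IsBigTest g')
    {M N : ℕ} (hN : ∀ n, N ≤ n → g n = 0) (hM : ∀ n, M ≤ n → g' n = 0)
    {ξ ξ' : BigHilbert κe κm H} (hξ : ξ =ᵐ[specMeasure κe κm] bigPsi T g)
    (hξ' : ξ' =ᵐ[specMeasure κe κm] bigPsi T g') :
    ⟪ξ', ξ⟫_ℂ = ∑ m ∈ Finset.range M, ∑ n ∈ Finset.range N,
      ∫ θ, pairing (T.Ψ m) (g' m θ) (T.Ψ n) (g n θ) ∂μHE[4] := by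
  have hpointwise : (fun z => ⟪ξ' z, ξ z⟫_ℂ) =ᵐ[specMeasure κe κm] fun z =>
      ∑ m ∈ Finset.range M, ∑ n ∈ Finset.range N,
        ⟪T.Ψ m (slice z.1 (g' m z.2)), T.Ψ n (slice z.1 (g n z.2))⟫_ℂ := by
    filter_upwards [hξ, hξ'] with z hz hz'
    rw [hz, hz', bigPsi_eq_sum T hN, bigPsi_eq_sum T hM]
    simp only [sum_inner, inner_sum]
    exact Finset.sum_comm
  rw [L2.inner_def, integral_congr_ae hpointwise, integral_finsetSum _ fun m _ =>
    integrable_finsetSum _ fun n _ => integrable_inner_Ψ T hg hg' m n]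
  refine Finset.sum_congr rfl fun m _ => ?_
  rw [integral_finsetSum _ fun n _ => integrable_inner_Ψ T hg hg' m n]
  simp only [integral_inner_Ψ T hg hg']

lemma IsAction.inner_eq {f : Test K} {g h g' h' : BigTest κe κm K} (hg : IsBigTest g)
    (hh : IsBigTest h) (hact : IsAction Λ f g h) (hg' : IsBigTest g') (hh' : IsBigTest h')
    (hact' : IsAction Λ (starTest T.bar f) g' h') {ξ η ξ' η' : BigHilbert κe κm H}
    (hξ : ξ =ᵐ[specMeasure κe κm] bigPsi T g) (hη : η =ᵐ[specMeasure κe κm] bigPsi T h)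
    (hξ' : ξ' =ᵐ[specMeasure κe κm] bigPsi T g') (hη' : η' =ᵐ[specMeasure κe κm] bigPsi T h') :
    ⟪ξ', η⟫_ℂ = ⟪η', ξ⟫_ℂ := by
  obtain ⟨Ng, hNg⟩ := hg.terminating
  obtain ⟨Nh, hNh⟩ := hh.terminating
  obtain ⟨Ng', hNg'⟩ := hg'.terminating
  obtain ⟨Nh', hNh'⟩ := hh'.terminating
  set N := Ng + Nh + Ng' + Nh'
  rw [inner_eq_sum_pairing T hh hg' (N := N + 1) (M := N) (fun n hn => hNh n (by omega))
      (fun n hn => hNg' n (by omega)) hη hξ',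
    inner_eq_sum_pairing T hg hh' (N := N) (M := N + 1) (fun n hn => hNg n (by omega))
      (fun n hn => hNh' n (by omega)) hξ hη']
  have hzero : ∀ m, ∫ θ, pairing (T.Ψ m) (g' m θ) (T.Ψ 0) (h 0 θ) ∂μHE[4] = 0 := fun m => by
    simp [hact.1]
  have hzero' : ∀ n, ∫ θ, pairing (T.Ψ 0) (h' 0 θ) (T.Ψ n) (g n θ) ∂μHE[4] = 0 := fun n => by
    simp [hact'.1, pairing_apply]
  rw [Finset.sum_range_succ' _ N, Finset.sum_eq_zero fun n _ => hzero' n, add_zero]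
  refine Finset.sum_congr rfl fun m _ => ?_
  rw [Finset.sum_range_succ', hzero, add_zero]
  exact Finset.sum_congr rfl fun n _ => by simp only [hact.pairing_eq T hact']

theorem inner_eq_inner_of_mem_fieldGraph {f : Test K}
    {ξ ξ' : BigHilbert κe κm H × BigHilbert κe κm H} (hξ : ξ ∈ fieldGraph Λ T f)
    (hξ' : ξ' ∈ fieldGraph Λ T (starTest T.bar f)) : ⟪ξ'.1, ξ.2⟫_ℂ = ⟪ξ'.2, ξ.1⟫_ℂ := by
  induction hξ using Submodule.span_induction with
  | zero => simp
  | add x y _ _ hx hy => simp [inner_add_right, hx, hy]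
  | smul c x _ hx => simp [inner_smul_right, hx]
  | mem ξ hξ =>
    obtain ⟨g, h, hg, hh, hact, hξ₁, hξ₂⟩ := hξ
    induction hξ' using Submodule.span_induction with
    | zero => simp
    | add x y _ _ hx hy => simp [inner_add_left, hx, hy]
    | smul c x _ hx => simp [inner_smul_left, hx]
    | mem ξ' hξ' =>
      obtain ⟨g', h', hg', hh', hact', hξ₁', hξ₂'⟩ := hξ'
      exact IsAction.inner_eq T hg hh hact hg' hh' hact' hξ₁ hξ₂ hξ₁' hξ₂'

lemma map_fst_fieldGraph (hΛ : IsFrame κe κm Λ) (f : Test K) :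
    (fieldGraph Λ T f).map (LinearMap.fst ℂ (BigHilbert κe κm H) (BigHilbert κe κm H)) =
      bigDomain κe κm T := by
  rw [fieldGraph, Submodule.map_span, bigDomain]
  congr 1
  ext ξ
  constructor
  · rintro ⟨η, ⟨g, h, hg, -, -, hη, -⟩, rfl⟩
    exact ⟨g, hg, hη⟩
  · rintro ⟨g, hg, hξ⟩
    obtain ⟨h, hh, hact⟩ := (existsUnique_isAction hΛ f hg).exists
    exact ⟨(ξ, (memLp_bigPsi T hh).toLp _),
      ⟨g, h, hg, hh, hact, hξ, (memLp_bigPsi T hh).coeFn_toLp⟩, rfl⟩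

lemma field_domain (hΛ : IsFrame κe κm Λ) (f : Test K) :
    (field Λ T f).domain = bigDomain κe κm T := map_fst_fieldGraph T hΛ f

-- A relation with a densely defined formal adjoint is single-valued.
lemma fieldGraph_single_valued (hΛ : IsFrame κe κm Λ)
    (hd : Dense (bigDomain κe κm T : Set (BigHilbert κe κm H))) (f : Test K)
    (ξ : BigHilbert κe κm H × BigHilbert κe κm H) (hξ : ξ ∈ fieldGraph Λ T f)
    (hξ_fst : ξ.1 = 0) : ξ.2 = 0 := by
  refine hd.eq_zero_of_inner_right ℂ fun η (hη : η ∈ bigDomain κe κm T) => ?_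
  rw [← map_fst_fieldGraph T hΛ (starTest T.bar f)] at hη
  obtain ⟨ξ', hξ', rfl⟩ := hη
  exact (inner_eq_inner_of_mem_fieldGraph T hξ hξ').trans (by rw [hξ_fst, inner_zero_right])

lemma mem_fieldGraph (hΛ : IsFrame κe κm Λ)
    (hd : Dense (bigDomain κe κm T : Set (BigHilbert κe κm H))) (f : Test K)
    (ξ : (field Λ T f).domain) : ((ξ : BigHilbert κe κm H), field Λ T f ξ) ∈ fieldGraph Λ T f :=
  Submodule.mem_graph_toLinearPMap (fieldGraph_single_valued T hΛ hd f) ξ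

lemma field_mem (hΛ : IsFrame κe κm Λ)
    (hd : Dense (bigDomain κe κm T : Set (BigHilbert κe κm H))) (f : Test K)
    (ξ : (field Λ T f).domain) : field Λ T f ξ ∈ bigDomain κe κm T :=
  map_snd_fieldGraph_le T f ⟨_, mem_fieldGraph T hΛ hd f ξ, rfl⟩

theorem field_starTest_le_adjoint (hΛ : IsFrame κe κm Λ)
    (hd : Dense (bigDomain κe κm T : Set (BigHilbert κe κm H))) (f : Test K) :
    field Λ T (starTest T.bar f) ≤ (field Λ T f).adjoint := by
  refine LinearPMap.IsFormalAdjoint.le_adjoint ?_ fun ξ ξ' => ?_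
  · rw [field_domain T hΛ]
    exact hd
  · have hinner := inner_eq_inner_of_mem_fieldGraph T (mem_fieldGraph T hΛ hd f ξ)
      (mem_fieldGraph T hΛ hd (starTest T.bar f) ξ')
    rw [← inner_conj_symm]
    exact (congrArg (starRingEnd ℂ) hinner).trans (inner_conj_symm _ _)

lemma exists_eq_field (hΛ : IsFrame κe κm Λ)
    (hd : Dense (bigDomain κe κm T : Set (BigHilbert κe κm H))) {f : Test K}
    {g h : BigTest κe κm K} (hg : IsBigTest g) (hh : IsBigTest h) (hact : IsAction Λ f g h)
    {ξ η : BigHilbert κe κm H} (hξ : ξ =ᵐ[specMeasure κe κm] bigPsi T g)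
    (hη : η =ᵐ[specMeasure κe κm] bigPsi T h) :
    ∃ hdom : ξ ∈ (field Λ T f).domain, η = field Λ T f ⟨ξ, hdom⟩ := by
  have hmem : (ξ, η) ∈ fieldGraph Λ T f := Submodule.subset_span ⟨g, h, hg, hh, hact, hξ, hη⟩
  have hdom : ξ ∈ (field Λ T f).domain := ⟨_, hmem, rfl⟩
  have hsub := Submodule.sub_mem _ hmem (mem_fieldGraph T hΛ hd f ⟨ξ, hdom⟩)
  exact ⟨hdom, sub_eq_zero.1 (fieldGraph_single_valued T hΛ hd f _ hsub (sub_self _))⟩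

end Operators

/-! ### Density -/

section ClosedEmbedding

variable {X E H : Type*} [TopologicalSpace X] [MeasurableSpace X] [BorelSpace X]
  [NormedAddCommGroup E] [NormedSpace ℝ E] [FiniteDimensional ℝ E] [MeasurableSpace E]
  [BorelSpace E] [NormedAddCommGroup H] [NormedSpace ℝ H]

lemma ae_eq_zero_of_forall_integral_comp_smul_eq_zero [CompleteSpace H] {ι : X → E}
    (hι : Topology.IsClosedEmbedding ι) {μ : Measure X} {f : X → H} (hf : LocallyIntegrable f μ)
    (h : ∀ w : E → ℝ, ContDiff ℝ ∞ w → HasCompactSupport w → ∫ x, w (ι x) • f x ∂μ = 0) :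
    f =ᵐ[μ] 0 := by
  have hmeas := hι.measurableEmbedding
  have hext (x : X) : Function.extend ι f 0 (ι x) = f x := hι.injective.extend_apply _ _ x
  have hlocint : LocallyIntegrable (Function.extend ι f 0) (μ.map ι) := by
    refine locallyIntegrable_iff.2 fun C hC => hmeas.integrableOn_map_iff.2 ?_
    simp only [Function.comp_def, hext]
    exact hf.integrableOn_isCompact (hι.isCompact_preimage hC)
  have hzero : ∀ᵐ y ∂μ.map ι, Function.extend ι f 0 y = 0 :=
    ae_eq_zero_of_integral_contDiff_smul_eq_zero hlocint fun w hw hwc => by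
      rw [hmeas.integral_map]
      simp only [hext]
      exact h w hw hwc
  rw [hmeas.ae_map_iff] at hzero
  filter_upwards [hzero] with x hx
  rw [← hext x, hx, Pi.zero_apply]

end ClosedEmbedding

section Density

variable {κe κm : ℝ} {K : ℕ}

lemma isClosed_spec : IsClosed (Spec κe κm) := by
  have hmat (i j : Fin 4) : Continuous fun θ : MatSpace => toMat θ i j := by
    simp only [toMat, Matrix.of_apply]
    fun_prop
  have hraise (i j : Fin 4) : Continuous fun θ : MatSpace => raise (toMat θ) i j :=
    (continuous_const.mul (hmat i j)).mul continuous_const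
  refine IsClosed.and ?_ (IsClosed.and ?_ ?_)
  · refine isClosed_eq ?_ ?_
    · exact continuous_pi fun i => continuous_pi fun j => hmat j i
    · exact continuous_pi fun i => continuous_pi fun j => (hmat i j).neg
  · refine isClosed_eq ?_ continuous_const
    exact continuous_finsetSum _ fun i _ =>
      continuous_finsetSum _ fun j _ => (hmat i j).mul (hraise i j)
  · refine isClosed_eq ?_ continuous_const
    exact continuous_finsetSum _ fun τ _ =>
      continuous_const.mul ((hraise _ _).mul (hraise _ _))

/-- The inclusion of `ℝ² × Σ` into `ℝ² × ℝ¹⁶`. -/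
def specInclusion (z : Plane × Spec κe κm) : Plane × MatSpace := (z.1, z.2)

lemma isClosedEmbedding_specInclusion :
    Topology.IsClosedEmbedding (specInclusion (κe := κe) (κm := κm)) :=
  Topology.IsClosedEmbedding.id.prodMap isClosed_spec.isClosedEmbedding_subtypeVal

lemma IsBigTest.single {n : ℕ}
    {G : Spec κe κm → 𝓢(Plane × (Fin n → Mink), (Fin n → Fin K) → ℂ)}
    (hmeas : ∀ z, Measurable fun θ => G θ z)
    (hbdd : ∀ a b : ℕ, ∃ B, ∀ θ, SchwartzMap.seminorm ℝ a b (G θ) ≤ B)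
    (hsupp : ∃ C : Set (Spec κe κm), IsCompact C ∧ ∀ θ, θ ∉ C → G θ = 0) :
    IsBigTest (Pi.single n G : BigTest κe κm K) where
  terminating := ⟨n + 1, fun m hm => by
    rw [Pi.single_eq_of_ne (Nat.lt_of_succ_le hm).ne']⟩
  measurable m := by
    rcases eq_or_ne m n with rfl | hm
    · simpa only [Pi.single_eq_same] using hmeas
    · simp only [Pi.single_eq_of_ne hm]
      exact fun _ => measurable_const
  bounded m := by
    rcases eq_or_ne m n with rfl | hm
    · simpa only [Pi.single_eq_same] using hbdd
    · simpa only [Pi.single_eq_of_ne hm] using fun a b => ⟨0, fun θ => (map_zero _).le⟩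
  support m := by
    rcases eq_or_ne m n with rfl | hm
    · simpa only [Pi.single_eq_same] using hsupp
    · simpa only [Pi.single_eq_of_ne hm] using ⟨∅, isCompact_empty, fun θ _ => rfl⟩

theorem exists_isBigTest_slice_eq_smul {v : Plane × Spec κe κm → ℂ} (hv : IsSmoothCompact v)
    (n : ℕ) (F : TestN K n) : ∃ g : BigTest κe κm K, IsBigTest g ∧ (∀ m, m ≠ n → g m = 0) ∧
      ∀ s θ, slice s (g n θ) = v (s, θ) • F := by
  obtain ⟨V, hV, hVc, hvV⟩ := hv
  have hVswap : HasCompactSupport fun z : MatSpace × Plane => V (z.2, z.1) :=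
    hVc.comp_homeomorph (Homeomorph.prodComm MatSpace Plane)
  let VS : 𝓢(MatSpace × Plane, ℂ) := hVswap.toSchwartzMap (by fun_prop)
  let A : 𝓢(Plane, ℂ) →L[ℂ] 𝓢(Plane × (Fin n → Mink), (Fin n → Fin K) → ℂ) :=
    swapCLM.comp (tensorCLM (ContinuousLinearMap.lsmul ℂ ℂ).flip F)
  let G (θ : Spec κe κm) : 𝓢(Plane × (Fin n → Mink), (Fin n → Fin K) → ℂ) :=
    A (sliceCLM (θ : MatSpace) VS)
  have hG (θ s x) : G θ (s, x) = V (s, θ) • F x := rfl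
  have hcont (z) : Continuous fun θ => G θ z := by
    have := hV.continuous
    change Continuous fun θ : Spec κe κm => V (z.1, θ) • F z.2
    fun_prop
  have hsupp : ∃ C : Set (Spec κe κm), IsCompact C ∧ ∀ θ, θ ∉ C → G θ = 0 := by
    refine ⟨Subtype.val ⁻¹' (Prod.snd '' tsupport V),
      isClosed_spec.isClosedEmbedding_subtypeVal.isCompact_preimage (hVc.image continuous_snd),
      fun θ hθ => SchwartzMap.ext fun z => ?_⟩
    change V (z.1, θ) • F z.2 = 0
    rw [image_eq_zero_of_notMem_tsupport fun h => hθ ⟨_, h, rfl⟩, zero_smul]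
  refine ⟨Pi.single n G, .single (fun z => (hcont z).measurable)
    (exists_forall_seminorm_map_le A fun a b => ⟨_, fun θ => seminorm_sliceCLM_le VS a b θ⟩) hsupp,
    fun m hm => by rw [Pi.single_eq_of_ne hm], fun s θ => ?_⟩
  ext x : 1
  rw [slice_apply, Pi.single_eq_same, hG, ← hvV]
  rfl

variable {H : Type*} [NormedAddCommGroup H] [InnerProductSpace ℂ H] (T : Theory K H)

lemma bigPsi_eq_smul {v : Plane × Spec κe κm → ℂ} {n : ℕ} {F : TestN K n} {g : BigTest κe κm K}
    (hg₀ : ∀ m, m ≠ n → g m = 0) (hg : ∀ s θ, slice s (g n θ) = v (s, θ) • F) :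
    bigPsi T g = fun z => v z • T.Ψ n F := by
  funext z
  rw [bigPsi, finsum_eq_single _ n fun m hm => by simp [hg₀ m hm], hg, map_smul]

lemma smoothDomain_le : smoothDomain κe κm T ≤ bigDomain κe κm T := by
  refine Submodule.span_mono ?_
  rintro ξ ⟨v, hv, n, F, hξ⟩
  obtain ⟨g, hg, hg₀, hgn⟩ := exists_isBigTest_slice_eq_smul hv n F
  exact ⟨g, hg, by rwa [bigPsi_eq_smul T hg₀ hgn]⟩

lemma Theory.eq_zero_of_forall_inner_Ψ {x : H} (h : ∀ n F, ⟪T.Ψ n F, x⟫_ℂ = 0) : x = 0 := by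
  have hD : T.D ≤ (ℂ ∙ x)ᗮ := by
    rw [T.D_eq, Submodule.span_le]
    rintro _ ⟨n, F, rfl⟩
    exact Submodule.mem_orthogonal_singleton_iff_inner_left.2 (h n F)
  exact T.D_dense.eq_zero_of_inner_right ℂ fun η hη =>
    Submodule.mem_orthogonal_singleton_iff_inner_left.1 (hD hη)

variable [CompleteSpace H] [IsLocallyFiniteMeasure (μHE[4] : Measure (Spec κe κm))]

lemma memLp_smul_Ψ {v : Plane × Spec κe κm → ℂ} (hv : IsSmoothCompact v) (n : ℕ)
    (F : TestN K n) : MemLp (fun z => v z • T.Ψ n F) 2 (specMeasure κe κm) := by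
  obtain ⟨g, hg, hg₀, hgn⟩ := exists_isBigTest_slice_eq_smul hv n F
  rw [← bigPsi_eq_smul T hg₀ hgn]
  exact memLp_bigPsi T hg

instance isLocallyFiniteMeasure_specMeasure : IsLocallyFiniteMeasure (specMeasure κe κm) := by
  unfold specMeasure
  infer_instance

lemma integral_smul_inner_Ψ {ξ : BigHilbert κe κm H} (hξ : ξ ∈ (smoothDomain κe κm T)ᗮ)
    {w : Plane × MatSpace → ℝ} (hw : ContDiff ℝ ∞ w) (hwc : HasCompactSupport w) (n : ℕ)
    (F : TestN K n) : ∫ z, ⟪T.Ψ n F, w (specInclusion z) • ξ z⟫_ℂ ∂specMeasure κe κm = 0 := by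
  have hv : IsSmoothCompact (κe := κe) (κm := κm) fun z => ((w (specInclusion z) : ℝ) : ℂ) :=
    ⟨fun z => (w z : ℂ), Complex.ofRealCLM.contDiff.comp hw,
      hwc.comp_left Complex.ofReal_zero, fun s θ => rfl⟩
  have hm := memLp_smul_Ψ T hv n F
  have horth := hξ (hm.toLp _) (Submodule.subset_span ⟨_, hv, n, F, hm.coeFn_toLp⟩)
  rw [L2.inner_def] at horth
  rw [← horth]
  refine integral_congr_ae ?_
  filter_upwards [hm.coeFn_toLp] with z hz
  rw [hz, inner_smul_left, Complex.conj_ofReal, ← inner_smul_right]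
  rfl

theorem dense_smoothDomain : Dense (smoothDomain κe κm T : Set (BigHilbert κe κm H)) := by
  rw [Submodule.dense_iff_topologicalClosure_eq_top, Submodule.topologicalClosure_eq_top_iff,
    Submodule.eq_bot_iff]
  intro ξ hξ
  have hι := isClosedEmbedding_specInclusion (κe := κe) (κm := κm)
  have hlocint : LocallyIntegrable ξ (specMeasure κe κm) :=
    (Lp.memLp ξ).locallyIntegrable (by norm_num)
  refine Lp.eq_zero_iff_ae_eq_zero.2 <|
    ae_eq_zero_of_forall_integral_comp_smul_eq_zero hι hlocint fun w hw hwc =>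
      T.eq_zero_of_forall_inner_Ψ fun n F => ?_
  have hint : Integrable (fun z => w (specInclusion z) • ξ z) (specMeasure κe κm) :=
    hlocint.integrable_smul_left_of_hasCompactSupport
      (hw.continuous.comp hι.continuous) (hwc.comp_isClosedEmbedding hι)
  rw [← integral_inner hint]
  exact integral_smul_inner_Ψ T hξ hw hwc n F

lemma dense_bigDomain : Dense (bigDomain κe κm T : Set (BigHilbert κe κm H)) :=
  (dense_smoothDomain T).mono (smoothDomain_le T)

end Density

/-! ### Translations and multipliers in the total momentum -/

lemma mdot_zero_left (x : Mink) : mdot 0 x = 0 := by simp [mdot]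

lemma mdot_add_right (p x y : Mink) : mdot p (x + y) = mdot p x + mdot p y := by
  simp only [mdot, ← Finset.sum_add_distrib]
  exact Finset.sum_congr rfl fun μ _ => by simp; ring

lemma mdot_sum_left {n : ℕ} (p : Fin n → Mink) (y : Mink) :
    mdot (∑ j, p j) y = ∑ j, mdot (p j) y := by
  simp only [mdot]
  rw [Finset.sum_comm]
  refine Finset.sum_congr rfl fun μ _ => ?_
  rw [WithLp.ofLp_sum, Finset.sum_apply, Finset.mul_sum, Finset.sum_mul]

section TranslationAverage

variable {n : ℕ} {V : Type} [NormedAddCommGroup V] [NormedSpace ℂ V]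

/-- The map `(y, x) ↦ (y, x₁ - y, …, xₙ - y)`. -/
def translateCLE (n : ℕ) : (Mink × (Fin n → Mink)) ≃L[ℝ] Mink × (Fin n → Mink) :=
  LinearEquiv.toContinuousLinearEquiv
    { toFun := fun z => (z.1, z.2 - fun _ => z.1)
      map_add' := fun z w => by ext <;> simp; ring
      map_smul' := fun c z => by ext <;> simp; ring
      invFun := fun z => (z.1, z.2 + fun _ => z.1)
      left_inv := fun z => by simp
      right_inv := fun z => by simp }

/-- The average `∫ dy c(y) F(x₁ - y, …, xₙ - y)` over translations. -/
def translationAverage (c : 𝓢(Mink, ℂ)) (F : 𝓢(Fin n → Mink, V)) : 𝓢(Fin n → Mink, V) :=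
  integrateCLM (SchwartzMap.compCLMOfContinuousLinearEquiv ℂ (translateCLE n) (smulTensor c F))

lemma fourierNCLM_compSubConstCLM (F : 𝓢(Fin n → Mink, V)) (y : Mink) (p : Fin n → Mink) :
    fourierNCLM n (SchwartzMap.compSubConstCLM ℂ (fun _ => y) F) p =
      Complex.exp (-Complex.I * (mdot (∑ j, p j) y : ℝ)) • fourierNCLM n F p := by
  rw [fourierNCLM_apply, fourierNCLM_apply, smul_comm (Complex.exp _)]
  congr 1
  rw [← integral_smul]
  rw [← integral_add_right_eq_self (fun x : Fin n → Mink =>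
    Complex.exp (-Complex.I * (∑ j, mdot (p j) (x j) : ℝ)) •
      SchwartzMap.compSubConstCLM ℂ (fun _ => y) F x) (fun _ : Fin n => y)]
  refine integral_congr_ae (.of_forall fun x => ?_)
  simp only [SchwartzMap.compSubConstCLM_apply, add_sub_cancel_right, Pi.add_apply, mdot_add_right,
    smul_smul, ← Complex.exp_add, mdot_sum_left, Finset.sum_add_distrib]
  congr 2
  push_cast
  ring

variable [CompleteSpace V]

lemma map_translationAverage {H : Type*} [NormedAddCommGroup H] [NormedSpace ℂ H]
    [CompleteSpace H] (W : 𝓢(Fin n → Mink, V) →L[ℂ] H) (c : 𝓢(Mink, ℂ))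
    (F : 𝓢(Fin n → Mink, V)) : W (translationAverage c F) =
      ∫ y, c y • W (SchwartzMap.compSubConstCLM ℂ (fun _ => y) F) := by
  rw [translationAverage, map_integrateCLM]
  refine integral_congr_ae (.of_forall fun y => ?_)
  simp only
  rw [← map_smul]
  rfl

lemma map_translationAverage_eq_smul {H : Type*} [NormedAddCommGroup H] [NormedSpace ℂ H]
    [CompleteSpace H] (W : 𝓢(Fin n → Mink, V) →L[ℂ] H) (c : 𝓢(Mink, ℂ))
    {F : 𝓢(Fin n → Mink, V)} {q : Mink}
    (hW : ∀ y, W (SchwartzMap.compSubConstCLM ℂ (fun _ => y) F) =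
      Complex.exp (-Complex.I * (mdot q y : ℝ)) • W F) :
    W (translationAverage c F) = (((2 * Real.pi) ^ 2 : ℝ) * fourierCLM c q : ℂ) • W F := by
  have hc : (((2 * Real.pi) ^ 2 : ℝ) * fourierCLM c q : ℂ) =
      ∫ y, Complex.exp (-Complex.I * (mdot q y : ℝ)) • c y := by
    rw [fourierCLM_apply, smul_eq_mul, ← mul_assoc, ← Complex.ofReal_mul,
      mul_inv_cancel₀ (by positivity), Complex.ofReal_one, one_mul]
  rw [map_translationAverage, hc, ← integral_smul_const]
  refine integral_congr_ae (.of_forall fun y => ?_)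
  simp only [hW, smul_smul, smul_eq_mul, mul_comm]

lemma fourierNCLM_translationAverage (c : 𝓢(Mink, ℂ)) (F : 𝓢(Fin n → Mink, V))
    (p : Fin n → Mink) : fourierNCLM n (translationAverage c F) p =
      (((2 * Real.pi) ^ 2 : ℝ) * fourierCLM c (∑ j, p j) : ℂ) • fourierNCLM n F p :=
  map_translationAverage_eq_smul ((evalCLM p).comp (fourierNCLM n)) c
    fun y => fourierNCLM_compSubConstCLM F y p

end TranslationAverage

namespace Theory

variable {n K : ℕ} {H : Type*} [NormedAddCommGroup H] [InnerProductSpace ℂ H]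
  [CompleteSpace H] (T : Theory K H)

lemma npoint_translationAverage (c : 𝓢(Mink, ℂ)) (F : TestN K n) :
    T.npoint n (translationAverage c F) =
      ((2 * Real.pi) ^ 2 : ℝ) * fourierCLM c 0 * T.npoint n F :=
  map_translationAverage_eq_smul ((innerSL ℂ T.Ω).comp (T.Ψ n)) c fun y =>
    (T.npoint_translate y F).trans (by simp [mdot_zero_left, npoint])

/-- By translation invariance, the `n`-point functions are supported at total momentum zero: cutting
off the total momentum with `χ` turns both sides into averages over translations. -/
theorem npoint_eq_of_fourierN_eq (F G : TestN K n) {m : Mink → ℂ}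
    (hm : m.HasTemperateGrowth) (h : ∀ p k, fourierN G p k = m (∑ j, p j) * fourierN F p k) :
    T.npoint n G = m 0 * T.npoint n F := by
  obtain ⟨χ, hχ⟩ := exists_schwartz_eq_one Mink 0
  have hχ₀ : χ 0 = 1 := hχ 0 (by simp)
  have haverage : translationAverage (invFourierCLM χ) G =
      translationAverage (invFourierCLM (SchwartzMap.smulLeftCLM ℂ m χ)) F := by
    refine fourierN_injective fun p k => ?_
    have hpk := h p k
    rw [fourierN_eq, fourierN_eq] at hpk
    rw [fourierN_eq, fourierN_eq, fourierNCLM_translationAverage, fourierNCLM_translationAverage,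
      fourierCLM_invFourierCLM, fourierCLM_invFourierCLM,
      SchwartzMap.smulLeftCLM_apply_apply hm, Pi.smul_apply, Pi.smul_apply, hpk]
    simp only [smul_eq_mul]
    ring
  have hnpoint := congrArg (T.npoint n) haverage
  rw [npoint_translationAverage, npoint_translationAverage, fourierCLM_invFourierCLM,
    fourierCLM_invFourierCLM, SchwartzMap.smulLeftCLM_apply_apply hm, hχ₀, smul_eq_mul, mul_one,
    mul_one, mul_assoc] at hnpoint
  have hpi : (((2 * Real.pi) ^ 2 : ℝ) : ℂ) ≠ 0 := by
    exact_mod_cast (by positivity : (2 * Real.pi) ^ 2 ≠ 0)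
  exact mul_left_cancel₀ hpi hnpoint

end Theory

/-! ### Products of Weyl operators -/

section Weyl

variable {κe κm : ℝ} {L θ : Matrix (Fin 4) (Fin 4) ℝ}

lemma coeff_add (L : Matrix (Fin 4) (Fin 4) ℝ) (p q : Mink) (ν : Fin 4) :
    coeff L (p + q) ν = coeff L p ν + coeff L q ν := by
  simp only [coeff, ← Finset.sum_add_distrib]
  exact Finset.sum_congr rfl fun μ _ => by simp; ring

lemma shift_add (p q : Mink) : shift κe κm L (p + q) = shift κe κm L p + shift κe κm L q := by
  ext i
  fin_cases i <;> simp [shift, coeff_add] <;> ring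

lemma twist_eq_coeff (h : L * thetaRef κe κm * L.transpose = θ) (p q : Mink) :
    twist θ p q = κe * (coeff L p 0 * coeff L q 1 - coeff L p 1 * coeff L q 0) +
      κm * (coeff L p 2 * coeff L q 3 - coeff L p 3 * coeff L q 2) := by
  subst h
  simp only [twist, coeff, Matrix.mul_apply, Matrix.transpose_apply, thetaRef, Fin.sum_univ_four]
  simp
  ring

lemma weylPhase_add_weylPhase (h : L * thetaRef κe κm * L.transpose = θ) (p q : Mink) (s : Plane) :
    weylPhase κe κm L p s + weylPhase κe κm L q (s + shift κe κm L p) =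
      weylPhase κe κm L (p + q) s - twist θ p q / 2 := by
  rw [twist_eq_coeff h]
  simp only [weylPhase, coeff_add, shift]
  simp
  ring

lemma weyl_zero_momentum (κe κm : ℝ) (L : Matrix (Fin 4) (Fin 4) ℝ) (w : Plane → ℂ) (s : Plane) :
    weyl κe κm L 0 w s = w s := by
  simpa only [zero_smul] using congrFun (weyl_zero κe κm L 0 w) s

lemma weyl_const_mul_weyl (h : L * thetaRef κe κm * L.transpose = θ) (p q : Mink)
    (w : Plane → ℂ) (c : ℂ) (s : Plane) :
    weyl κe κm L p (fun s' => c * weyl κe κm L q w s') s =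
      c * Complex.exp (-(Complex.I / 2) * (twist θ p q : ℝ)) * weyl κe κm L (p + q) w s := by
  have hphase : Complex.exp (Complex.I * (weylPhase κe κm L p s : ℂ)) *
      Complex.exp (Complex.I * (weylPhase κe κm L q (s + shift κe κm L p) : ℂ)) =
      Complex.exp (-(Complex.I / 2) * (twist θ p q : ℝ)) *
        Complex.exp (Complex.I * (weylPhase κe κm L (p + q) s : ℂ)) := by
    rw [← Complex.exp_add, ← Complex.exp_add, ← mul_add, ← Complex.ofReal_add,
      weylPhase_add_weylPhase h]
    congr 1
    push_cast
    ring
  rw [weyl_eq, weyl_eq, weyl_eq, shift_add, ← add_assoc]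
  linear_combination c * w (s + shift κe κm L p + shift κe κm L q) * hphase

lemma twist_sum_right {n : ℕ} (θ : Matrix (Fin 4) (Fin 4) ℝ) (p : Mink) (q : Fin n → Mink) :
    twist θ p (∑ j, q j) = ∑ j, twist θ p (q j) := by
  refine map_sum (AddMonoidHom.mk' (twist θ p) fun q q' => ?_) q Finset.univ
  simp only [twist, ← Finset.sum_add_distrib]
  exact Finset.sum_congr rfl fun μ _ => Finset.sum_congr rfl fun ν _ => by simp; ring

/-- The factor by which the product of the Weyl operators with momenta `p₁, …, pₙ` differs from
the Weyl operator with momentum `p₁ + ⋯ + pₙ`. -/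
def twistFactor (θ : Matrix (Fin 4) (Fin 4) ℝ) {n : ℕ} (p : Fin n → Mink) : ℂ :=
  ∏ l, ∏ r ∈ Finset.Ioi l, Complex.exp (-(Complex.I / 2) * (twist θ (p l) (p r) : ℝ))

lemma twistFactor_succ (θ : Matrix (Fin 4) (Fin 4) ℝ) {n : ℕ} (p : Fin (n + 1) → Mink) :
    twistFactor θ p = Complex.exp (-(Complex.I / 2) * (twist θ (p 0) (∑ j, Fin.tail p j) : ℝ)) *
      twistFactor θ (Fin.tail p) := by
  rw [twistFactor, Fin.prod_univ_succ, twistFactor]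
  congr 1
  · rw [Fin.prod_Ioi_zero, ← Complex.exp_sum, twist_sum_right, ← Finset.mul_sum]
    push_cast
    rfl
  · exact Finset.prod_congr rfl fun l _ => Fin.prod_Ioi_succ _ l

lemma twistFactor_eq_cexp (θ : Matrix (Fin 4) (Fin 4) ℝ) {n : ℕ} (p : Fin n → Mink) :
    twistFactor θ p = Complex.exp
      (Complex.I * ((∑ l, ∑ r ∈ Finset.Ioi l, -(1 / 2) * twist θ (p l) (p r) : ℝ) : ℂ)) := by
  simp only [twistFactor, ← Complex.exp_sum]
  congr 1
  push_cast
  simp only [Finset.mul_sum]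
  exact Finset.sum_congr rfl fun l _ => Finset.sum_congr rfl fun r _ => by ring

lemma hasTemperateGrowth_twist {D : Type*} [NormedAddCommGroup D] [NormedSpace ℝ D]
    (θ : Matrix (Fin 4) (Fin 4) ℝ) {f g : D → Mink} (hf : f.HasTemperateGrowth)
    (hg : g.HasTemperateGrowth) : (fun x => twist θ (f x) (g x)).HasTemperateGrowth := by
  unfold twist
  fun_prop

lemma hasTemperateGrowth_twistFactor (θ : Matrix (Fin 4) (Fin 4) ℝ) (n : ℕ) :
    (fun p : Fin n → Mink => twistFactor θ p).HasTemperateGrowth := by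
  have hproj (j : Fin n) : (fun p : Fin n → Mink => p j).HasTemperateGrowth :=
    (ContinuousLinearMap.proj (R := ℝ) (φ := fun _ : Fin n => Mink) j).hasTemperateGrowth
  have hphase : (fun p : Fin n → Mink =>
      ∑ l, ∑ r ∈ Finset.Ioi l, -(1 / 2) * twist θ (p l) (p r)).HasTemperateGrowth :=
    .sum fun l _ => .sum fun r _ =>
      (Function.HasTemperateGrowth.const _).mul (hasTemperateGrowth_twist θ (hproj l) (hproj r))
  simp only [twistFactor_eq_cexp]
  exact hasTemperateGrowth_cexp_I_mul hphase

lemma exists_isTwistedProduct {K n : ℕ} (θ : Matrix (Fin 4) (Fin 4) ℝ) (f : Fin n → Test K) :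
    ∃ F : TestN K n, IsTwistedProduct θ f F := by
  obtain ⟨F₀, hF₀⟩ := exists_isTensor fun j => fourierCLM (f j)
  refine ⟨invFourierNCLM n (SchwartzMap.smulLeftCLM _ (fun p => twistFactor θ p) F₀),
    fun p k => ?_⟩
  rw [fourierN_eq, fourierNCLM_invFourierNCLM,
    SchwartzMap.smulLeftCLM_apply_apply (hasTemperateGrowth_twistFactor θ n), Pi.smul_apply, hF₀,
    smul_eq_mul, mul_comm]
  simp only [fourier_eq, twistFactor]

end Weyl

/-! ### Products of the deformed fields -/

section Products

variable {κe κm : ℝ} {K : ℕ} {Λ : Spec κe κm → Matrix (Fin 4) (Fin 4) ℝ}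

lemma IsAction.eq_zero {f : Test K} {g h : BigTest κe κm K} (hh : IsAction Λ f g h) {n : ℕ}
    (hg : g n = 0) : h (n + 1) = 0 := by
  funext θ
  refine eq_of_forall_slice_eq fun s => fourierN_injective fun p k => ?_
  rw [hh.2, hg]
  simp [fourierN_zero, weyl_const_zero]

lemma fourierN_fin_zero (F : TestN K 0) (p : Fin 0 → Mink) (k : Fin 0 → Fin K) :
    fourierN F p k = F 0 k := by
  have hvol : (volume : Measure (Fin 0 → Mink)).real Set.univ = 1 := by
    simp [Measure.real, volume_pi]
  have hF (x : Fin 0 → Mink) : F x k = F 0 k := by rw [Subsingleton.elim x 0]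
  rw [fourierN, integral_unique, hvol, hF]
  simp

/-- `g = f₁ × (f₂ × ⋯ (fₙ × v))`, written out in momentum space with the help of the Weyl
relations; `v` is regarded as an element of degree zero. -/
structure IsIteratedAction (Λ : Spec κe κm → Matrix (Fin 4) (Fin 4) ℝ)
    (v : Plane × Spec κe κm → ℂ) {n : ℕ} (f : Fin n → Test K) (g : BigTest κe κm K) : Prop where
  isBigTest : IsBigTest g
  eq_zero : ∀ m, m ≠ n → g m = 0
  fourierN_slice : ∀ s θ p k, fourierN (slice s (g n θ)) p k =
    (∏ j, fourier (f j) (p j) (k j)) * twistFactor (toMat θ) p *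
      weyl κe κm (Λ θ) (∑ j, p j) (fun s' => v (s', θ)) s

namespace IsIteratedAction

variable {v : Plane × Spec κe κm → ℂ}

lemma zero {g : BigTest κe κm K} (hg : IsBigTest g) (hg₀ : ∀ m, m ≠ 0 → g m = 0)
    (hgv : ∀ s θ, slice s (g 0 θ) = v (s, θ) • constZero fun _ => 1) (f : Fin 0 → Test K) :
    IsIteratedAction Λ v f g where
  isBigTest := hg
  eq_zero := hg₀
  fourierN_slice s θ p k := by
    rw [fourierN_fin_zero, hgv]
    simp [constZero_apply, twistFactor, weyl_zero_momentum]

lemma cons (hΛ : IsFrame κe κm Λ) {n : ℕ} {f : Fin (n + 1) → Test K} {g h : BigTest κe κm K}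
    (hg : IsIteratedAction Λ v (Fin.tail f) g) (hh : IsBigTest h)
    (hact : IsAction Λ (f 0) g h) : IsIteratedAction Λ v f h where
  isBigTest := hh
  eq_zero m hm := by
    cases m with
    | zero => exact hact.1
    | succ m => exact hact.eq_zero (hg.eq_zero m (by omega))
  fourierN_slice s θ p k := by
    rw [hact.2]
    simp only [hg.fourierN_slice]
    rw [weyl_const_mul_weyl (hΛ.conj θ), Fin.prod_univ_succ, twistFactor_succ, Fin.sum_univ_succ]
    simp only [Fin.tail]
    ring

end IsIteratedAction

lemma hasTemperateGrowth_weyl (κe κm : ℝ) (ℓ : MatSpace) (u : 𝓢(Plane, ℂ)) (s : Plane) :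
    (fun p => weyl κe κm (toMat ℓ) p u s).HasTemperateGrowth := by
  simp only [weyl_eq]
  refine (hasTemperateGrowth_cexp_I_mul (hasTemperateGrowth_weylPhase κe κm
    (f := fun _ => ℓ) (by fun_prop) (by fun_prop) (by fun_prop))).mul
    (u.hasTemperateGrowth.comp ((Function.HasTemperateGrowth.const s).add
      (hasTemperateGrowth_shift κe κm (f := fun _ => ℓ) (g := fun p => p)
        (by fun_prop) (by fun_prop))))

lemma IsSmoothCompact.exists_schwartz_eq {v : Plane × Spec κe κm → ℂ} (hv : IsSmoothCompact v)
    (θ : Spec κe κm) : ∃ u : 𝓢(Plane, ℂ), ∀ s, u s = v (s, θ) := by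
  obtain ⟨V, hV, hVc, hvV⟩ := hv
  exact ⟨sliceCLM (θ : MatSpace) (swapCLM (hVc.toSchwartzMap hV)), fun s => (hvV s θ).symm⟩

variable {H : Type*} [NormedAddCommGroup H] [InnerProductSpace ℂ H] (T : Theory K H)

lemma exists_isIteratedAction_vacuum {v : Plane × Spec κe κm → ℂ} (hv : IsSmoothCompact v) :
    ∃ g : BigTest κe κm K, (∀ f : Fin 0 → Test K, IsIteratedAction Λ v f g) ∧
      bigPsi T g = fun z => v z • T.Ω := by
  obtain ⟨g, hg, hg₀, hgv⟩ := exists_isBigTest_slice_eq_smul (K := K) hv 0 (constZero fun _ => 1)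
  refine ⟨g, .zero hg hg₀ hgv, ?_⟩
  rw [bigPsi_eq_smul T hg₀ hgv, T.Ψ_zero, constZero_apply, one_smul]

variable [CompleteSpace H]

lemma IsIteratedAction.npoint_slice {v : Plane × Spec κe κm → ℂ} (hv : IsSmoothCompact v) {n : ℕ}
    {f : Fin n → Test K} {g : BigTest κe κm K} (hg : IsIteratedAction Λ v f g) {θ : Spec κe κm}
    {F : TestN K n} (hF : IsTwistedProduct (toMat θ) f F) (s : Plane) :
    T.npoint n (slice s (g n θ)) = v (s, θ) * T.npoint n F := by
  obtain ⟨u, hu⟩ := hv.exists_schwartz_eq θ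
  have hm := hasTemperateGrowth_weyl κe κm (ofMat (Λ θ)) u s
  have hslice : T.npoint n (slice s (g n θ)) = weyl κe κm (Λ θ) 0 u s * T.npoint n F := by
    refine T.npoint_eq_of_fourierN_eq F _ hm fun p k => ?_
    rw [hg.fourierN_slice, hF, mul_comm]
    simp only [← hu]
    rfl
  rw [hslice, weyl_zero_momentum, hu]

lemma IsIteratedAction.inner_bigPsi {v : Plane × Spec κe κm → ℂ} (hv : IsSmoothCompact v) {n : ℕ}
    {f : Fin n → Test K} {g : BigTest κe κm K} (hg : IsIteratedAction Λ v f g) {θ : Spec κe κm}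
    {F : TestN K n} (hF : IsTwistedProduct (toMat θ) f F) (s : Plane) :
    ⟪v (s, θ) • T.Ω, bigPsi T g (s, θ)⟫_ℂ = T.npoint n F * (‖v (s, θ)‖ ^ 2 : ℝ) := by
  have hbigPsi : bigPsi T g (s, θ) = T.Ψ n (slice s (g n θ)) :=
    finsum_eq_single _ n fun m hm => by simp [hg.eq_zero m hm]
  calc ⟪v (s, θ) • T.Ω, bigPsi T g (s, θ)⟫_ℂ
      = (starRingEnd ℂ) (v (s, θ)) * T.npoint n (slice s (g n θ)) := by
        rw [hbigPsi, inner_smul_left, Theory.npoint]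
    _ = (v (s, θ) * (starRingEnd ℂ) (v (s, θ))) * T.npoint n F := by
        rw [hg.npoint_slice T hv hF]
        ring
    _ = T.npoint n F * (‖v (s, θ)‖ ^ 2 : ℝ) := by
        rw [Complex.mul_conj, Complex.normSq_eq_norm_sq, mul_comm]

variable [IsLocallyFiniteMeasure (μHE[4] : Measure (Spec κe κm))]

theorem exists_isFieldProduct (hΛ : IsFrame κe κm Λ) {v : Plane × Spec κe κm → ℂ}
    {g : BigTest κe κm K} (hg : ∀ f : Fin 0 → Test K, IsIteratedAction Λ v f g)
    {ξ : BigHilbert κe κm H} (hξ : ξ =ᵐ[specMeasure κe κm] bigPsi T g) {n : ℕ}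
    (f : Fin n → Test K) :
    ∃ (h : BigTest κe κm K) (ζ : BigHilbert κe κm H), IsIteratedAction Λ v f h ∧
      ζ =ᵐ[specMeasure κe κm] bigPsi T h ∧ IsFieldProduct Λ T (List.ofFn f) ξ ζ := by
  induction n with
  | zero => exact ⟨g, ξ, hg f, hξ, rfl⟩
  | succ n ih =>
    obtain ⟨h, ζ, hh, hζ, hprod⟩ := ih (Fin.tail f)
    obtain ⟨h', hh', hact⟩ := (existsUnique_isAction hΛ (f 0) hh.isBigTest).exists
    have hmem := memLp_bigPsi T hh'
    obtain ⟨hdom, hfield⟩ := exists_eq_field T hΛ (dense_bigDomain T) hh.isBigTest hh' hact hζ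
      hmem.coeFn_toLp
    refine ⟨h', hmem.toLp _, hh.cons hΛ hh' hact, hmem.coeFn_toLp, ?_⟩
    rw [List.ofFn_succ]
    exact ⟨ζ, hprod, hdom, hfield⟩

theorem exists_expectation (hΛ : IsFrame κe κm Λ) {v : Plane × Spec κe κm → ℂ}
    (hv : IsSmoothCompact v) : ∃ hvΩ : MemLp (fun z => v z • T.Ω) 2 (specMeasure κe κm),
        ∀ (n : ℕ) (f : Fin n → Test K),
          ∃ (ζ : BigHilbert κe κm H) (F : Spec κe κm → TestN K n),
            IsFieldProduct Λ T (List.ofFn f) (hvΩ.toLp _) ζ ∧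
            (∀ θ : Spec κe κm, IsTwistedProduct (toMat θ) f (F θ)) ∧
            Integrable (fun z => T.npoint n (F z.2) * (‖v z‖ ^ 2 : ℝ)) (specMeasure κe κm) ∧
            inner ℂ (hvΩ.toLp _) ζ =
              ∫ z, T.npoint n (F z.2) * (‖v z‖ ^ 2 : ℝ) ∂(specMeasure κe κm) := by
  obtain ⟨g, hg, hgΨ⟩ := exists_isIteratedAction_vacuum (Λ := Λ) T hv
  have hvΩ : MemLp (fun z => v z • T.Ω) 2 (specMeasure κe κm) :=
    hgΨ ▸ memLp_bigPsi T (hg Fin.elim0).isBigTest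
  refine ⟨hvΩ, fun n f => ?_⟩
  obtain ⟨h, ζ, hh, hζ, hprod⟩ := exists_isFieldProduct T hΛ hg
    (ξ := hvΩ.toLp _) (by rw [hgΨ]; exact hvΩ.coeFn_toLp) f
  choose F hF using fun θ : Spec κe κm => exists_isTwistedProduct (toMat θ) f
  have hinner : (fun z => ⟪hvΩ.toLp _ z, ζ z⟫_ℂ) =ᵐ[specMeasure κe κm]
      fun z => T.npoint n (F z.2) * (‖v z‖ ^ 2 : ℝ) := by
    filter_upwards [hvΩ.coeFn_toLp, hζ] with z hzv hzζ
    rw [hzv, hzζ]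
    exact hh.inner_bigPsi T hv (hF z.2) z.1
  exact ⟨ζ, F, hprod, hF, (L2.integrable_inner (𝕜 := ℂ) _ _).congr hinner,
    (L2.inner_def _ _).trans (integral_congr_ae hinner)⟩

end Products

end WeylWigner

end

open WeylWigner in
theorem mainTheorem9 {K : ℕ} {H : Type*} [NormedAddCommGroup H] [InnerProductSpace ℂ H]
    [CompleteSpace H] [TopologicalSpace.SeparableSpace H] (T : Theory K H)
    (κe κm : ℝ) (hκ : ¬(κe = 0 ∧ κm = 0))
    (Λ : Spec κe κm → Matrix (Fin 4) (Fin 4) ℝ) (hΛ : IsFrame κe κm Λ) :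
    -- vectors `Ψ^⊗(𝐠)` are in the Hilbert space, and `f × 𝐠` stays in the test function space
    (∀ g : BigTest κe κm K, IsBigTest g → MemLp (bigPsi T g) 2 (specMeasure κe κm)) ∧
    (∀ (f : Test K) (g : BigTest κe κm K), IsBigTest g →
      ∃! h : BigTest κe κm K, IsBigTest h ∧ IsAction Λ f g h) ∧
    -- density of the domain
    smoothDomain κe κm T ≤ bigDomain κe κm T ∧
    Dense (smoothDomain κe κm T : Set (BigHilbert κe κm H)) ∧
    Dense (bigDomain κe κm T : Set (BigHilbert κe κm H)) ∧
    -- the fields are well defined on the domain and leave it invariant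
    (∀ f : Test K,
      (∀ ξ ∈ fieldGraph Λ T f, ξ.1 = 0 → ξ.2 = 0) ∧
      (field Λ T f).domain = bigDomain κe κm T ∧
      ∀ ξ : (field Λ T f).domain, field Λ T f ξ ∈ bigDomain κe κm T) ∧
    -- adjoints
    (∀ f : Test K, field Λ T (starTest T.bar f) ≤ (field Λ T f).adjoint) ∧
    -- expectation values
    (∀ v : Plane × Spec κe κm → ℂ, IsSmoothCompact v →
      ∃ hv : MemLp (fun z => v z • T.Ω) 2 (specMeasure κe κm),
        ∀ (n : ℕ) (f : Fin n → Test K),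
          ∃ (ζ : BigHilbert κe κm H) (F : Spec κe κm → TestN K n),
            IsFieldProduct Λ T (List.ofFn f) (hv.toLp _) ζ ∧
            (∀ θ : Spec κe κm, IsTwistedProduct (toMat θ) f (F θ)) ∧
            Integrable (fun z => T.npoint n (F z.2) * (‖v z‖ ^ 2 : ℝ)) (specMeasure κe κm) ∧
            inner ℂ (hv.toLp _) ζ =
              ∫ z, T.npoint n (F z.2) * (‖v z‖ ^ 2 : ℝ) ∂(specMeasure κe κm)) := by
  have := isLocallyFiniteMeasure_spec hκ
  have hd := dense_bigDomain (κe := κe) (κm := κm) T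
  exact ⟨fun _ hg => memLp_bigPsi T hg, fun f _ hg => existsUnique_isAction hΛ f hg,
    smoothDomain_le T, dense_smoothDomain T, hd,
    fun f => ⟨fieldGraph_single_valued T hΛ hd f, field_domain T hΛ f, field_mem T hΛ hd f⟩,
    fun f => field_starTest_le_adjoint T hΛ hd f, fun _ hv => exists_expectation T hΛ hv⟩
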